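/- Let $M$ be a smooth $2$-dimensional manifold, $T_0M=TM\setminus\{0\}$ its slit tangent bundle with projection $\pi$, $J=\frac{\partial}{\partial y^i}\otimes dx^i$ the tangent structure and $\mathcal C=y^i\frac{\partial}{\partial y^i}$ the Liouville vector field. An \emph{open cone} is an open set $A\subset T_0M$ invariant under the positive homotheties of the fibres (for instance $A=T_0M$). Let $S$ be a spray on an open cone $A$, that is, a smooth vector field on $A$ with $JS=\mathcal C$ and $[\mathcal C,S]=S$. Put $\Gamma=[J,S]$ (Frölicher–Nijenhuis bracket, so $\Gamma(X)=[JX,S]-J[X,S]$), $h=\frac12(\mathrm{Id}+\Gamma)$, $v=\frac12(\mathrm{Id}-\Gamma)$, $\Phi=v\circ[S,h]$ (Jacobi endomorphism), $\mathbb F=h\circ[S,h]-J$, and let $\rho$ (a function) and $\alpha$ (a semi-basic $1$-form) be determined by $\Phi=\rho J-\alpha\otimes\mathcal C$; these exist and are unique in dimension $2$. Assume that $S$ is non-flat on $A$: $\Phi$ and $\rho$ vanish nowhere on $A$. Let $$\Omega=d\Big(\frac{\alpha}{\rho}\Big)+2\,i_{\mathbb F}\frac{\alpha}{\rho}\wedge\frac{\alpha}{\rho},\qquad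 \mathcal D=\operatorname{Im}(h)\oplus\operatorname{Im}(\Phi).$$ Call $S$ \emph{regular} if $\Omega$ has rank $4$ at every point of $A$. A \emph{conic pseudo-Finsler function} on an open cone $A'\subset A$ is a smooth function $F>0$ on $A'$ with $F(x,\lambda y)=\lambda F(x,y)$ for $\lambda>0$, and with $\big(\frac12\frac{\partial^2F^2}{\partial y^i\partial y^j}\big)$ of rank $2$ everywhere; it \emph{metrizes} $S$ on $A'$ if $i_Sdd_JF^2=-dF^2$ on $A'$. Call $S$ \emph{Finsler metrizable} if every point of $A$ lies in an open cone $A'\subset A$ on which some conic pseudo-Finsler function metrizes $S$. \textbf{Theorem.} The following are equivalent: (i) $S$ is Finsler metrizable; (ii) $S$ is regular and the $3$-dimensional Berwald distribution $\mathcal D$ is integrable on $A$ (an integral manifold passes through every point of $A$); (iii) there is a smooth closed $1$-form $\omega$ on $A$, annihilating $\mathcal D$, such that $d_J\omega+2\,\omega\wedge i_J\omega$ has rank $4$ at every point of $A$, where $d_J\omega=i_Jd\omega-d\,i_J\omega$. Moreover, if $S$ is Finsler metrizable, then there is exactly one closed $1$-form $\omega$ on $A$ that annihilates $\mathcal D$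 and satisfies $\omega(\mathcal C)=1$. It satisfies the rank condition in (iii); every point of $A$ lies in an open cone $A'\subset A$ on which $\omega=df$ for some smooth function $f$; and, for every open cone $A'\subset A$ (including $A'=A$), a function $F$ on $A'$ is a conic pseudo-Finsler function that metrizes $S$ on $A'$ if and only if $F=\exp(f)$ for some smooth function $f$ on $A'$ with $\omega=df$ on $A'$. -/

import Mathlib

open scoped Manifold ContDiff

noncomputable section

namespace Spray

/-- The model space `ℝ²`. -/
abbrev E2 : Type := EuclideanSpace ℝ (Fin 2)

/-- The model space `ℝ² × ℝ²` of the tangent bundle of a surface, with coordinates `(x, y)`. -/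
abbrev E4 : Type := E2 × E2

/-- The model with corners of the tangent bundle of a surface. -/
abbrev IT : ModelWithCorners ℝ E4 (ModelProd E2 E2) := (𝓡 2).tangent

variable (M : Type*) [TopologicalSpace M] [ChartedSpace E2 M]

/-- The tangent bundle `TM` of a surface `M`. -/
abbrev TB : Type _ := TangentBundle (𝓡 2) M

variable {M} [IsManifold (𝓡 2) ∞ M]

/-! ### Tensor fields on the tangent bundle -/

/-- The tangent space `T_u(TM)`. -/
abbrev TT (u : TB M) : Type := TangentSpace IT u

variable (M) in
/-- Vector fields on `TM`. -/
abbrev VField : Type _ := (u : TB M) → TT u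

variable (M) in
/-- `1`-forms on `TM`. -/
abbrev Form1 : Type _ := (u : TB M) → (TT u →L[ℝ] ℝ)

variable (M) in
/-- Bilinear forms, in particular `2`-forms, on `TM`. -/
abbrev Form2 : Type _ := (u : TB M) → (TT u →ₗ[ℝ] TT u →ₗ[ℝ] ℝ)

variable (M) in
/-- Vector-valued `1`-forms (fields of endomorphisms of the tangent spaces) on `TM`. -/
abbrev Endo : Type _ := (u : TB M) → (TT u →L[ℝ] TT u)

/-- The vector field `X` is smooth on `A`. -/
def VField.SmoothOn (X : VField M) (A : Set (TB M)) : Prop :=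
  ContMDiffOn IT IT.tangent ∞ (fun u => (⟨u, X u⟩ : TangentBundle IT (TB M))) A

/-- The `1`-form `η` is smooth on `A` (as a section of the cotangent bundle of `TM`). -/
def Form1.SmoothOn (η : Form1 M) (A : Set (TB M)) : Prop :=
  ContMDiffOn IT (IT.prod 𝓘(ℝ, E4 →L[ℝ] ℝ)) ∞
    (fun u => Bundle.TotalSpace.mk' (E4 →L[ℝ] ℝ)
      (E := fun u : TB M => (TangentSpace IT u →L[ℝ] Bundle.Trivial (TB M) ℝ u)) u (η u)) A

/-- The differential at `u` of the chart of `TM` around `p`. -/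
def dchart (p u : TB M) : TT u →L[ℝ] E4 :=
  mfderiv IT 𝓘(ℝ, E4) (extChartAt IT p) u

/-- The differential of the inverse of the chart of `TM` around `p`, at the point of `ℝ² × ℝ²`
with coordinates `z`. -/
def dchartInv (p : TB M) (z : E4) : E4 →L[ℝ] TT ((extChartAt IT p).symm z) :=
  mfderiv 𝓘(ℝ, E4) IT (extChartAt IT p).symm z

/-- The components of a vector field in the chart of `TM` around `p`. -/
def localVField (X : VField M) (p : TB M) (z : E4) : E4 :=
  dchart p ((extChartAt IT p).symm z) (X ((extChartAt IT p).symm z))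

/-- The components of a vector-valued `1`-form in the chart of `TM` around `p`. -/
def localEndo (T : Endo M) (p : TB M) (z : E4) : E4 →L[ℝ] E4 :=
  (dchart p ((extChartAt IT p).symm z)).comp
    ((T ((extChartAt IT p).symm z)).comp (dchartInv p z))

/-- The components of a `1`-form in the chart of `TM` around `p`. -/
def localForm1 (η : Form1 M) (p : TB M) (z : E4) : E4 →L[ℝ] ℝ :=
  (η ((extChartAt IT p).symm z)).comp (dchartInv p z)

/-- The Lie derivative `ℒ_X T = [X, T]` (Frölicher–Nijenhuis bracket) of a vector-valued `1`-form
`T` along the vector field `X`, that is `[X, T](Y) = [X, T Y] - T [X, Y]`. In a chart, for a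
constant vector field `ξ`, it is `(D_X T) ξ - DX (T ξ) + T (DX ξ)`. -/
def lieDeriv (X : VField M) (T : Endo M) : Endo M := fun u =>
  let z : E4 := extChartAt IT u u
  let DX : E4 →L[ℝ] E4 := fderiv ℝ (localVField X u) z
  let DT : E4 →L[ℝ] E4 := fderiv ℝ (localEndo T u) z (localVField X u z)
  let L : E4 →L[ℝ] E4 := DT - DX.comp (localEndo T u z) + (localEndo T u z).comp DX
  ((dchart u u).inverse).comp (L.comp (dchart u u))

/-- The exterior derivative of a `1`-form: in a chart,
`dη (ξ, ζ) = (D_ξ η)(ζ) - (D_ζ η)(ξ)`. -/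
def extd (η : Form1 M) : Form2 M := fun u =>
  let D : E4 →L[ℝ] E4 →L[ℝ] ℝ := fderiv ℝ (localForm1 η u) (extChartAt IT u u)
  LinearMap.mk₂ ℝ
    (fun ξ ζ : TT u => D (dchart u u ξ) (dchart u u ζ) - D (dchart u u ζ) (dchart u u ξ))
    (by intros; simp only [map_add, add_apply]; ring)
    (by intros; simp only [map_smul, smul_apply, smul_eq_mul]; ring)
    (by intros; simp only [map_add, add_apply]; ring)
    (by intros; simp only [map_smul, smul_apply, smul_eq_mul]; ring)

/-- The differential of a function on `TM`. -/
def diff (f : TB M → ℝ) : Form1 M := fun u => mfderiv IT 𝓘(ℝ, ℝ) f u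

/-- The wedge product `(η ∧ θ)(ξ, ζ) = η(ξ) θ(ζ) - η(ζ) θ(ξ)` of two `1`-forms. -/
def wedge (η θ : Form1 M) : Form2 M := fun u =>
  LinearMap.mk₂ ℝ (fun ξ ζ : TT u => η u ξ * θ u ζ - η u ζ * θ u ξ)
    (by intros; simp only [map_add]; ring)
    (by intros; simp only [map_smul, smul_eq_mul]; ring)
    (by intros; simp only [map_add]; ring)
    (by intros; simp only [map_smul, smul_eq_mul]; ring)

/-- The contraction `i_T η = η ∘ T` of a `1`-form with a vector-valued `1`-form. -/
def contract (T : Endo M) (η : Form1 M) : Form1 M := fun u => (η u).comp (T u)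

/-- The contraction `(i_T B)(ξ, ζ) = B(T ξ, ζ) + B(ξ, T ζ)` of a `2`-form with a vector-valued
`1`-form. -/
def contract2 (T : Endo M) (B : Form2 M) : Form2 M := fun u =>
  (B u).compl₁₂ (T u).toLinearMap LinearMap.id + (B u).compl₁₂ LinearMap.id (T u).toLinearMap

/-- `d_T f = i_T df` for a function `f`. -/
def dAlong0 (T : Endo M) (f : TB M → ℝ) : Form1 M := contract T (diff f)

/-- `d_T η = i_T dη - d i_T η` for a `1`-form `η`. -/
def dAlong1 (T : Endo M) (η : Form1 M) : Form2 M := fun u =>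
  contract2 T (extd η) u - extd (contract T η) u

/-- The rank at `u` of a `2`-form. -/
def Form2.rankAt (B : Form2 M) (u : TB M) : ℕ :=
  Module.finrank ℝ (LinearMap.range (B u))

/-! ### The canonical structures of the tangent bundle -/

/-- The vertical lift `T_xM → T_u(TM)`, `x = π(u)`: the differential at `u` of the inclusion of
the fibre `T_xM` into `TM`. -/
def vlift (u : TB M) : E2 →L[ℝ] TT u :=
  mfderiv 𝓘(ℝ, E2) IT (fun w : E2 => (⟨u.proj, w⟩ : TB M)) u.snd

/-- The differential of the projection `π : TM → M`. -/
def dproj (u : TB M) : TT u →L[ℝ] E2 :=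
  mfderiv IT (𝓡 2) (fun w : TB M => w.proj) u

variable (M) in
/-- The tangent structure (vertical endomorphism) `J = ∂/∂yⁱ ⊗ dxⁱ`. -/
def J : Endo M := fun u => (vlift u).comp (dproj u)

variable (M) in
/-- The Liouville (dilation) vector field `𝒞 = yⁱ ∂/∂yⁱ`. -/
def liouville : VField M := fun u => vlift u u.snd

/-- Open conic subsets of the slit tangent bundle `T₀M = TM \ {0}`. -/
structure IsOpenCone (A : Set (TB M)) : Prop where
  isOpen : IsOpen A
  ne_zero : ∀ u ∈ A, u.snd ≠ 0
  smul_mem : ∀ u ∈ A, ∀ c : ℝ, 0 < c → (⟨u.proj, c • u.snd⟩ : TB M) ∈ A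

/-! ### Sprays -/

/-- `S` is a spray on the open cone `A`: a smooth vector field with `J S = 𝒞` and
`[𝒞, S] = S`. -/
structure IsSpray (S : VField M) (A : Set (TB M)) : Prop where
  smooth : VField.SmoothOn S A
  second_order : ∀ u ∈ A, J M u (S u) = liouville M u
  homogeneous : ∀ u ∈ A, VectorField.mlieBracket IT (liouville M) S u = S u

/-- The almost product structure `Γ = [J, S] = - [S, J]`. -/
def Gam (S : VField M) : Endo M := fun u => -(lieDeriv S (J M) u)

/-- The horizontal projector `h = (Id + Γ)/2`. -/
def hor (S : VField M) : Endo M := fun u =>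
  (1 / 2 : ℝ) • (ContinuousLinearMap.id ℝ (TT u) + Gam S u)

/-- The vertical projector `v = (Id - Γ)/2`. -/
def ver (S : VField M) : Endo M := fun u =>
  (1 / 2 : ℝ) • (ContinuousLinearMap.id ℝ (TT u) - Gam S u)

/-- The almost complex structure `𝔽 = h ∘ [S, h] - J`. -/
def cplx (S : VField M) : Endo M := fun u =>
  (hor S u).comp (lieDeriv S (hor S) u) - J M u

/-- The Jacobi endomorphism `Φ = v ∘ [S, h]`. -/
def jacobi (S : VField M) : Endo M := fun u => (ver S u).comp (lieDeriv S (hor S) u)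

/-- The pair `(ρ(u), α_u)` with `Φ = ρ J - α ⊗ 𝒞` at `u`. For a spray on a surface such a pair
exists and is unique at every `u ≠ 0`, and `α` is semi-basic. -/
def isotropyPair (S : VField M) (u : TB M) : ℝ × (TT u →L[ℝ] ℝ) :=
  Classical.epsilon fun p : ℝ × (TT u →L[ℝ] ℝ) =>
    ∀ ξ : TT u, jacobi S u ξ = p.1 • J M u ξ - p.2 ξ • liouville M u

/-- The Ricci scalar `ρ`. -/
def ricci (S : VField M) (u : TB M) : ℝ := (isotropyPair S u).1

/-- The semi-basic `1`-form `α`. -/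
def alpha (S : VField M) : Form1 M := fun u => (isotropyPair S u).2

/-- The `1`-form `α/ρ`. -/
def alphaRho (S : VField M) : Form1 M := fun u => (ricci S u)⁻¹ • alpha S u

/-- The spray `S` is non-flat on `A`: the Jacobi endomorphism and the Ricci scalar vanish
nowhere. -/
def NonFlat (S : VField M) (A : Set (TB M)) : Prop :=
  ∀ u ∈ A, jacobi S u ≠ 0 ∧ ricci S u ≠ 0

/-- The `2`-form `Ω = d(α/ρ) + 2 i_𝔽(α/ρ) ∧ α/ρ`. -/
def Omega (S : VField M) : Form2 M := fun u =>
  extd (alphaRho S) u + (2 : ℝ) • wedge (contract (cplx S) (alphaRho S)) (alphaRho S) u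

/-- The spray `S` is regular on `A`: `Ω` has rank `4` everywhere. -/
def Regular (S : VField M) (A : Set (TB M)) : Prop :=
  ∀ u ∈ A, (Omega S).rankAt u = 4

/-- The Berwald distribution `𝒟 = Im h ⊕ Im Φ`. -/
def berwald (S : VField M) (u : TB M) : Submodule ℝ (TT u) :=
  LinearMap.range (hor S u).toLinearMap ⊔ LinearMap.range (jacobi S u).toLinearMap

/-- A distribution `D` of rank `k` is integrable on the open set `A`: through every point of `A`
passes an integral manifold of `D`, given by a smooth immersion `ψ` of an open neighbourhood of
the origin of `ℝᵏ` whose tangent spaces are the spaces of the distribution. -/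
def IsIntegrable (k : ℕ) (D : (u : TB M) → Submodule ℝ (TT u)) (A : Set (TB M)) : Prop :=
  ∀ u ∈ A, ∃ (W : Set (EuclideanSpace ℝ (Fin k))) (ψ : EuclideanSpace ℝ (Fin k) → TB M),
    IsOpen W ∧ (0 : EuclideanSpace ℝ (Fin k)) ∈ W ∧ ContMDiffOn (𝓡 k) IT ∞ ψ W ∧ ψ 0 = u ∧
    ∀ t ∈ W, ψ t ∈ A ∧ Function.Injective (mfderiv (𝓡 k) IT ψ t) ∧
      LinearMap.range (mfderiv (𝓡 k) IT ψ t).toLinearMap = D (ψ t)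

/-! ### Finsler functions -/

/-- The metric tensor `g_{ij} = (1/2) ∂²F²/∂yⁱ∂yʲ` at `u`, as a bilinear form on the fibre. -/
def metricTensor (F : TB M → ℝ) (u : TB M) : E2 →ₗ[ℝ] E2 →L[ℝ] ℝ :=
  ((1 / 2 : ℝ) •
    fderiv ℝ (fun y : E2 => fderiv ℝ (fun w : E2 => F ⟨u.proj, w⟩ ^ 2) y) u.snd).toLinearMap

/-- `F` is a conic pseudo-Finsler function on the open cone `A` (a Finsler function when
`A = T₀M`): smooth, strictly positive, positively `1`-homogeneous, and with a metric tensor of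
maximal rank `2`. -/
structure IsFinsler (F : TB M → ℝ) (A : Set (TB M)) : Prop where
  smooth : ContMDiffOn IT 𝓘(ℝ, ℝ) ∞ F A
  pos : ∀ u ∈ A, 0 < F u
  homogeneous : ∀ u ∈ A, ∀ c : ℝ, 0 < c → F ⟨u.proj, c • u.snd⟩ = c * F u
  regular : ∀ u ∈ A, Module.finrank ℝ (LinearMap.range (metricTensor F u)) = 2

/-- The Euler–Lagrange equation `i_S d d_J F² = - d F²` on `A`. -/
def EulerLagrange (S : VField M) (F : TB M → ℝ) (A : Set (TB M)) : Prop :=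
  ∀ u ∈ A, ∀ ξ : TT u,
    extd (dAlong0 (J M) (fun w => F w ^ 2)) u (S u) ξ = - diff (fun w => F w ^ 2) u ξ

/-- The conic pseudo-Finsler function `F` on the open cone `A` metrizes `S` there. -/
def Metrizes (S : VField M) (F : TB M → ℝ) (A : Set (TB M)) : Prop :=
  IsFinsler F A ∧ EulerLagrange S F A

/-- The spray `S` on `A` is Finsler metrizable: around every point of `A` there is a conic
pseudo-Finsler function that metrizes `S`. -/
def Metrizable (S : VField M) (A : Set (TB M)) : Prop :=
  ∀ u ∈ A, ∃ A' ⊆ A, IsOpenCone A' ∧ u ∈ A' ∧ ∃ F : TB M → ℝ, Metrizes S F A'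

/-! ### Closed `1`-forms in the annihilator -/

/-- `θ` is a (smooth) closed `1`-form on `A`. -/
def IsClosedForm (θ : Form1 M) (A : Set (TB M)) : Prop :=
  Form1.SmoothOn θ A ∧ ∀ u ∈ A, extd θ u = 0

/-- `θ` belongs, on `A`, to the annihilator of the Berwald distribution. -/
def Annihilates (S : VField M) (θ : Form1 M) (A : Set (TB M)) : Prop :=
  ∀ u ∈ A, ∀ ξ ∈ berwald S u, θ u ξ = 0

/-- The `2`-form `d_J θ + 2 θ ∧ i_J θ`. -/
def rankForm (θ : Form1 M) : Form2 M := fun u =>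
  dAlong1 (J M) θ u + (2 : ℝ) • wedge θ (contract (J M) θ) u

/-- `f` is smooth on `A` and `df = θ` there. -/
def IsPrimitive (f : TB M → ℝ) (θ : Form1 M) (A : Set (TB M)) : Prop :=
  ContMDiffOn IT 𝓘(ℝ, ℝ) ∞ f A ∧ ∀ u ∈ A, diff f u = θ u

end Spray

end

/-!
Fix the chart of `TM` around a point: there `S = (y, s)` for a map `s` with values in `ℝ²`,
positively `2`-homogeneous in `y`, and everything is expressed through the connection `N = ½
∂s/∂y` and its curvature `R`, with `h (ξ, η) = (ξ, N ξ)` and `Φ (ξ, η) = (0, R ξ)`. Since `R y =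
0` and the fibre has dimension `2`, `R η = ρ (η - β(η) y)`, where `β = α/ρ` is normalized by `β(y)
= 1` and is homogeneous of degree `-1`. Hence `𝒟 = ker ω`, where `ω = i_𝔽(α/ρ)`, that is `ω (ξ, η)
= β (η - N ξ)`. This form satisfies `ω(𝒞) = 1` and `i_𝒞 dω = 0`
(`IsLocalSpray.extdL_omegaL_euler`), and every form that annihilates `𝒟` is the multiple `θ(𝒞) ω`
of it.

All three conditions of the theorem are equivalent to one (`IsClosedTransversal`): `dω = 0`, and
the vertical derivative `∂β/∂y` has no kernel inside `ker β`. The latter is what remains of each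
of the three rank conditions once `dω = 0`. Indeed, the metric tensor, `Ω` and `d_J ω + 2 ω ∧ i_J
ω` are then all governed by bilinear forms `∂β/∂y + k β ⊗ β` on the fibre with `k ≠ 1`, up to a
non-zero factor. As `∂β/∂y` is symmetric and `∂β/∂y (y) = -β`, such a form splits off the
direction of `y`, and the value of `k` plays no role (`IsLocalSpray.isTransversal_iff`).

* Metrizability. For a `2`-homogeneous solution `E` of the Euler-Lagrange equation,
  differentiating the equation vertically shows that `E` is constant along horizontal vectors, and
  differentiating once more along `S` that it is constant along the image of `Φ`; with homogeneity
  this reads `dE = 2 E ω` (`IsLocalSpray.fderiv_energy`), so `log F = ½ log E` is a primitive of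
  `ω`. Conversely the exponential of a primitive of `ω` is homogeneous because `ω(𝒞) = 1`, and it
  solves the Euler-Lagrange equation (`IsLocalSpray.eulerLagrange_of_fderiv`). If `dω = 0`,
  primitives exist on conic neighbourhoods (`IsLocalSpray.exists_primitive`).
* Integrability. Pulling `ω` back to an integral manifold shows that `dω` vanishes on `𝒟`, and
  hence everywhere, since `i_𝒞 dω = 0` (`IsLocalSpray.closed_of_integral`). Conversely a level set
  of a primitive is an integral manifold, and logarithmic homogeneity exhibits it as a graph over
  a slice transverse to `𝒞` (`IsLocalSpray.exists_integral`).
* Closed forms. If `θ = φ ω` is closed, contraction of `dθ = dφ ∧ ω + φ dω` with `𝒞` gives `dφ =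
  𝒞(φ) ω` and `φ dω = 0`, and the rank condition excludes the zeros of `φ`
  (`IsLocalSpray.closed_and_transversal`).

Brackets and exterior derivatives of tensor fields on `TM` are computed in the chart around the
base point. That the formulas hold in all charts is the naturality of the coordinate expressions
under changes of charts.
-/

noncomputable section

namespace Spray

open Set Filter Topology

variable {M : Type*} [TopologicalSpace M] [ChartedSpace E2 M] [IsManifold (𝓡 2) ∞ M]

/-! ### Naturality of the coordinate formulas -/
section Naturality
variable {E : Type*} [NormedAddCommGroup E] [NormedSpace ℝ E]

/-- The Lie derivative of a field of endomorphisms along a vector field, on a vector space. -/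
def lieL (X : E → E) (T : E → E →L[ℝ] E) (z : E) : E →L[ℝ] E :=
  fderiv ℝ T z (X z) - (fderiv ℝ X z).comp (T z) + (T z).comp (fderiv ℝ X z)

/-- The exterior derivative of a `1`-form on a vector space. -/
def extdL (η : E → E →L[ℝ] ℝ) (z ξ ζ : E) : ℝ := fderiv ℝ η z ξ ζ - fderiv ℝ η z ζ ξ

theorem fderiv_fderiv_symm {F : Type*} [NormedAddCommGroup F] [NormedSpace ℝ F] {φ : E → F}
    {z : E} (hφ : ContDiffAt ℝ 2 φ z) (ξ ζ : E) :
    fderiv ℝ (fderiv ℝ φ) z ξ ζ = fderiv ℝ (fderiv ℝ φ) z ζ ξ :=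
  (hφ.isSymmSndFDerivAt (by simp)).eq ξ ζ

theorem differentiableAt_fderiv {F : Type*} [NormedAddCommGroup F] [NormedSpace ℝ F]
    {φ : E → F} {z : E} (hφ : ContDiffAt ℝ 2 φ z) : DifferentiableAt ℝ (fderiv ℝ φ) z :=
  (hφ.fderiv_right (m := 1) (by norm_num)).differentiableAt one_ne_zero

/-- The derivative of the relation `X' ∘ φ = Dφ (X)`. -/
theorem fderiv_vectorField_comp {φ X X' : E → E} {z : E} (hφ : ContDiffAt ℝ 2 φ z)
    (hX : DifferentiableAt ℝ X z) (hX' : DifferentiableAt ℝ X' (φ z))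
    (h : ∀ᶠ w in 𝓝 z, X' (φ w) = fderiv ℝ φ w (X w)) (ζ : E) :
    fderiv ℝ X' (φ z) (fderiv ℝ φ z ζ) =
      fderiv ℝ (fderiv ℝ φ) z ζ (X z) + fderiv ℝ φ z (fderiv ℝ X z ζ) := by
  have h1 : HasFDerivAt (fun w => X' (φ w)) _ z :=
    hX'.hasFDerivAt.comp z (hφ.differentiableAt two_ne_zero).hasFDerivAt
  have h2 := (differentiableAt_fderiv hφ).hasFDerivAt.clm_apply hX.hasFDerivAt
  have := DFunLike.congr_fun (h1.unique (h2.congr_of_eventuallyEq h)) ζ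
  simp at this
  rw [this, add_comm]

/-- The Lie derivative of a field of endomorphisms commutes with changes of coordinates: `X'`, `T'`
are the fields `X`, `T` in the coordinates `φ`. -/
theorem lieL_natural {φ X X' : E → E} {T T' : E → E →L[ℝ] E} {z : E} (hφ : ContDiffAt ℝ 2 φ z)
    (hX : DifferentiableAt ℝ X z) (hX' : DifferentiableAt ℝ X' (φ z))
    (hT : DifferentiableAt ℝ T z) (hT' : DifferentiableAt ℝ T' (φ z))
    (h : ∀ᶠ w in 𝓝 z, X' (φ w) = fderiv ℝ φ w (X w))
    (h' : ∀ᶠ w in 𝓝 z, ∀ ξ, T' (φ w) (fderiv ℝ φ w ξ) = fderiv ℝ φ w (T w ξ)) (ξ : E) :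
    lieL X' T' (φ z) (fderiv ℝ φ z ξ) = fderiv ℝ φ z (lieL X T z ξ) := by
  have key := fderiv_vectorField_comp hφ hX hX' h
  have hd := (differentiableAt_fderiv hφ).hasFDerivAt
  have h1 : HasFDerivAt (fun w => T' (φ w)) _ z :=
    hT'.hasFDerivAt.comp z (hφ.differentiableAt two_ne_zero).hasFDerivAt
  have h2 := h1.clm_apply (hd.clm_apply (hasFDerivAt_const ξ z))
  have h3 := hd.clm_apply (hT.hasFDerivAt.clm_apply (hasFDerivAt_const ξ z))
  have e1 := DFunLike.congr_fun (h2.unique (h3.congr_of_eventuallyEq (h'.mono fun w hw => hw ξ)))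
    (X z)
  simp at e1
  have s1 := fderiv_fderiv_symm hφ (X z) ξ
  have s2 := fderiv_fderiv_symm hφ (X z) (T z ξ)
  simp only [lieL, add_apply, sub_apply, ContinuousLinearMap.comp_apply, key, h.self_of_nhds,
    h'.self_of_nhds, map_add, map_sub]
  rw [← s1, ← s2, eq_sub_of_add_eq' e1]
  abel

theorem lieBracket_natural {φ X X' Y Y' : E → E} {z : E} (hφ : ContDiffAt ℝ 2 φ z)
    (hX : DifferentiableAt ℝ X z) (hX' : DifferentiableAt ℝ X' (φ z))
    (hY : DifferentiableAt ℝ Y z) (hY' : DifferentiableAt ℝ Y' (φ z))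
    (h : ∀ᶠ w in 𝓝 z, X' (φ w) = fderiv ℝ φ w (X w))
    (h' : ∀ᶠ w in 𝓝 z, Y' (φ w) = fderiv ℝ φ w (Y w)) :
    VectorField.lieBracket ℝ X' Y' (φ z) = fderiv ℝ φ z (VectorField.lieBracket ℝ X Y z) := by
  simp only [VectorField.lieBracket, h.self_of_nhds, h'.self_of_nhds,
    fderiv_vectorField_comp hφ hX hX' h, fderiv_vectorField_comp hφ hY hY' h', map_sub]
  rw [fderiv_fderiv_symm hφ (X z) (Y z)]
  abel

/-- Pull-back commutes with the exterior derivative. Here `φ` may lower or raise the dimension, so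
that this applies both to changes of charts and to parametrized submanifolds. -/
theorem extdL_natural {F : Type*} [NormedAddCommGroup F] [NormedSpace ℝ F] {φ : F → E}
    {η : F → F →L[ℝ] ℝ} {η' : E → E →L[ℝ] ℝ} {z : F} (hφ : ContDiffAt ℝ 2 φ z)
    (hη : DifferentiableAt ℝ η z) (hη' : DifferentiableAt ℝ η' (φ z))
    (h : ∀ᶠ w in 𝓝 z, ∀ ξ, η' (φ w) (fderiv ℝ φ w ξ) = η w ξ) (ξ ζ : F) :
    extdL η' (φ z) (fderiv ℝ φ z ξ) (fderiv ℝ φ z ζ) = extdL η z ξ ζ := by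
  have hd := (differentiableAt_fderiv hφ).hasFDerivAt
  have h1 : HasFDerivAt (fun w => η' (φ w)) _ z :=
    hη'.hasFDerivAt.comp z (hφ.differentiableAt two_ne_zero).hasFDerivAt
  have key : ∀ ξ ζ, _ := fun ξ ζ => DFunLike.congr_fun ((h1.clm_apply
    (hd.clm_apply (hasFDerivAt_const ξ z))).unique
    ((hη.hasFDerivAt.clm_apply (hasFDerivAt_const ξ z)).congr_of_eventuallyEq
      (h.mono fun w hw => hw ξ))) ζ
  have e1 := key ξ ζ
  have e2 := key ζ ξ
  simp at e1 e2
  rw [fderiv_fderiv_symm hφ ζ ξ] at e1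
  simp only [extdL]
  linarith

end Naturality

/-! ### The charts of the tangent bundle -/

/-- The charts of `TM` are defined on whole fibres. The same holds for their targets. -/
theorem mem_chart_source {p u : TB M} :
    u ∈ (extChartAt IT p).source ↔ u.proj ∈ (chartAt E2 p.proj).source := by
  rw [FiberBundle.extChartAt]
  simp

theorem mem_chart_target {p : TB M} {z : E4} :
    z ∈ (extChartAt IT p).target ↔ z.1 ∈ (extChartAt (𝓡 2) p.proj).target := by
  rw [FiberBundle.extChartAt]
  have := fun h => (chartAt E2 p.proj).map_target (x := z.1) h
  simpa [PartialEquiv.trans_target]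

/-- The linear part of the chart of `TM` around `p` on the fibre through `u`. -/
def fibreMap (p u : TB M) : E2 →L[ℝ] E2 :=
  mfderiv (𝓡 2) 𝓘(ℝ, E2) (extChartAt (𝓡 2) p.proj) u.proj

/-- The chart of `TM` around `p` is linear on the fibres. -/
theorem chart_apply {p u : TB M} (hu : u ∈ (extChartAt IT p).source) :
    extChartAt IT p u = (extChartAt (𝓡 2) p.proj u.proj, fibreMap p u u.snd) := by
  rw [mem_chart_source] at hu
  have := TangentBundle.continuousLinearMapAt_trivializationAt (I := 𝓡 2) hu
  rw [FiberBundle.extChartAt, fibreMap, ← this]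
  refine Prod.ext rfl ?_
  change _ = Bundle.Trivialization.continuousLinearMapAt ℝ
    (trivializationAt E2 (TangentSpace (𝓡 2)) p.proj) u.proj u.snd
  rw [Bundle.Trivialization.continuousLinearMapAt_apply_of_mem]
  · rfl
  · simpa using hu

theorem chart_mk {p u : TB M} (hu : u ∈ (extChartAt IT p).source) (w : E2) :
    extChartAt IT p ⟨u.proj, w⟩ = ((extChartAt IT p u).1, fibreMap p u w) := by
  have h := chart_apply (p := p) (u := ⟨u.proj, w⟩) (mem_chart_source.2 (mem_chart_source.1 hu))
  exact h.trans (by rw [chart_apply hu]; rfl)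

theorem chart_smul {p u : TB M} (hu : u ∈ (extChartAt IT p).source) (c : ℝ) :
    extChartAt IT p ⟨u.proj, c • u.snd⟩ = ((extChartAt IT p u).1, c • (extChartAt IT p u).2) := by
  refine (chart_mk hu (c • u.snd)).trans ?_
  rw [chart_apply hu]
  exact congrArg _ (map_smul (fibreMap p u) c u.snd)

theorem chart_symm_smul {p : TB M} {z : E4} (hz : z ∈ (extChartAt IT p).target) (c : ℝ) :
    (extChartAt IT p).symm (z.1, c • z.2) =
      ⟨((extChartAt IT p).symm z).proj, c • ((extChartAt IT p).symm z).snd⟩ := by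
  have hu := (extChartAt IT p).map_target hz
  have := chart_smul hu c
  rw [(extChartAt IT p).right_inv hz] at this
  rw [← this]
  exact (extChartAt IT p).left_inv (mem_chart_source.2 (mem_chart_source.1 hu))

theorem chart_self_mk (u : TB M) (w : E2) :
    extChartAt IT u ⟨u.proj, w⟩ = ((extChartAt IT u u).1, w) := by
  rw [chart_mk (mem_extChartAt_source u), fibreMap, mfderiv_extChartAt_self]
  rfl

theorem chart_self_snd (u : TB M) : (extChartAt IT u u).2 = u.snd := by
  have := chart_self_mk u u.snd
  exact congrArg Prod.snd this

theorem chart_self_symm_mk (u : TB M) (w : E2) :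
    (extChartAt IT u).symm ((extChartAt IT u u).1, w) = ⟨u.proj, w⟩ := by
  rw [← chart_self_mk]
  exact (extChartAt IT u).left_inv (mem_chart_source.2 (mem_chart_source.1
    (mem_extChartAt_source (I := IT) u)))

/-! ### Components of tensor fields in a chart -/

/-- At `u` itself the chart around `u` has the identity as its differential: the fibre of the
tangent bundle of `TM` over `u` is the model space, read in the preferred chart around `u`. -/
theorem dchart_self (u : TB M) : dchart u u = ContinuousLinearMap.id ℝ (TT u) :=
  mfderiv_extChartAt_self

theorem dchart_self_apply (u : TB M) (ξ : TT u) : dchart u u ξ = ξ := by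
  rw [dchart_self]; rfl

theorem dchart_dchartInv (p : TB M) {z : E4} (hz : z ∈ (extChartAt IT p).target) (ξ : E4) :
    dchart p ((extChartAt IT p).symm z) (dchartInv p z ξ) = ξ := by
  have := mfderiv_extChartAt_comp_mfderivWithin_extChartAt_symm (I := IT) hz
  simp only [ModelWithCorners.range_eq_univ, mfderivWithin_univ] at this
  exact DFunLike.congr_fun this ξ

theorem dchartInv_dchart (p : TB M) {z : E4} (hz : z ∈ (extChartAt IT p).target)
    (ξ : TT ((extChartAt IT p).symm z)) :
    dchartInv p z (dchart p ((extChartAt IT p).symm z) ξ) = ξ := by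
  have := mfderivWithin_extChartAt_symm_comp_mfderiv_extChartAt (I := IT) hz
  simp only [ModelWithCorners.range_eq_univ, mfderivWithin_univ] at this
  exact DFunLike.congr_fun this ξ

theorem exists_symm_eq {p u : TB M} (hu : u ∈ (extChartAt IT p).source) :
    ∃ z ∈ (extChartAt IT p).target, (extChartAt IT p).symm z = u :=
  ⟨_, (extChartAt IT p).map_source hu, (extChartAt IT p).left_inv hu⟩

theorem dchart_bijective {p u : TB M} (hu : u ∈ (extChartAt IT p).source) :
    Function.Bijective (dchart p u) := by
  obtain ⟨z, hz, rfl⟩ := exists_symm_eq hu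
  exact Function.bijective_iff_has_inverse.2
    ⟨dchartInv p z, dchartInv_dchart p hz, dchart_dchartInv p hz⟩

theorem localVField_chart (X : VField M) {p u : TB M} (hu : u ∈ (extChartAt IT p).source) :
    localVField X p (extChartAt IT p u) = dchart p u (X u) := by
  obtain ⟨z, hz, rfl⟩ := exists_symm_eq hu
  rw [(extChartAt IT p).right_inv hz]
  rfl

theorem localEndo_chart (T : Endo M) {p u : TB M} (hu : u ∈ (extChartAt IT p).source) (ξ : TT u) :
    localEndo T p (extChartAt IT p u) (dchart p u ξ) = dchart p u (T u ξ) := by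
  obtain ⟨z, hz, rfl⟩ := exists_symm_eq hu
  rw [(extChartAt IT p).right_inv hz]
  change dchart p _ (T _ (dchartInv p z _)) = _
  rw [dchartInv_dchart p hz]

theorem localForm1_chart (η : Form1 M) {p u : TB M} (hu : u ∈ (extChartAt IT p).source)
    (ξ : TT u) : localForm1 η p (extChartAt IT p u) (dchart p u ξ) = η u ξ := by
  obtain ⟨z, hz, rfl⟩ := exists_symm_eq hu
  rw [(extChartAt IT p).right_inv hz]
  change η _ (dchartInv p z _) = _
  rw [dchartInv_dchart p hz]

/-- The change of charts from the chart of `TM` around `u` to the one around `p`. -/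
def transition (p u : TB M) : E4 → E4 := extChartAt IT p ∘ (extChartAt IT u).symm

theorem eventually_symm_mem_source {p u : TB M} (hu : u ∈ (extChartAt IT p).source) :
    ∀ᶠ z in 𝓝 (extChartAt IT u u), z ∈ (extChartAt IT u).target ∧
      (extChartAt IT u).symm z ∈ (extChartAt IT p).source := by
  refine Filter.Eventually.and (extChartAt_target_mem_nhds u) ?_
  exact (continuousAt_extChartAt_symm u).preimage_mem_nhds
    (by rw [extChartAt_to_inv]; exact (isOpen_extChartAt_source p).mem_nhds hu)

theorem contDiffAt_transition {p u : TB M} (hu : u ∈ (extChartAt IT p).source) :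
    ContDiffAt ℝ 2 (transition p u) (extChartAt IT u u) := by
  have h : extChartAt IT u u ∈ ((extChartAt IT u).symm ≫ extChartAt IT p).source := by
    simp only [PartialEquiv.trans_source, PartialEquiv.symm_source]
    exact (eventually_symm_mem_source hu).self_of_nhds
  have := contDiffWithinAt_ext_coord_change (I := IT) (n := ∞) p u h
  rw [ModelWithCorners.range_eq_univ, contDiffWithinAt_univ] at this
  exact this.of_le (WithTop.coe_le_coe.2 le_top)

theorem fderiv_transition {p u : TB M} {z : E4} (hz : z ∈ (extChartAt IT u).target)
    (hz' : (extChartAt IT u).symm z ∈ (extChartAt IT p).source)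
    (ξ : TT ((extChartAt IT u).symm z)) :
    fderiv ℝ (transition p u) z (dchart u ((extChartAt IT u).symm z) ξ) =
      dchart p ((extChartAt IT u).symm z) ξ := by
  have h1 : MDifferentiableAt IT 𝓘(ℝ, E4) (extChartAt IT p) ((extChartAt IT u).symm z) :=
    mdifferentiableAt_extChartAt (by rwa [← extChartAt_source IT])
  have h2 : MDifferentiableAt 𝓘(ℝ, E4) IT (extChartAt IT u).symm z := by
    have := mdifferentiableWithinAt_extChartAt_symm (I := IT) hz
    rwa [ModelWithCorners.range_eq_univ, mdifferentiableWithinAt_univ] at this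
  rw [← mfderiv_eq_fderiv, transition, mfderiv_comp z h1 h2]
  change dchart p _ (dchartInv u z _) = _
  rw [dchartInv_dchart u hz]

theorem transition_self {p u : TB M} :
    transition p u (extChartAt IT u u) = extChartAt IT p u := by
  rw [transition, Function.comp_apply, extChartAt_to_inv]

/-- The differential of the change of charts at the centre of the first chart. -/
theorem fderiv_transition_self {p u : TB M} (hu : u ∈ (extChartAt IT p).source) (ξ : TT u) :
    fderiv ℝ (transition p u) (extChartAt IT u u) ξ = dchart p u ξ := by
  have : ∀ v, v ∈ (extChartAt IT u).source → v ∈ (extChartAt IT p).source → ∀ ξ : TT v,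
      fderiv ℝ (transition p u) (extChartAt IT u v) (dchart u v ξ) = dchart p v ξ := by
    intro v hv hv' ξ
    obtain ⟨z, hz, rfl⟩ := exists_symm_eq hv
    rw [(extChartAt IT u).right_inv hz]
    exact fderiv_transition hz hv' ξ
  have := this u (mem_extChartAt_source u) hu ξ
  rwa [dchart_self_apply] at this

theorem localVField_transition (X : VField M) {p u : TB M} (hu : u ∈ (extChartAt IT p).source) :
    ∀ᶠ z in 𝓝 (extChartAt IT u u), localVField X p (transition p u z) =
      fderiv ℝ (transition p u) z (localVField X u z) := by
  filter_upwards [eventually_symm_mem_source hu] with z hz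
  change _ = fderiv ℝ (transition p u) z (dchart u _ _)
  rw [fderiv_transition hz.1 hz.2]
  exact localVField_chart X hz.2

theorem localEndo_transition (T : Endo M) {p u : TB M} (hu : u ∈ (extChartAt IT p).source) :
    ∀ᶠ z in 𝓝 (extChartAt IT u u), ∀ ξ,
      localEndo T p (transition p u z) (fderiv ℝ (transition p u) z ξ) =
        fderiv ℝ (transition p u) z (localEndo T u z ξ) := by
  filter_upwards [eventually_symm_mem_source hu] with z hz ξ
  change _ = fderiv ℝ (transition p u) z (dchart u _ _)
  rw [fderiv_transition hz.1 hz.2]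
  conv_lhs => rw [← dchart_dchartInv u hz.1 ξ]
  rw [fderiv_transition hz.1 hz.2]
  exact localEndo_chart T hz.2 _

theorem localForm1_transition (η : Form1 M) {p u : TB M} (hu : u ∈ (extChartAt IT p).source) :
    ∀ᶠ z in 𝓝 (extChartAt IT u u), ∀ ξ,
      localForm1 η p (transition p u z) (fderiv ℝ (transition p u) z ξ) = localForm1 η u z ξ := by
  filter_upwards [eventually_symm_mem_source hu] with z hz ξ
  conv_lhs => rw [← dchart_dchartInv u hz.1 ξ]
  rw [fderiv_transition hz.1 hz.2]
  exact localForm1_chart η hz.2 _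

/-- `lieDeriv` is defined in the chart around the base point, but may be computed in any chart. -/
theorem dchart_lieDeriv {X : VField M} {T : Endo M} {p u : TB M}
    (hu : u ∈ (extChartAt IT p).source)
    (hX : DifferentiableAt ℝ (localVField X u) (extChartAt IT u u))
    (hX' : DifferentiableAt ℝ (localVField X p) (extChartAt IT p u))
    (hT : DifferentiableAt ℝ (localEndo T u) (extChartAt IT u u))
    (hT' : DifferentiableAt ℝ (localEndo T p) (extChartAt IT p u)) (ξ : TT u) :
    dchart p u (lieDeriv X T u ξ) =
      lieL (localVField X p) (localEndo T p) (extChartAt IT p u) (dchart p u ξ) := by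
  have e : lieDeriv X T u ξ = lieL (localVField X u) (localEndo T u) (extChartAt IT u u) ξ := by
    change (dchart u u).inverse (lieL _ _ _ (dchart u u ξ)) = _
    rw [dchart_self_apply, dchart_self]
    exact DFunLike.congr_fun (ContinuousLinearMap.inverse_id) _
  rw [← transition_self (p := p) (u := u)] at hX' hT' ⊢
  rw [← fderiv_transition_self hu, ← fderiv_transition_self hu, e]
  exact (lieL_natural (contDiffAt_transition hu) hX hX' hT hT' (localVField_transition X hu)
    (localEndo_transition T hu) ξ).symm

theorem extd_self (η : Form1 M) (u : TB M) (ξ ζ : TT u) :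
    extd η u ξ ζ = extdL (localForm1 η u) (extChartAt IT u u) ξ ζ := by
  change extdL (localForm1 η u) (extChartAt IT u u) (dchart u u ξ) (dchart u u ζ) = _
  rw [dchart_self_apply, dchart_self_apply]

/-- `extd` is defined in the chart around the base point, but may be computed in any chart. -/
theorem extd_eq {η : Form1 M} {p u : TB M} (hu : u ∈ (extChartAt IT p).source)
    (hη : DifferentiableAt ℝ (localForm1 η u) (extChartAt IT u u))
    (hη' : DifferentiableAt ℝ (localForm1 η p) (extChartAt IT p u)) (ξ ζ : TT u) :
    extd η u ξ ζ =
      extdL (localForm1 η p) (extChartAt IT p u) (dchart p u ξ) (dchart p u ζ) := by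
  rw [extd_self]
  rw [← transition_self (p := p) (u := u)] at hη' ⊢
  rw [← fderiv_transition_self hu, ← fderiv_transition_self hu]
  exact (extdL_natural (contDiffAt_transition hu) hη hη' (localForm1_transition η hu) ξ ζ).symm

theorem mlieBracket_self_chart (X Y : VField M) (u : TB M) :
    VectorField.mlieBracket IT X Y u =
      VectorField.lieBracket ℝ (localVField X u) (localVField Y u) (extChartAt IT u u) := by
  have h : ∀ Z : VField M, ∀ᶠ z in 𝓝 (extChartAt IT u u),
      VectorField.mpullback 𝓘(ℝ, E4) IT (extChartAt IT u).symm Z z = localVField Z u z := by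
    intro Z
    filter_upwards [extChartAt_target_mem_nhds u] with z hz
    change (dchartInv u z).inverse _ = _
    have : (dchartInv u z).inverse = dchart u ((extChartAt IT u).symm z) :=
      ContinuousLinearMap.inverse_eq (ContinuousLinearMap.ext fun ξ => dchartInv_dchart u hz ξ)
        (ContinuousLinearMap.ext fun ξ => dchart_dchartInv u hz ξ)
    rw [this]; rfl
  rw [← VectorField.mlieBracketWithin_univ, VectorField.mlieBracketWithin_apply]
  simp only [ModelWithCorners.range_eq_univ, preimage_univ, univ_inter,
    VectorField.mpullbackWithin_univ]
  rw [mfderiv_extChartAt_self]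
  refine (DFunLike.congr_fun (ContinuousLinearMap.inverse_id) _).trans ?_
  exact (congrFun (VectorField.lieBracketWithin_univ (𝕜 := ℝ) (E := E4)) _).trans
    (Filter.EventuallyEq.lieBracket_vectorField_eq (h X) (h Y))

theorem dchart_mlieBracket {X Y : VField M} {p u : TB M}
    (hu : u ∈ (extChartAt IT p).source)
    (hX : DifferentiableAt ℝ (localVField X u) (extChartAt IT u u))
    (hX' : DifferentiableAt ℝ (localVField X p) (extChartAt IT p u))
    (hY : DifferentiableAt ℝ (localVField Y u) (extChartAt IT u u))
    (hY' : DifferentiableAt ℝ (localVField Y p) (extChartAt IT p u)) :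
    dchart p u (VectorField.mlieBracket IT X Y u) =
      VectorField.lieBracket ℝ (localVField X p) (localVField Y p) (extChartAt IT p u) := by
  rw [← transition_self (p := p) (u := u)] at hX' hY' ⊢
  rw [← fderiv_transition_self hu, mlieBracket_self_chart]
  exact (lieBracket_natural (contDiffAt_transition hu) hX hX' hY hY' (localVField_transition X hu)
    (localVField_transition Y hu)).symm

/-! ### The canonical structures, smoothness and functions in a chart -/

theorem mdifferentiableAt_chart {p u : TB M} (hu : u ∈ (extChartAt IT p).source) :
    MDifferentiableAt IT 𝓘(ℝ, E4) (extChartAt IT p) u :=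
  mdifferentiableAt_extChartAt (by rwa [← extChartAt_source IT])

/-- The inclusion of the fibre through `u`. -/
def fibreIncl (u : TB M) (w : E2) : TB M := ⟨u.proj, w⟩

theorem mdifferentiable_fibreIncl (u : TB M) (w : E2) :
    MDifferentiableAt 𝓘(ℝ, E2) IT (fibreIncl u) w := by
  refine ContMDiffAt.mdifferentiableAt (n := 1) ?_ one_ne_zero
  refine Bundle.contMDiffAt_totalSpace.2 ⟨contMDiffAt_const, ?_⟩
  have : (fun w : E2 => (trivializationAt E2 (TangentSpace (𝓡 2)) u.proj (fibreIncl u w)).2)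
      = fun w => w := by
    funext w
    have := congrArg Prod.snd (chart_self_mk u w)
    rw [FiberBundle.extChartAt] at this
    exact this
  change ContMDiffAt _ _ _ (fun w : E2 =>
    (trivializationAt E2 (TangentSpace (𝓡 2)) u.proj (fibreIncl u w)).2) _
  rw [this]
  exact contMDiffAt_id

theorem dchart_vlift {p u : TB M} (hu : u ∈ (extChartAt IT p).source) (w : E2) :
    dchart p u (vlift u w) = (0, fibreMap p u w) := by
  have key : ∀ w₀ : E2, (dchart p (fibreIncl u w₀)).comp (mfderiv 𝓘(ℝ, E2) IT (fibreIncl u) w₀) =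
      (0 : E2 →L[ℝ] E2).prod (fibreMap p u) := by
    intro w₀
    have h2 := mfderiv_comp (I := 𝓘(ℝ, E2)) (I' := IT) (I'' := 𝓘(ℝ, E4)) (f := fibreIncl u) w₀
      (mdifferentiableAt_chart (mem_chart_source.2 (mem_chart_source.1 hu)))
      (mdifferentiable_fibreIncl u w₀)
    have h3 : (extChartAt IT p) ∘ fibreIncl u =
        fun w => ((extChartAt IT p u).1, fibreMap p u w) := funext fun w => chart_mk hu w
    have h4 : HasFDerivAt (fun w : E2 => ((extChartAt IT p u).1, fibreMap p u w))
        ((0 : E2 →L[ℝ] E2).prod (fibreMap p u)) w₀ :=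
      (hasFDerivAt_const _ _).prodMk (fibreMap p u).hasFDerivAt
    rw [h3, mfderiv_eq_fderiv, h4.fderiv] at h2
    exact h2.symm
  exact DFunLike.congr_fun (key u.snd) w

theorem fibreMap_dproj {p u : TB M} (hu : u ∈ (extChartAt IT p).source) (ξ : TT u) :
    fibreMap p u (dproj u ξ) = (dchart p u ξ).1 := by
  have h1 : MDifferentiableAt IT (𝓡 2) (fun w : TB M => w.proj) u :=
    (Bundle.contMDiff_proj (IB := 𝓡 2) (n := 1) (TangentSpace (𝓡 2)) u).mdifferentiableAt
      one_ne_zero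
  have h2 : MDifferentiableAt (𝓡 2) 𝓘(ℝ, E2) (extChartAt (𝓡 2) p.proj) u.proj :=
    mdifferentiableAt_extChartAt (mem_chart_source.1 hu)
  have h3 := mfderiv_comp (I := IT) (I' := 𝓡 2) (I'' := 𝓘(ℝ, E2)) u h2 h1
  have h4 : (extChartAt (𝓡 2) p.proj ∘ fun w : TB M => w.proj) =ᶠ[𝓝 u]
      (fun z : E4 => z.1) ∘ extChartAt IT p := by
    filter_upwards [(isOpen_extChartAt_source p).mem_nhds hu] with w hw
    simp only [Function.comp_apply]
    rw [chart_apply hw]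
  rw [h4.mfderiv_eq, mfderiv_comp u (I' := 𝓘(ℝ, E4))
    (differentiableAt_fst.mdifferentiableAt) (mdifferentiableAt_chart hu), mfderiv_eq_fderiv,
    fderiv_fst] at h3
  exact (DFunLike.congr_fun h3 ξ).symm

/-- In a chart, `J (ξ, η) = (0, ξ)`. -/
theorem dchart_J {p u : TB M} (hu : u ∈ (extChartAt IT p).source) (ξ : TT u) :
    dchart p u (J M u ξ) = (0, (dchart p u ξ).1) := by
  rw [← fibreMap_dproj hu, ← dchart_vlift hu]
  rfl

/-- In a chart, `𝒞 = (0, y)`. -/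
theorem dchart_liouville {p u : TB M} (hu : u ∈ (extChartAt IT p).source) :
    dchart p u (liouville M u) = (0, (extChartAt IT p u).2) := by
  rw [chart_apply hu]
  exact dchart_vlift hu u.snd

theorem localVField_contDiffAt {X : VField M} {A : Set (TB M)} (hA : IsOpen A) (hX : X.SmoothOn A)
    {p u : TB M} (hu : u ∈ (extChartAt IT p).source) (huA : u ∈ A) :
    ContDiffAt ℝ ∞ (localVField X p) (extChartAt IT p u) := by
  have h1 := (hX u huA).contMDiffAt (hA.mem_nhds huA)
  have hmem : u ∈ (trivializationAt E4 (TangentSpace IT) p).baseSet := by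
    simpa using hu
  have h2 :=
    ((trivializationAt E4 (TangentSpace IT) p).contMDiffAt_section_iff (IB := IT) hmem).1 h1
  have h3 : (fun v => dchart p v (X v)) =ᶠ[𝓝 u]
      fun v => (trivializationAt E4 (TangentSpace IT) p ⟨v, X v⟩).2 := by
    filter_upwards [(isOpen_extChartAt_source (I := IT) p).mem_nhds hu] with v hv
    have hv' : v ∈ (chartAt (ModelProd E2 E2) p).source := by rwa [← extChartAt_source IT]
    have := TangentBundle.continuousLinearMapAt_trivializationAt (I := IT) hv'
    rw [dchart, ← this, Bundle.Trivialization.continuousLinearMapAt_apply_of_mem]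
    simpa using hv
  have h4 : ContMDiffAt IT 𝓘(ℝ, E4) ∞ (fun v => dchart p v (X v)) u := h2.congr_of_eventuallyEq h3
  have h5 : ContMDiffAt 𝓘(ℝ, E4) IT ∞ (extChartAt IT p).symm (extChartAt IT p u) :=
    (contMDiffOn_extChartAt_symm p).contMDiffAt
      ((isOpen_extChartAt_target p).mem_nhds ((extChartAt IT p).map_source hu))
  have h6 : ContMDiffAt 𝓘(ℝ, E4) 𝓘(ℝ, E4) ∞
      ((fun v => dchart p v (X v)) ∘ (extChartAt IT p).symm) (extChartAt IT p u) := by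
    refine ContMDiffAt.comp (I' := IT) _ ?_ h5
    rwa [(extChartAt IT p).left_inv hu]
  exact h6.contDiffAt

/-- A function on `TM`, read in the chart around `p`. -/
def localFun (f : TB M → ℝ) (p : TB M) : E4 → ℝ := f ∘ (extChartAt IT p).symm

theorem localFun_contDiffAt {f : TB M → ℝ} {p u : TB M} (hu : u ∈ (extChartAt IT p).source)
    (hf : ContMDiffAt IT 𝓘(ℝ, ℝ) ∞ f u) :
    ContDiffAt ℝ ∞ (localFun f p) (extChartAt IT p u) := by
  have h5 : ContMDiffAt 𝓘(ℝ, E4) IT ∞ (extChartAt IT p).symm (extChartAt IT p u) :=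
    (contMDiffOn_extChartAt_symm p).contMDiffAt
      ((isOpen_extChartAt_target p).mem_nhds ((extChartAt IT p).map_source hu))
  have h6 : ContMDiffAt 𝓘(ℝ, E4) 𝓘(ℝ, ℝ) ∞ (f ∘ (extChartAt IT p).symm) (extChartAt IT p u) := by
    refine ContMDiffAt.comp (I' := IT) _ ?_ h5
    rwa [(extChartAt IT p).left_inv hu]
  exact h6.contDiffAt

theorem fderiv_localFun {f : TB M → ℝ} {p u : TB M} (hu : u ∈ (extChartAt IT p).source)
    (hf : MDifferentiableAt IT 𝓘(ℝ, ℝ) f u) (ξ : TT u) :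
    fderiv ℝ (localFun f p) (extChartAt IT p u) (dchart p u ξ) = diff f u ξ := by
  obtain ⟨z, hz, rfl⟩ := exists_symm_eq hu
  have h2 : MDifferentiableAt 𝓘(ℝ, E4) IT (extChartAt IT p).symm z := by
    have := mdifferentiableWithinAt_extChartAt_symm (I := IT) hz
    rwa [ModelWithCorners.range_eq_univ, mdifferentiableWithinAt_univ] at this
  rw [(extChartAt IT p).right_inv hz, ← mfderiv_eq_fderiv, localFun, mfderiv_comp z hf h2]
  change diff f _ (dchartInv p z _) = _
  rw [dchartInv_dchart p hz]

theorem contMDiffAt_of_localFun {f : TB M → ℝ} {p u : TB M} (hu : u ∈ (extChartAt IT p).source)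
    (hf : ContDiffAt ℝ ∞ (localFun f p) (extChartAt IT p u)) :
    ContMDiffAt IT 𝓘(ℝ, ℝ) ∞ f u := by
  have h1 : ContMDiffAt IT 𝓘(ℝ, E4) ∞ (extChartAt IT p) u :=
    contMDiffAt_extChartAt' (by rwa [← extChartAt_source IT])
  have h2 : ContMDiffAt IT 𝓘(ℝ, ℝ) ∞ (localFun f p ∘ extChartAt IT p) u :=
    ContMDiffAt.comp (I' := 𝓘(ℝ, E4)) u hf.contMDiffAt h1
  refine h2.congr_of_eventuallyEq ?_
  filter_upwards [(isOpen_extChartAt_source (I := IT) p).mem_nhds hu] with v hv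
  rw [localFun, Function.comp_apply, Function.comp_apply, (extChartAt IT p).left_inv hv]

/-- A `1`-form is smooth at `u`, as a section of the cotangent bundle, exactly if its components in
the chart around `u` are smooth. -/
theorem form1_contMDiffAt_iff (η : Form1 M) (u : TB M) :
    ContMDiffAt IT (IT.prod 𝓘(ℝ, E4 →L[ℝ] ℝ)) ∞
    (fun u => Bundle.TotalSpace.mk' (E4 →L[ℝ] ℝ)
      (E := fun u : TB M => (TangentSpace IT u →L[ℝ] Bundle.Trivial (TB M) ℝ u)) u (η u)) u ↔
    ContDiffAt ℝ ∞ (localForm1 η u) (extChartAt IT u u) := by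
  rw [contMDiffAt_hom_bundle]
  have h0 : ∀ v ∈ (extChartAt IT u).source,
      ContinuousLinearMap.inCoordinates E4 (TangentSpace IT) ℝ (Bundle.Trivial (TB M) ℝ)
        u v u v (η v) = localForm1 η u (extChartAt IT u v) := by
    intro v hv
    have hv' : v ∈ (chartAt (ModelProd E2 E2) u).source := by rwa [← extChartAt_source IT]
    have := TangentBundle.symmL_trivializationAt (I := IT) hv'
    rw [ContinuousLinearMap.inCoordinates, this]
    refine ContinuousLinearMap.ext fun ξ => ?_
    obtain ⟨ζ, rfl⟩ := (dchart_bijective hv).2 ξ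
    rw [localForm1_chart η hv]
    have h := mfderivWithin_extChartAt_symm_comp_mfderiv_extChartAt' (I := IT) hv
    have h' := congrArg (η v) (DFunLike.congr_fun h ζ)
    refine Eq.trans ?_ h'
    simp
    rfl
  have h1 : ContMDiffAt IT IT ∞ (fun v : TB M => v) u := contMDiffAt_id
  have e1 : ContMDiffAt IT 𝓘(ℝ, E4) ∞ (extChartAt IT u) u := contMDiffAt_extChartAt
  have e2 : ContMDiffAt 𝓘(ℝ, E4) IT ∞ (extChartAt IT u).symm (extChartAt IT u u) :=
    (contMDiffOn_extChartAt_symm u).contMDiffAt (extChartAt_target_mem_nhds u)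
  have e3 : (fun v => ContinuousLinearMap.inCoordinates E4 (TangentSpace IT) ℝ
      (Bundle.Trivial (TB M) ℝ) u v u v (η v)) =ᶠ[𝓝 u] localForm1 η u ∘ extChartAt IT u := by
    filter_upwards [extChartAt_source_mem_nhds (I := IT) u] with v hv using h0 v hv
  refine (and_iff_right h1).trans ⟨fun h => ?_, fun h => ?_⟩
  · have h2 := h.congr_of_eventuallyEq e3.symm
    have h3 : ContMDiffAt 𝓘(ℝ, E4) 𝓘(ℝ, E4 →L[ℝ] ℝ) ∞
        ((localForm1 η u ∘ extChartAt IT u) ∘ (extChartAt IT u).symm) (extChartAt IT u u) := by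
      refine ContMDiffAt.comp (I' := IT) _ ?_ e2
      rwa [extChartAt_to_inv]
    refine h3.contDiffAt.congr_of_eventuallyEq ?_
    filter_upwards [extChartAt_target_mem_nhds (I := IT) u] with z hz
    rw [Function.comp_apply, Function.comp_apply, (extChartAt IT u).right_inv hz]
  · have h2 : ContMDiffAt IT 𝓘(ℝ, E4 →L[ℝ] ℝ) ∞ (localForm1 η u ∘ extChartAt IT u) u :=
      ContMDiffAt.comp (I' := 𝓘(ℝ, E4)) u h.contMDiffAt e1
    exact h2.congr_of_eventuallyEq e3

/-! ### Sprays in a chart -/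

/-- The rotation of the Euclidean plane by a right angle. -/
def rot : E2 →L[ℝ] E2 :=
  LinearMap.toContinuousLinearMap
    { toFun := fun y => !₂[-y 1, y 0]
      map_add' := fun y z => by ext i; fin_cases i <;> simp [add_comm]
      map_smul' := fun c y => by ext i; fin_cases i <;> simp }

theorem rot_apply_zero (y : E2) : rot y 0 = -y 1 := rfl
theorem rot_apply_one (y : E2) : rot y 1 = y 0 := rfl

theorem inner_eq (a b : E2) : inner ℝ a b = a 0 * b 0 + a 1 * b 1 := by
  simp [PiLp.inner_apply, Fin.sum_univ_two, mul_comm]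

/-- The decomposition of a vector in the orthogonal basis `y`, `rot y`, without divisions. -/
theorem rot_decomposition (y η : E2) :
    inner ℝ y y • η = inner ℝ (rot y) η • rot y + inner ℝ y η • y := by
  rw [inner_eq, inner_eq, inner_eq]
  ext i
  fin_cases i <;> simp [rot_apply_zero, rot_apply_one] <;> ring

/-- The vector field `(y, s)` with components `y` and `s(x, y)`. -/
def sprayField (s : E4 → E2) (z : E4) : E4 := (z.2, s z)

/-- The connection `N = ½ ∂s/∂y` of the spray `(y, s)`; with this sign, the horizontal vectors are
the `(ξ, N ξ)`. -/
def connL (s : E4 → E2) (z : E4) : E2 →L[ℝ] E2 :=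
  (1 / 2 : ℝ) • (fderiv ℝ s z).comp (ContinuousLinearMap.inr ℝ E2 E2)

/-- The curvature `R` of the spray `(y, s)`, with `Φ (ξ, η) = (0, R ξ)`. -/
def curvL (s : E4 → E2) (z : E4) : E2 →L[ℝ] E2 :=
  fderiv ℝ (connL s) z (sprayField s z) - (fderiv ℝ s z).comp (ContinuousLinearMap.inl ℝ E2 E2) -
    (connL s z).comp (connL s z)

/-- The components of `α`. As `R y = 0`, the endomorphism `R` is determined by `R (rot y)`, and
`α(η) = ⟨R (rot y), rot η⟩ / ⟨y, y⟩` is the form with `R η = α(y) η - α(η) y`. -/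
def alphaL (s : E4 → E2) (z : E4) : E2 →L[ℝ] ℝ :=
  (inner ℝ z.2 z.2)⁻¹ • (innerSL ℝ (curvL s z (rot z.2))).comp rot

/-- The components `β` of `α/ρ`, where `ρ = α(S) = α(y)`. As `α` is semi-basic, it is encoded as a
form on the base directions. -/
def betaL (s : E4 → E2) (z : E4) : E2 →L[ℝ] ℝ := (alphaL s z z.2)⁻¹ • alphaL s z

/-- The vertical part of a vector for the connection `N`. -/
def verL (s : E4 → E2) (z : E4) : E4 →L[ℝ] E2 :=
  ContinuousLinearMap.snd ℝ E2 E2 - (connL s z).comp (ContinuousLinearMap.fst ℝ E2 E2)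

/-- The `1`-form `i_𝔽(α/ρ)`, which annihilates the Berwald distribution. -/
def omegaL (s : E4 → E2) (z : E4) : E4 →L[ℝ] ℝ := (betaL s z).comp (verL s z)

/-- `(y, s)` is a spray on the open set `V`, disjoint from the zero section. Homogeneity is
encoded by the Euler relation. -/
structure IsSprayOn (s : E4 → E2) (V : Set E4) : Prop where
  isOpen : IsOpen V
  smooth : ∀ z ∈ V, ContDiffAt ℝ ∞ s z
  ne_zero : ∀ z ∈ V, z.2 ≠ 0
  euler : ∀ z ∈ V, fderiv ℝ s z (0, z.2) = (2 : ℝ) • s z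

/-- `(y, s)` is a spray on the open set `V`, with nowhere vanishing Ricci scalar. -/
structure IsLocalSpray (s : E4 → E2) (V : Set E4) : Prop extends IsSprayOn s V where
  nonflat : ∀ z ∈ V, alphaL s z z.2 ≠ 0

theorem connL_apply (s : E4 → E2) (z : E4) (η : E2) :
    connL s z η = (1 / 2 : ℝ) • fderiv ℝ s z (0, η) := rfl

theorem two_smul_connL (s : E4 → E2) (z : E4) (η : E2) :
    fderiv ℝ s z (0, η) = (2 : ℝ) • connL s z η := by
  rw [connL_apply, smul_smul]; norm_num

theorem curvL_apply (s : E4 → E2) (z : E4) (η : E2) :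
    curvL s z η = fderiv ℝ (connL s) z (sprayField s z) η - fderiv ℝ s z (η, 0) -
      connL s z (connL s z η) := rfl

theorem alphaL_apply (s : E4 → E2) (z : E4) (η : E2) :
    alphaL s z η = (inner ℝ z.2 z.2)⁻¹ * inner ℝ (curvL s z (rot z.2)) (rot η) := rfl

theorem betaL_apply (s : E4 → E2) (z : E4) (η : E2) :
    betaL s z η = (alphaL s z z.2)⁻¹ * alphaL s z η := rfl

theorem verL_apply (s : E4 → E2) (z ξ : E4) : verL s z ξ = ξ.2 - connL s z ξ.1 := rfl

theorem omegaL_apply (s : E4 → E2) (z ξ : E4) :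
    omegaL s z ξ = betaL s z (ξ.2 - connL s z ξ.1) := rfl

theorem fderiv_split (s : E4 → E2) (z ξ : E4) :
    fderiv ℝ s z ξ = fderiv ℝ s z (ξ.1, 0) + (2 : ℝ) • connL s z ξ.2 := by
  rw [← two_smul_connL, ← map_add]
  simp

theorem hasFDerivAt_vert (z : E4) : HasFDerivAt (fun w : E4 => ((0, w.2) : E4))
    ((ContinuousLinearMap.inr ℝ E2 E2).comp (ContinuousLinearMap.snd ℝ E2 E2)) z :=
  ((ContinuousLinearMap.inr ℝ E2 E2).comp (ContinuousLinearMap.snd ℝ E2 E2)).hasFDerivAt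

namespace IsSprayOn
variable {s : E4 → E2} {V : Set E4}

theorem mem_nhds (h : IsSprayOn s V) {z : E4} (hz : z ∈ V) : ∀ᶠ w in 𝓝 z, w ∈ V :=
  h.isOpen.mem_nhds hz

theorem smooth_fderiv (h : IsSprayOn s V) {z : E4} (hz : z ∈ V) :
    ContDiffAt ℝ ∞ (fderiv ℝ s) z := (h.smooth z hz).fderiv_right (by simp)

theorem smooth_connL (h : IsSprayOn s V) {z : E4} (hz : z ∈ V) :
    ContDiffAt ℝ ∞ (connL s) z :=
  ((h.smooth_fderiv hz).clm_comp contDiffAt_const).const_smul _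

theorem smooth_sprayField (h : IsSprayOn s V) {z : E4} (hz : z ∈ V) :
    ContDiffAt ℝ ∞ (sprayField s) z := contDiffAt_snd.prodMk (h.smooth z hz)

theorem smooth_curvL (h : IsSprayOn s V) {z : E4} (hz : z ∈ V) :
    ContDiffAt ℝ ∞ (curvL s) z :=
  ((((h.smooth_connL hz).fderiv_right (by simp)).clm_apply (h.smooth_sprayField hz)).sub
    ((h.smooth_fderiv hz).clm_comp contDiffAt_const)).sub
    ((h.smooth_connL hz).clm_comp (h.smooth_connL hz))

theorem inner_ne_zero (h : IsSprayOn s V) {z : E4} (hz : z ∈ V) : inner ℝ z.2 z.2 ≠ 0 :=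
  inner_self_ne_zero.2 (h.ne_zero z hz)

theorem smooth_alphaL (h : IsSprayOn s V) {z : E4} (hz : z ∈ V) :
    ContDiffAt ℝ ∞ (alphaL s) z := by
  have h1 : ContDiffAt ℝ ∞ (fun w : E4 => curvL s w (rot w.2)) z :=
    (h.smooth_curvL hz).clm_apply (rot.contDiff.contDiffAt.comp z contDiffAt_snd)
  have h2 : ContDiffAt ℝ ∞ (fun w : E4 => innerSL ℝ (curvL s w (rot w.2))) z :=
    (innerSL ℝ (E := E2)).contDiff.contDiffAt.comp z h1
  exact ((contDiffAt_snd.inner ℝ contDiffAt_snd).inv (h.inner_ne_zero hz)).smul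
    (h2.clm_comp contDiffAt_const)

/-- `N y = s`: the spray is horizontal. -/
theorem connL_snd (h : IsSprayOn s V) {z : E4} (hz : z ∈ V) : connL s z z.2 = s z := by
  rw [connL_apply, h.euler z hz, smul_smul]; norm_num

/-- The curvature kills the direction of the spray. -/
theorem curvL_snd (h : IsSprayOn s V) {z : E4} (hz : z ∈ V) : curvL s z z.2 = 0 := by
  have h1 := ((h.smooth_connL hz).differentiableAt (by simp)).hasFDerivAt.clm_apply
    (hasFDerivAt_snd (𝕜 := ℝ) (p := z))
  have h2 := ((h.smooth z hz).differentiableAt (by simp)).hasFDerivAt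
  have e := DFunLike.congr_fun (h1.unique (h2.congr_of_eventuallyEq
    ((h.mem_nhds hz).mono fun w hw => h.connL_snd hw))) (sprayField s z)
  rw [fderiv_split] at e
  simp only [add_apply, ContinuousLinearMap.comp_apply, ContinuousLinearMap.flip_apply,
    ContinuousLinearMap.coe_snd', sprayField] at e
  rw [curvL_apply, h.connL_snd hz, sprayField]
  rw [two_smul] at e
  linear_combination (norm := module) e

/-- Second derivatives of `s` in the direction of the Liouville field. -/
theorem fderiv_fderiv_euler (h : IsSprayOn s V) {z : E4} (hz : z ∈ V) (ζ : E4) :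
    fderiv ℝ (fderiv ℝ s) z (0, z.2) ζ = (2 : ℝ) • fderiv ℝ s z ζ - fderiv ℝ s z (0, ζ.2) := by
  have hd := hasFDerivAt_vert z
  have h1 := ((h.smooth_fderiv hz).differentiableAt (by simp)).hasFDerivAt.clm_apply hd
  have h2 := ((h.smooth z hz).differentiableAt (by simp)).hasFDerivAt.const_smul (2 : ℝ)
  have e := DFunLike.congr_fun (h1.unique (h2.congr_of_eventuallyEq
    ((h.mem_nhds hz).mono fun w hw => h.euler w hw))) ζ
  simp at e
  rw [fderiv_fderiv_symm ((h.smooth z hz).of_le (WithTop.coe_le_coe.2 le_top))]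
  rw [← e]; abel

/-- `N` is positively homogeneous of degree `1`. -/
theorem fderiv_connL_euler (h : IsSprayOn s V) {z : E4} (hz : z ∈ V) :
    fderiv ℝ (connL s) z (0, z.2) = connL s z := by
  have h1 := (((h.smooth_fderiv hz).differentiableAt (by simp)).hasFDerivAt.clm_comp
    (hasFDerivAt_const (ContinuousLinearMap.inr ℝ E2 E2) z)).const_smul (1 / 2 : ℝ)
  have h2 : fderiv ℝ (connL s) z = _ := h1.fderiv
  rw [h2]
  ext1 η
  simp [h.fderiv_fderiv_euler hz, connL_apply]
  module

/-- `R` is positively homogeneous of degree `2`. -/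
theorem fderiv_curvL_euler (h : IsSprayOn s V) {z : E4} (hz : z ∈ V) :
    fderiv ℝ (curvL s) z (0, z.2) = (2 : ℝ) • curvL s z := by
  have hN := ((h.smooth_connL hz).differentiableAt (by simp)).hasFDerivAt
  have hN' := (((h.smooth_connL hz).fderiv_right (m := ∞) (by simp)).differentiableAt
    (by simp)).hasFDerivAt
  have hs := ((h.smooth z hz).differentiableAt (by simp)).hasFDerivAt
  have hs' := ((h.smooth_fderiv hz).differentiableAt (by simp)).hasFDerivAt
  have hf : HasFDerivAt (sprayField s) _ z := hasFDerivAt_snd.prodMk hs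
  have hR : HasFDerivAt (curvL s) _ z := ((hN'.clm_apply hf).sub (hs'.clm_comp
    (hasFDerivAt_const (ContinuousLinearMap.inl ℝ E2 E2) z))).sub (hN.clm_comp hN)
  have hd := hasFDerivAt_vert z
  have e := DFunLike.congr_fun ((hN'.clm_apply hd).unique (hN.congr_of_eventuallyEq
    ((h.mem_nhds hz).mono fun w hw => h.fderiv_connL_euler hw))) (sprayField s z)
  simp [sprayField] at e
  have e2 : fderiv ℝ (connL s) z (z.2, s z + s z) = fderiv ℝ (connL s) z (z.2, s z) +
    fderiv ℝ (connL s) z (0, s z) := by rw [← map_add]; simp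
  have symm := fderiv_fderiv_symm ((h.smooth_connL hz).of_le (WithTop.coe_le_coe.2 le_top))
    (0, z.2) (z.2, s z)
  rw [hR.fderiv]
  ext1 η
  have e' := DFunLike.congr_fun e η
  have e2' := DFunLike.congr_fun e2 η
  have symm' := DFunLike.congr_fun symm η
  simp [sprayField, h.fderiv_fderiv_euler hz, h.fderiv_connL_euler hz, h.euler z hz, two_smul,
    curvL_apply] at e' e2' symm' ⊢
  have h0 : fderiv ℝ s z ((0 : E2), (0 : E2)) = 0 := map_zero _
  rw [symm', e2', h0]
  linear_combination (norm := module) e'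

/-- The decomposition `Φ = ρ J - α ⊗ 𝒞`, with `ρ = α(y)`. -/
theorem curvL_eq (h : IsSprayOn s V) {z : E4} (hz : z ∈ V) (η : E2) :
    curvL s z η = alphaL s z z.2 • η - alphaL s z η • z.2 := by
  have hy := h.inner_ne_zero hz
  have d1 := rot_decomposition z.2 η
  have d2 := rot_decomposition z.2 (curvL s z (rot z.2))
  have e := congrArg (curvL s z) d1
  simp only [map_smul, map_add, h.curvL_snd hz, smul_zero, add_zero] at e
  have hs : inner ℝ (rot z.2) η * inner ℝ z.2 (curvL s z (rot z.2)) =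
      inner ℝ (curvL s z (rot z.2)) (rot z.2) * inner ℝ z.2 η -
        inner ℝ z.2 z.2 * inner ℝ (curvL s z (rot z.2)) (rot η) := by
    simp only [inner_eq, rot_apply_zero, rot_apply_one]
    ring
  have hc := real_inner_comm (curvL s z (rot z.2)) (rot z.2)
  refine smul_right_injective E2 (mul_ne_zero hy hy) ?_
  simp only [alphaL_apply, smul_sub, smul_smul]
  rw [show ∀ a b : ℝ, a * a * (a⁻¹ * b) = a * a⁻¹ * (a * b) by intros; ring,
    show ∀ a b : ℝ, a * a * (a⁻¹ * b) = a * a⁻¹ * (a * b) by intros; ring,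
    mul_inv_cancel₀ hy, one_mul, one_mul]
  have hs' := congrArg (· • z.2) hs
  simp only [sub_smul] at hs'
  rw [hc] at d2
  linear_combination (norm := module) (inner ℝ z.2 z.2 : ℝ) • e +
    (inner ℝ (rot z.2) η : ℝ) • d2 - (inner ℝ (curvL s z (rot z.2)) (rot z.2) : ℝ) • d1 + hs'

/-- `α` is positively homogeneous of degree `1`. -/
theorem fderiv_alphaL_euler (h : IsSprayOn s V) {z : E4} (hz : z ∈ V) :
    fderiv ℝ (alphaL s) z (0, z.2) = alphaL s z := by
  have hR := ((h.smooth_curvL hz).differentiableAt (by simp)).hasFDerivAt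
  have hα := ((h.smooth_alphaL hz).differentiableAt (by simp)).hasFDerivAt
  have hy := hasFDerivAt_snd (𝕜 := ℝ) (p := z)
  have hw := hR.clm_apply (rot.hasFDerivAt.comp z hy)
  have hyy := (hy.inner ℝ hy)
  ext1 η
  have h1 := hyy.mul (hα.clm_apply (hasFDerivAt_const η z))
  have h2 := hw.inner ℝ (hasFDerivAt_const (rot η) z)
  have e : ∀ᶠ w in 𝓝 z, inner ℝ w.2 w.2 * alphaL s w η = inner ℝ (curvL s w (rot w.2)) (rot η) := by
    filter_upwards [h.mem_nhds hz] with w hw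
    rw [alphaL_apply, mul_inv_cancel_left₀ (h.inner_ne_zero hw)]
  have e1 := DFunLike.congr_fun (h1.unique (h2.congr_of_eventuallyEq e)) (0, z.2)
  simp [h.fderiv_curvL_euler hz] at e1
  have e2 := e.self_of_nhds
  have hy0 : ‖z.2‖ ^ 2 ≠ 0 := by simpa using h.ne_zero z hz
  rw [real_inner_self_eq_norm_sq] at e2
  rw [two_smul, inner_add_left, inner_add_left, ← e2] at e1
  exact mul_left_cancel₀ hy0 (by linarith)

theorem fderiv_sprayField (h : IsSprayOn s V) {z : E4} (hz : z ∈ V) (a : E4) :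
    fderiv ℝ (sprayField s) z a = (a.2, fderiv ℝ s z (a.1, 0) + (2 : ℝ) • connL s z a.2) := by
  have h1 : HasFDerivAt (sprayField s) _ z :=
    hasFDerivAt_snd.prodMk ((h.smooth z hz).differentiableAt (by simp)).hasFDerivAt
  rw [h1.fderiv, ← fderiv_split]
  rfl

end IsSprayOn

namespace IsLocalSpray
variable {s : E4 → E2} {V : Set E4}

theorem smooth_betaL (h : IsLocalSpray s V) {z : E4} (hz : z ∈ V) :
    ContDiffAt ℝ ∞ (betaL s) z :=
  (((h.smooth_alphaL hz).clm_apply contDiffAt_snd).inv (h.nonflat z hz)).smul (h.smooth_alphaL hz)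

theorem smooth_omegaL (h : IsLocalSpray s V) {z : E4} (hz : z ∈ V) :
    ContDiffAt ℝ ∞ (omegaL s) z :=
  (h.smooth_betaL hz).clm_comp
    (contDiffAt_const.sub ((h.smooth_connL hz).clm_comp contDiffAt_const))

theorem betaL_snd (h : IsLocalSpray s V) {z : E4} (hz : z ∈ V) : betaL s z z.2 = 1 := by
  rw [betaL_apply, inv_mul_cancel₀ (h.nonflat z hz)]

/-- The decomposition `R η = ρ (η - β(η) y)`: the image of `R` is the kernel of `β`. -/
theorem curvL_eq_betaL (h : IsLocalSpray s V) {z : E4} (hz : z ∈ V) (η : E2) :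
    curvL s z η = alphaL s z z.2 • (η - betaL s z η • z.2) := by
  rw [h.curvL_eq hz, smul_sub, smul_smul, betaL_apply, mul_inv_cancel_left₀ (h.nonflat z hz)]

/-- `β` is positively homogeneous of degree `-1`. -/
theorem fderiv_betaL_euler (h : IsLocalSpray s V) {z : E4} (hz : z ∈ V) :
    fderiv ℝ (betaL s) z (0, z.2) = - betaL s z := by
  have hα := ((h.smooth_alphaL hz).differentiableAt (by simp)).hasFDerivAt
  have hβ := ((h.smooth_betaL hz).differentiableAt (by simp)).hasFDerivAt
  have hρ := hα.clm_apply (hasFDerivAt_snd (𝕜 := ℝ) (p := z))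
  have e := (hρ.smul hβ).unique (hα.congr_of_eventuallyEq ((h.mem_nhds hz).mono fun w hw => by
    change alphaL s w w.2 • ((alphaL s w w.2)⁻¹ • alphaL s w) = _
    rw [smul_inv_smul₀ (h.nonflat w hw)]))
  have e1 := DFunLike.congr_fun e (0, z.2)
  simp [h.fderiv_alphaL_euler hz] at e1
  have e2 : alphaL s z = alphaL s z z.2 • betaL s z := by
    rw [betaL, smul_inv_smul₀ (h.nonflat z hz)]
  refine smul_right_injective _ (h.nonflat z hz) ?_
  change alphaL s z z.2 • _ = alphaL s z z.2 • _
  rw [e2] at e1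
  simp [h.betaL_snd hz] at e1 ⊢
  linear_combination (norm := module) e1

/-- `ℒ_𝒞 ω = 0`, written as `i_𝒞 dω = 0` since `ω(𝒞) = 1`. -/
theorem extdL_omegaL_euler (h : IsLocalSpray s V) {z : E4} (hz : z ∈ V) (ξ : E4) :
    extdL (omegaL s) z (0, z.2) ξ = 0 := by
  have hβ := ((h.smooth_betaL hz).differentiableAt (by simp)).hasFDerivAt
  have hN := ((h.smooth_connL hz).differentiableAt (by simp)).hasFDerivAt
  have hω := ((h.smooth_omegaL hz).differentiableAt (by simp)).hasFDerivAt
  have h1 := hω.clm_apply (hasFDerivAt_vert z)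
  have e1 := DFunLike.congr_fun (h1.unique ((hasFDerivAt_const (1 : ℝ) z).congr_of_eventuallyEq
    ((h.mem_nhds hz).mono fun w hw => by simp [omegaL_apply, h.betaL_snd hw]))) ξ
  have h2 := hβ.clm_apply ((hasFDerivAt_const ξ.2 z).sub
    (hN.clm_apply (hasFDerivAt_const ξ.1 z)))
  have e2 := DFunLike.congr_fun ((hω.clm_apply (hasFDerivAt_const ξ z)).unique h2) (0, z.2)
  simp [h.fderiv_betaL_euler hz, h.fderiv_connL_euler hz, omegaL_apply] at e1 e2
  rw [extdL]
  linarith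

end IsLocalSpray

/-! ### Non-degeneracy -/

/-- The transversal non-degeneracy of a spray in a chart: the vertical derivative of `β = α/ρ` has
no kernel inside the kernel of `β`. -/
def IsTransversal (s : E4 → E2) (z : E4) : Prop :=
  ∀ e, betaL s z e = 0 → fderiv ℝ (betaL s) z (0, e) = 0 → e = 0

/-- The semi-basic form `α/ρ`, as a `1`-form in a chart. -/
def betaH (s : E4 → E2) (z : E4) : E4 →L[ℝ] ℝ :=
  (betaL s z).comp (ContinuousLinearMap.fst ℝ E2 E2)

theorem finrank_E4 : Module.finrank ℝ E4 = 4 := by simp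

/-- An alternating form on `ℝ² × ℝ²` for which the vertical plane is isotropic is non-degenerate
exactly if its pairing of vertical with horizontal vectors is non-degenerate. -/
theorem finrank_range_eq_four_iff (B : E4 →ₗ[ℝ] E4 →ₗ[ℝ] ℝ) (hB : ∀ ξ ζ, B ξ ζ = - B ζ ξ)
    (h0 : ∀ η ζ : E2, B (0, η) (0, ζ) = 0) :
    Module.finrank ℝ (LinearMap.range B) = 4 ↔
      ∀ η : E2, (∀ ζ : E2, B (0, η) (ζ, 0) = 0) → η = 0 := by
  have h1 := B.finrank_range_add_finrank_ker
  rw [finrank_E4] at h1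
  have h2 : Module.finrank ℝ (LinearMap.range B) = 4 ↔ LinearMap.ker B = ⊥ := by
    rw [← Submodule.finrank_eq_zero (R := ℝ)]
    omega
  have dec : ∀ ζ : E4, ζ = (ζ.1, 0) + (0, ζ.2) := fun ζ => by simp
  rw [h2, LinearMap.ker_eq_bot']
  constructor
  · intro h η hη
    have := h (0, η) (LinearMap.ext fun ζ => by
      rw [dec ζ, map_add, hη, h0]; simp)
    exact congrArg Prod.snd this
  · intro h ξ hξ
    have e1 : ξ.1 = 0 := by
      by_contra hne
      -- the pairing of horizontal and vertical vectors has no left kernel, hence no right kernel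
      let m : E2 →ₗ[ℝ] Module.Dual ℝ E2 :=
        B.compl₁₂ (LinearMap.inr ℝ E2 E2) (LinearMap.inl ℝ E2 E2)
      have hm : Function.Injective m := (injective_iff_map_eq_zero m).2 fun η hη =>
        h η fun ζ => DFunLike.congr_fun hη ζ
      have hm' : Function.Surjective m := (LinearMap.injective_iff_surjective_of_finrank_eq_finrank
        (by rw [Subspace.dual_finrank_eq])).1 hm
      obtain ⟨η, hη⟩ := hm' (innerSL ℝ ξ.1).toLinearMap
      have hη' := DFunLike.congr_fun hη ξ.1
      refine hne (inner_self_eq_zero.1 (hη'.symm.trans ?_ : inner ℝ ξ.1 ξ.1 = (0 : ℝ)))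
      change B (0, η) (ξ.1, 0) = 0
      have := hB (0, η) ξ
      rw [hξ] at this
      rw [dec ξ, map_add, h0] at this
      simpa using this
    have e2 : ξ.2 = 0 := h _ fun ζ => by
      rw [← e1]; rw [show (ξ.1, ξ.2) = ξ from rfl, hξ]; rfl
    exact Prod.ext e1 e2

/-- A `2`-form which vanishes on vertical vectors and pairs vertical with horizontal vectors
through `∂β/∂y + k β ⊗ β`, `k ≠ 1`, is non-degenerate exactly if the spray is transversal: `y`
splits off, as `β(y) = 1` and `∂β/∂y (y) = -β`. -/
theorem IsLocalSpray.isTransversal_iff {s : E4 → E2} {V : Set E4} (h : IsLocalSpray s V) {z : E4}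
    (hz : z ∈ V)
    (hsymm : ∀ η ζ, fderiv ℝ (betaL s) z (0, η) ζ = fderiv ℝ (betaL s) z (0, ζ) η)
    {k : ℝ} (hk : k ≠ 1) :
    (∀ η, (∀ ζ, fderiv ℝ (betaL s) z (0, η) ζ + k * (betaL s z η * betaL s z ζ) = 0) → η = 0) ↔
      IsTransversal s z := by
  constructor
  · intro H e he he'
    exact H e fun ζ => by rw [he', he]; simp
  · intro H η hη
    -- pairing with `y` gives `(k - 1) β(η) = 0`
    have hy := h.betaL_snd hz
    have hE : ∀ ζ, fderiv ℝ (betaL s) z (0, z.2) ζ = - betaL s z ζ := fun ζ => by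
      rw [h.fderiv_betaL_euler hz]; rfl
    have h1 := hη z.2
    rw [hsymm, hE, hy] at h1
    have h2 : betaL s z η = 0 := by
      have : (k - 1) * betaL s z η = 0 := by linarith
      exact (mul_eq_zero.1 this).resolve_left (sub_ne_zero.2 hk)
    refine H η h2 (ContinuousLinearMap.ext fun ζ => ?_)
    have := hη ζ
    rw [h2] at this
    simpa using this

namespace IsLocalSpray
variable {s : E4 → E2} {V : Set E4}

theorem fderiv_omegaL (h : IsLocalSpray s V) {z : E4} (hz : z ∈ V) (a ξ : E4) :
    fderiv ℝ (omegaL s) z a ξ = fderiv ℝ (betaL s) z a (ξ.2 - connL s z ξ.1) -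
      betaL s z (fderiv ℝ (connL s) z a ξ.1) := by
  have hβ := ((h.smooth_betaL hz).differentiableAt (by simp)).hasFDerivAt
  have hN := ((h.smooth_connL hz).differentiableAt (by simp)).hasFDerivAt
  have hω := ((h.smooth_omegaL hz).differentiableAt (by simp)).hasFDerivAt
  have h2 := hβ.clm_apply ((hasFDerivAt_const ξ.2 z).sub
    (hN.clm_apply (hasFDerivAt_const ξ.1 z)))
  have e2 := DFunLike.congr_fun ((hω.clm_apply (hasFDerivAt_const ξ z)).unique h2) a
  simp at e2
  rw [e2, map_sub]; ring

/-- If `ω` is closed, then so is its restriction `β` to the fibres. -/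
theorem fderiv_betaL_symm (h : IsLocalSpray s V) {z : E4} (hz : z ∈ V)
    (hcl : ∀ ξ ζ, extdL (omegaL s) z ξ ζ = 0) (η ζ : E2) :
    fderiv ℝ (betaL s) z (0, η) ζ = fderiv ℝ (betaL s) z (0, ζ) η := by
  have := hcl (0, η) (0, ζ)
  simpa [extdL, h.fderiv_omegaL hz, sub_eq_zero] using this

theorem omegaL_vert (h : IsLocalSpray s V) {z : E4} (hz : z ∈ V) : omegaL s z (0, z.2) = 1 := by
  simp [omegaL_apply, h.betaL_snd hz]

theorem fderiv_betaH (h : IsLocalSpray s V) {z : E4} (hz : z ∈ V) (a ξ : E4) :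
    fderiv ℝ (betaH s) z a ξ = fderiv ℝ (betaL s) z a ξ.1 := by
  have hβ := ((h.smooth_betaL hz).differentiableAt (by simp)).hasFDerivAt
  have h1 : HasFDerivAt (betaH s) _ z :=
    hβ.clm_comp (hasFDerivAt_const (ContinuousLinearMap.fst ℝ E2 E2) z)
  rw [h1.fderiv]
  simp

theorem smooth_betaH (h : IsLocalSpray s V) {z : E4} (hz : z ∈ V) : ContDiffAt ℝ ∞ (betaH s) z :=
  (h.smooth_betaL hz).clm_comp contDiffAt_const

theorem exists_betaL_eq_zero (h : IsLocalSpray s V) {z : E4} (hz : z ∈ V) :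
    ∃ e, e ≠ 0 ∧ betaL s z e = 0 := by
  refine ⟨rot z.2 - betaL s z (rot z.2) • z.2, fun h0 => ?_, ?_⟩
  · have h1 : inner ℝ (rot z.2 - betaL s z (rot z.2) • z.2) (rot z.2) = inner ℝ z.2 z.2 := by
      simp only [inner_eq, rot_apply_zero, rot_apply_one, PiLp.sub_apply, PiLp.smul_apply,
        smul_eq_mul]
      ring
    rw [h0, inner_zero_left] at h1
    exact h.inner_ne_zero hz h1.symm
  · rw [map_sub, map_smul, h.betaL_snd hz]; simp

/-- A closed multiple `φ ω` of `ω` has `dφ = 𝒞(φ) ω` and `φ dω = 0`, because `i_𝒞 dω = 0`. -/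
theorem of_closed_multiple (h : IsLocalSpray s V) {z : E4} (hz : z ∈ V) {θ : E4 → E4 →L[ℝ] ℝ}
    {φ : E4 → ℝ} (hφ : DifferentiableAt ℝ φ z) (hθ : ∀ᶠ w in 𝓝 z, θ w = φ w • omegaL s w)
    (hcl : ∀ ξ ζ, extdL θ z ξ ζ = 0) :
    (∀ ξ, fderiv ℝ φ z ξ = fderiv ℝ φ z (0, z.2) * omegaL s z ξ) ∧
      ∀ ξ ζ, φ z * extdL (omegaL s) z ξ ζ = 0 := by
  have hω := ((h.smooth_omegaL hz).differentiableAt (by simp)).hasFDerivAt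
  have hθ' : HasFDerivAt θ _ z := (hφ.hasFDerivAt.smul hω).congr_of_eventuallyEq hθ
  have e : ∀ ξ ζ, fderiv ℝ φ z ξ * omegaL s z ζ - fderiv ℝ φ z ζ * omegaL s z ξ +
      φ z * extdL (omegaL s) z ξ ζ = 0 := by
    intro ξ ζ
    have := hcl ξ ζ
    rw [extdL, hθ'.fderiv] at this
    simp at this
    rw [extdL]
    linarith
  have e1 : ∀ ξ, fderiv ℝ φ z ξ = fderiv ℝ φ z (0, z.2) * omegaL s z ξ := by
    intro ξ
    have := e (0, z.2) ξ
    rw [h.extdL_omegaL_euler hz, h.omegaL_vert hz] at this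
    linarith
  refine ⟨e1, fun ξ ζ => ?_⟩
  have := e ξ ζ
  rw [e1 ξ, e1 ζ] at this
  linarith

/-- The form `d_J θ + 2 θ ∧ i_J θ` of a closed form `θ = φ ω`, on a vertical and a horizontal
vector. -/
theorem rankForm_multiple (h : IsLocalSpray s V) {z : E4} (hz : z ∈ V) {θ θJ : E4 → E4 →L[ℝ] ℝ}
    {φ : E4 → ℝ} (hφ : DifferentiableAt ℝ φ z) (hθ : θ z = φ z • omegaL s z)
    (hθJ : ∀ᶠ w in 𝓝 z, θJ w = φ w • betaH s w) (η ζ : E2) :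
    -extdL θJ z (0, η) (ζ, 0) +
        2 * (θ z (0, η) * θJ z (ζ, 0) - θ z (ζ, 0) * θJ z (0, η)) =
      -(fderiv ℝ φ z (0, η) * betaL s z ζ) - φ z * fderiv ℝ (betaL s) z (0, η) ζ +
        2 * φ z ^ 2 * (betaL s z η * betaL s z ζ) := by
  have hβ := ((h.smooth_betaH hz).differentiableAt (by simp)).hasFDerivAt
  have hθJ' : HasFDerivAt θJ _ z := (hφ.hasFDerivAt.smul hβ).congr_of_eventuallyEq hθJ
  rw [extdL, hθJ'.fderiv, hθ, hθJ.self_of_nhds]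
  simp [h.fderiv_betaH hz, betaH, omegaL_apply]
  ring

/-- If `θ` is closed, a multiple of `ω`, and `d_J θ + 2 θ ∧ i_J θ` is non-degenerate, then `ω` is
closed and the spray is transversal. -/
theorem closed_and_transversal (h : IsLocalSpray s V) {z : E4} (hz : z ∈ V)
    {θ θJ : E4 → E4 →L[ℝ] ℝ} {φ : E4 → ℝ} (hφ : DifferentiableAt ℝ φ z)
    (hθ : ∀ᶠ w in 𝓝 z, θ w = φ w • omegaL s w) (hθJ : ∀ᶠ w in 𝓝 z, θJ w = φ w • betaH s w)
    (hcl : ∀ ξ ζ, extdL θ z ξ ζ = 0)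
    (hnd : ∀ η : E2, (∀ ζ : E2, -extdL θJ z (0, η) (ζ, 0) +
        2 * (θ z (0, η) * θJ z (ζ, 0) - θ z (ζ, 0) * θJ z (0, η)) = 0) → η = 0) :
    (∀ ξ ζ, extdL (omegaL s) z ξ ζ = 0) ∧ IsTransversal s z := by
  obtain ⟨h1, h2⟩ := h.of_closed_multiple hz hφ hθ hcl
  -- on `ker β`, only the term `φ ∂β/∂y` of the form is left
  have key : ∀ e, betaL s z e = 0 → φ z • fderiv ℝ (betaL s) z (0, e) = 0 → e = 0 := by
    intro e he he'
    refine hnd e fun ζ => ?_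
    have := DFunLike.congr_fun he' ζ
    simp only [smul_apply, smul_eq_mul, zero_apply] at this
    rw [h.rankForm_multiple hz hφ hθ.self_of_nhds hθJ, h1, omegaL_apply, this]
    simp [he]
  have hφ0 : φ z ≠ 0 := by
    intro h0
    obtain ⟨e, hne, he⟩ := h.exists_betaL_eq_zero hz
    exact hne (key e he (by rw [h0, zero_smul]))
  exact ⟨fun ξ ζ => (mul_eq_zero.1 (h2 ξ ζ)).resolve_left hφ0,
    fun e he he' => key e he (by rw [he', smul_zero])⟩

/-- An integral manifold `g` of `ker ω` forces `dω = 0`: pulling back gives `dω = 0` on `ker ω`,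
and `i_𝒞 dω = 0`. -/
theorem closed_of_integral (h : IsLocalSpray s V) {F : Type*} [NormedAddCommGroup F]
    [NormedSpace ℝ F] {g : F → E4} {t : F} (ht : g t ∈ V) (hg : ContDiffAt ℝ 2 g t)
    (hgω : ∀ᶠ r in 𝓝 t, ∀ a, omegaL s (g r) (fderiv ℝ g r a) = 0)
    (hr : ∀ ξ, omegaL s (g t) ξ = 0 → ∃ a, fderiv ℝ g t a = ξ) (ξ ζ : E4) :
    extdL (omegaL s) (g t) ξ ζ = 0 := by
  have h0 : ∀ a b, extdL (omegaL s) (g t) (fderiv ℝ g t a) (fderiv ℝ g t b) = 0 := by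
    intro a b
    rw [extdL_natural hg (differentiableAt_const (0 : F →L[ℝ] ℝ))
      ((h.smooth_omegaL ht).differentiableAt (by simp)) hgω]
    simp [extdL]
  have hω := h.omegaL_vert ht
  obtain ⟨a, ha⟩ := hr (ξ - omegaL s (g t) ξ • (0, (g t).2)) (by
    rw [map_sub, map_smul, hω]; simp)
  obtain ⟨b, hb⟩ := hr (ζ - omegaL s (g t) ζ • (0, (g t).2)) (by
    rw [map_sub, map_smul, hω]; simp)
  have e := h0 a b
  have e1 := h.extdL_omegaL_euler ht ξ
  have e2 := h.extdL_omegaL_euler ht ζ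
  rw [ha, hb] at e
  simp only [extdL, map_sub, map_smul, sub_apply, smul_apply, smul_eq_mul] at e e1 e2 ⊢
  linear_combination e + omegaL s (g t) ξ * e2 - omegaL s (g t) ζ * e1

end IsLocalSpray

/-! ### The Euler-Lagrange equation in a chart -/

/-- The form `d_J E` in a chart. -/
def dJL (E : E4 → ℝ) (z : E4) : E4 →L[ℝ] ℝ :=
  (fderiv ℝ E z).comp ((ContinuousLinearMap.inr ℝ E2 E2).comp (ContinuousLinearMap.fst ℝ E2 E2))

theorem fderiv_dJL {E : E4 → ℝ} {z : E4} (hE : ContDiffAt ℝ 2 E z) (a ξ : E4) :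
    fderiv ℝ (dJL E) z a ξ = fderiv ℝ (fderiv ℝ E) z a (0, ξ.1) := by
  have h1 : HasFDerivAt (dJL E) _ z := (differentiableAt_fderiv hE).hasFDerivAt.clm_comp
    (hasFDerivAt_const ((ContinuousLinearMap.inr ℝ E2 E2).comp (ContinuousLinearMap.fst ℝ E2 E2)) z)
  rw [h1.fderiv]
  simp

/-- The derivative of the relation `dE(X) = g`. -/
theorem fderiv_fderiv_apply {E : E4 → ℝ} {X : E4 → E4} {g : E4 → ℝ} {z : E4}
    (hE : ContDiffAt ℝ 2 E z) (hX : DifferentiableAt ℝ X z) (hg : DifferentiableAt ℝ g z)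
    (h : ∀ᶠ w in 𝓝 z, fderiv ℝ E w (X w) = g w) (a : E4) :
    fderiv ℝ (fderiv ℝ E) z a (X z) = fderiv ℝ g z a - fderiv ℝ E z (fderiv ℝ X z a) := by
  have h1 := (differentiableAt_fderiv hE).hasFDerivAt.clm_apply hX.hasFDerivAt
  have := DFunLike.congr_fun (h1.unique (hg.hasFDerivAt.congr_of_eventuallyEq h)) a
  simp at this
  linarith

namespace IsLocalSpray
variable {s : E4 → E2} {V : Set E4}

variable {E : E4 → ℝ}

/-- The Hessian of a `2`-homogeneous function in the direction of `𝒞`. -/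
theorem fderiv_fderiv_energy_euler (hE : ∀ z ∈ V, ContDiffAt ℝ ∞ E z) (h : IsLocalSpray s V)
    (heul : ∀ z ∈ V, fderiv ℝ E z (0, z.2) = 2 * E z) {z : E4} (hz : z ∈ V) (a : E4) :
    fderiv ℝ (fderiv ℝ E) z a (0, z.2) = 2 * fderiv ℝ E z a - fderiv ℝ E z (0, a.2) := by
  have hE' := (hE z hz).differentiableAt (by simp)
  rw [fderiv_fderiv_apply (X := fun w => (0, w.2)) (g := fun w => 2 * E w)
    ((hE z hz).of_le (WithTop.coe_le_coe.2 le_top)) (hasFDerivAt_vert z).differentiableAt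
    (hE'.const_mul 2) ((h.mem_nhds hz).mono heul), (hasFDerivAt_vert z).fderiv,
    (hE'.hasFDerivAt.const_mul 2).fderiv]
  rfl

/-- For a `2`-homogeneous function the equation `i_S d d_J E = -dE` is the classical Euler-Lagrange
equation `S(∂E/∂y) = ∂E/∂x`. -/
theorem eulerLagrange_iff (hE : ∀ z ∈ V, ContDiffAt ℝ ∞ E z) (h : IsLocalSpray s V)
    (heul : ∀ z ∈ V, fderiv ℝ E z (0, z.2) = 2 * E z) {z : E4} (hz : z ∈ V) :
    (∀ ξ, extdL (dJL E) z (sprayField s z) ξ = - fderiv ℝ E z ξ) ↔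
      ∀ η, fderiv ℝ (fderiv ℝ E) z (sprayField s z) (0, η) = fderiv ℝ E z (η, 0) := by
  have hE2 : ContDiffAt ℝ 2 E z := (hE z hz).of_le (WithTop.coe_le_coe.2 le_top)
  have e : ∀ ξ, extdL (dJL E) z (sprayField s z) ξ =
      fderiv ℝ (fderiv ℝ E) z (sprayField s z) (0, ξ.1) - 2 * fderiv ℝ E z ξ +
        fderiv ℝ E z (0, ξ.2) := by
    intro ξ
    rw [extdL, fderiv_dJL hE2, fderiv_dJL hE2]
    change _ - fderiv ℝ (fderiv ℝ E) z ξ (0, z.2) = _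
    rw [fderiv_fderiv_energy_euler hE h heul hz]
    ring
  have e' : ∀ ξ : E4, fderiv ℝ E z ξ = fderiv ℝ E z (ξ.1, 0) + fderiv ℝ E z (0, ξ.2) := by
    intro ξ
    rw [← map_add]; simp
  constructor
  · intro H η
    have := H (η, 0)
    rw [e] at this
    have h0 : fderiv ℝ E z ((0 : E2), (0 : E2)) = 0 := map_zero _
    simp only [h0] at this
    linarith
  · intro H ξ
    rw [e, H, e' ξ]
    ring

/-- If `E` is `2`-homogeneous and solves the Euler-Lagrange equation of the spray, then
`dE = 2 E ω`: `E` is constant along the horizontal and the curvature directions. -/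
theorem fderiv_energy (hE : ∀ z ∈ V, ContDiffAt ℝ ∞ E z) (h : IsLocalSpray s V)
    (heul : ∀ z ∈ V, fderiv ℝ E z (0, z.2) = 2 * E z)
    (hEL : ∀ z ∈ V, ∀ ξ, extdL (dJL E) z (sprayField s z) ξ = - fderiv ℝ E z ξ) {z : E4}
    (hz : z ∈ V) : fderiv ℝ E z = (2 * E z) • omegaL s z := by
  have hE2 : ∀ z ∈ V, ContDiffAt ℝ 2 E z := fun z hz =>
    (hE z hz).of_le (WithTop.coe_le_coe.2 le_top)
  have hE' : ∀ z ∈ V, ContDiffAt ℝ ∞ (fderiv ℝ E) z := fun z hz => (hE z hz).fderiv_right (by simp)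
  have hEL' : ∀ z ∈ V, ∀ η, fderiv ℝ (fderiv ℝ E) z (sprayField s z) (0, η) =
      fderiv ℝ E z (η, 0) := fun z hz => (h.eulerLagrange_iff hE heul hz).1 (hEL z hz)
  -- `E` is constant along horizontal vectors
  have hor : ∀ z ∈ V, ∀ η, fderiv ℝ E z (η, 0) + fderiv ℝ E z (0, connL s z η) = 0 := by
    intro z hz η
    have symm := fderiv_fderiv_symm (hE2 z hz)
    have hS := ((h.smooth_sprayField hz).differentiableAt (by simp)).hasFDerivAt
    have hD := ((hE' z hz).differentiableAt (by simp)).hasFDerivAt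
    have hDD :=
      (((hE' z hz).fderiv_right (m := ∞) (by simp)).differentiableAt (by simp)).hasFDerivAt
    -- the vertical derivative of the Euler-Lagrange equation
    have d : ∀ κ η, fderiv ℝ (fderiv ℝ (fderiv ℝ E)) z (0, κ) (sprayField s z) (0, η) +
        fderiv ℝ (fderiv ℝ E) z (κ, (2 : ℝ) • connL s z κ) (0, η) =
          fderiv ℝ (fderiv ℝ E) z (0, κ) (η, 0) := by
      intro κ η
      have h1 := (hDD.clm_apply hS).clm_apply (hasFDerivAt_const ((0, η) : E4) z)
      have h2 := hD.clm_apply (hasFDerivAt_const ((η, 0) : E4) z)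
      have := DFunLike.congr_fun (h1.unique (h2.congr_of_eventuallyEq
        ((h.mem_nhds hz).mono fun w hw => hEL' w hw η))) (0, κ)
      have h0 : fderiv ℝ s z ((0 : E2), (0 : E2)) = 0 := map_zero _
      simp [h.fderiv_sprayField hz, h0] at this
      linarith
    -- the third derivative of `E` is symmetric
    have t : ∀ κ η a, fderiv ℝ (fderiv ℝ (fderiv ℝ E)) z (0, κ) a (0, η) =
        fderiv ℝ (fderiv ℝ (fderiv ℝ E)) z (0, η) a (0, κ) := by
      intro κ η a
      have s1 : ∀ a b c, fderiv ℝ (fderiv ℝ (fderiv ℝ E)) z a b c =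
          fderiv ℝ (fderiv ℝ (fderiv ℝ E)) z b a c := fun a b c => DFunLike.congr_fun
        (fderiv_fderiv_symm ((hE' z hz).of_le (WithTop.coe_le_coe.2 le_top)) a b) c
      have s2 : ∀ a b c, fderiv ℝ (fderiv ℝ (fderiv ℝ E)) z a b c =
          fderiv ℝ (fderiv ℝ (fderiv ℝ E)) z a c b := by
        intro a b c
        have h1 := (hDD.clm_apply (hasFDerivAt_const b z)).clm_apply (hasFDerivAt_const c z)
        have h2 := (hDD.clm_apply (hasFDerivAt_const c z)).clm_apply (hasFDerivAt_const b z)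
        have := DFunLike.congr_fun (h1.unique (h2.congr_of_eventuallyEq
          ((h.mem_nhds hz).mono fun w hw => fderiv_fderiv_symm (hE2 w hw) b c))) a
        simpa using this
      rw [s2, s1, s2]
    have e1 := d η z.2
    have e2 := d z.2 η
    rw [t z.2 η] at e2
    have lin : ∀ a b c, fderiv ℝ (fderiv ℝ E) z (a, (2 : ℝ) • b) (0, c) =
        fderiv ℝ (fderiv ℝ E) z (a, 0) (0, c) + 2 * fderiv ℝ (fderiv ℝ E) z (0, b) (0, c) := by
      intro a b c
      have : ((a, (2 : ℝ) • b) : E4) = (a, 0) + (2 : ℝ) • (0, b) := by simp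
      rw [this, map_add, map_smul]; rfl
    have lin' : ∀ c, fderiv ℝ (fderiv ℝ E) z (sprayField s z) (0, c) =
        fderiv ℝ (fderiv ℝ E) z (z.2, 0) (0, c) + fderiv ℝ (fderiv ℝ E) z (0, s z) (0, c) := by
      intro c
      rw [← add_apply, ← map_add]; simp [sprayField]
    have e3 := hEL' z hz η
    rw [lin'] at e3
    rw [lin] at e1 e2
    rw [h.connL_snd hz] at e2
    have v := fderiv_fderiv_energy_euler hE h heul hz
    have v1 := v (η, 0)
    have v2 := v (0, connL s z η)
    have v3 := v (0, η)
    rw [symm (0, η) (z.2, 0)] at e1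
    rw [symm (0, z.2) (η, 0)] at e2
    have h0 : fderiv ℝ E z ((0 : E2), (0 : E2)) = 0 := map_zero _
    simp only [h0] at v1 v2 v3
    linarith
  -- `E` is constant along the image of the curvature
  have cur : ∀ η, fderiv ℝ E z (0, curvL s z η) = 0 := by
    intro η
    have hS := ((h.smooth_sprayField hz).differentiableAt (by simp))
    have hD := ((hE' z hz).differentiableAt (by simp)).hasFDerivAt
    have hN := ((h.smooth_connL hz).differentiableAt (by simp)).hasFDerivAt
    have hSE : ∀ w ∈ V, fderiv ℝ E w (sprayField s w) = 0 := by
      intro w hw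
      have := hor w hw w.2
      rw [h.connL_snd hw, ← map_add] at this
      simpa [sprayField] using this
    have e1 := fderiv_fderiv_apply (hE2 z hz) hS (differentiableAt_const (0 : ℝ))
      ((h.mem_nhds hz).mono hSE) (η, 0)
    rw [h.fderiv_sprayField hz] at e1
    have h1 := (hD.clm_apply (hasFDerivAt_const ((η, 0) : E4) z)).add (hD.clm_apply
      ((hasFDerivAt_const (0 : E2) z).prodMk (hN.clm_apply (hasFDerivAt_const η z))))
    have e2 := DFunLike.congr_fun (h1.unique ((hasFDerivAt_const (0 : ℝ) z).congr_of_eventuallyEq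
      ((h.mem_nhds hz).mono fun w hw => hor w hw η))) (sprayField s z)
    have e3 := hEL' z hz (connL s z η)
    have e4 := hor z hz (connL s z η)
    have symm := fderiv_fderiv_symm (hE2 z hz) (η, 0) (sprayField s z)
    have e5 : fderiv ℝ E z (0, curvL s z η) =
        fderiv ℝ E z (0, fderiv ℝ (connL s) z (sprayField s z) η) -
          fderiv ℝ E z (0, fderiv ℝ s z (η, 0)) - fderiv ℝ E z (0, connL s z (connL s z η)) := by
      rw [← map_sub, ← map_sub, curvL_apply]; simp
    simp at e1 e2
    linarith
  refine ContinuousLinearMap.ext fun ξ => ?_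
  -- split `ξ` into its horizontal and vertical parts, and the vertical part along `y` and `Im R`
  have e1 := cur (ξ.2 - connL s z ξ.1)
  rw [h.curvL_eq_betaL hz] at e1
  have e2 := hor z hz ξ.1
  have e3 := heul z hz
  have e4 : fderiv ℝ E z ξ = fderiv ℝ E z (ξ.1, 0) + fderiv ℝ E z (0, connL s z ξ.1) +
      fderiv ℝ E z (0, ξ.2 - connL s z ξ.1) := by
    rw [← map_add, ← map_add]; simp
  have e5 : ∀ (c b : ℝ) (v : E2), fderiv ℝ E z (0, c • (v - b • z.2)) =
      c * (fderiv ℝ E z (0, v) - b * fderiv ℝ E z (0, z.2)) := by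
    intro c b v
    have : ((0, c • (v - b • z.2)) : E4) = c • ((0, v) - b • (0, z.2)) := by simp
    rw [this, map_smul, map_sub, map_smul]; rfl
  rw [e5] at e1
  have e6 := (mul_eq_zero.1 e1).resolve_left (h.nonflat z hz)
  rw [smul_apply, smul_eq_mul, omegaL_apply]
  rw [e3] at e6
  linarith

/-- Conversely, if `dE = 2 E ω` then `E` is `2`-homogeneous and solves the Euler-Lagrange
equation. -/
theorem eulerLagrange_of_fderiv (hE : ∀ z ∈ V, ContDiffAt ℝ ∞ E z) (h : IsLocalSpray s V)
    (hω : ∀ z ∈ V, fderiv ℝ E z = (2 * E z) • omegaL s z) {z : E4} (hz : z ∈ V) (ξ : E4) :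
    extdL (dJL E) z (sprayField s z) ξ = - fderiv ℝ E z ξ := by
  have hE2 : ContDiffAt ℝ 2 E z := (hE z hz).of_le (WithTop.coe_le_coe.2 le_top)
  have heul : ∀ z ∈ V, fderiv ℝ E z (0, z.2) = 2 * E z := fun z hz => by
    rw [hω z hz, smul_apply, h.omegaL_vert hz]; simp
  refine (h.eulerLagrange_iff hE heul hz).2 (fun η => ?_) ξ
  rw [fderiv_fderiv_symm hE2, fderiv_fderiv_apply hE2
    ((h.smooth_sprayField hz).differentiableAt (by simp)) (differentiableAt_const (0 : ℝ))
    ((h.mem_nhds hz).mono fun w hw => by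
      rw [hω w hw]; simp [omegaL_apply, sprayField, h.connL_snd hw]), h.fderiv_sprayField hz,
    hω z hz]
  have h0 : fderiv ℝ s z ((0 : E2), (0 : E2)) = 0 := map_zero _
  simp [omegaL_apply, h0]
  left
  ring

/-- If `dE = 2 E ω`, the metric tensor of `E` is `E (∂β/∂y + 2 β ⊗ β)`. -/
theorem fderiv_fderiv_energy (hE : ∀ z ∈ V, ContDiffAt ℝ ∞ E z) (h : IsLocalSpray s V)
    (hω : ∀ z ∈ V, fderiv ℝ E z = (2 * E z) • omegaL s z) {z : E4} (hz : z ∈ V) (η ζ : E2) :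
    fderiv ℝ (fderiv ℝ E) z (0, η) (0, ζ) = 2 * E z * (fderiv ℝ (betaL s) z (0, η) ζ +
      2 * (betaL s z η * betaL s z ζ)) := by
  have h1 := (((hE z hz).differentiableAt (by simp)).hasFDerivAt.const_mul 2).smul
    ((h.smooth_omegaL hz).differentiableAt (by simp)).hasFDerivAt
  have h2 := (differentiableAt_fderiv ((hE z hz).of_le (WithTop.coe_le_coe.2 le_top))).hasFDerivAt
  have := h2.unique (h1.congr_of_eventuallyEq ((h.mem_nhds hz).mono hω))
  rw [this]
  simp [h.fderiv_omegaL hz, hω z hz, omegaL_apply]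
  ring

end IsLocalSpray

/-! ### Primitives and level sets in a chart -/

namespace IsLocalSpray
variable {s : E4 → E2} {V : Set E4}

theorem mono (h : IsLocalSpray s V) {K : Set E4} (hK : IsOpen K) (hKV : K ⊆ V) :
    IsLocalSpray s K :=
  ⟨⟨hK, fun z hz => h.smooth z (hKV hz), fun z hz => h.ne_zero z (hKV hz),
    fun z hz => h.euler z (hKV hz)⟩, fun z hz => h.nonflat z (hKV hz)⟩

theorem contDiffAt_primitive (h : IsLocalSpray s V) {f : E4 → ℝ}
    (hf : ∀ z ∈ V, HasFDerivAt f (omegaL s z) z) {z : E4} (hz : z ∈ V) : ContDiffAt ℝ ∞ f z := by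
  have : ContDiffOn ℝ ∞ f V := by
    rw [contDiffOn_infty_iff_fderiv_of_isOpen h.isOpen]
    refine ⟨fun w hw => (hf w hw).differentiableAt.differentiableWithinAt, ?_⟩
    refine ContDiffOn.congr (f := omegaL s) (fun w hw => (h.smooth_omegaL hw).contDiffWithinAt) ?_
    exact fun w hw => (hf w hw).fderiv
  exact this.contDiffAt (h.isOpen.mem_nhds hz)

/-- A primitive of `ω` is logarithmically homogeneous, because `ω(𝒞) = 1`. -/
theorem primitive_smul (h : IsLocalSpray s V) (hc : ∀ z ∈ V, ∀ c : ℝ, 0 < c → (z.1, c • z.2) ∈ V)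
    {f : E4 → ℝ} (hf : ∀ z ∈ V, HasFDerivAt f (omegaL s z) z) {z : E4} (hz : z ∈ V) {c : ℝ}
    (hc0 : 0 < c) : f (z.1, c • z.2) = f z + Real.log c := by
  have hd : ∀ t ∈ Ioi (0 : ℝ), HasDerivAt (fun t : ℝ => f (z.1, t • z.2) - Real.log t) 0 t := by
    intro t ht
    have ht0 : t ≠ 0 := ne_of_gt ht
    have hV := hc z hz t ht
    have h1 : HasDerivAt (fun t : ℝ => ((z.1, t • z.2) : E4)) (0, z.2) t := by
      have := (hasDerivAt_const t z.1).prodMk ((hasDerivAt_id t).smul_const z.2)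
      simpa using this
    have h2 := (HasFDerivAt.comp_hasDerivAt t (hf _ hV) h1).sub (Real.hasDerivAt_log ht0)
    have h3 : omegaL s (z.1, t • z.2) (0, z.2) = t⁻¹ := by
      have := h.omegaL_vert hV
      have e : ((0, t • z.2) : E4) = t • (0, z.2) := by simp
      simp only [e] at this
      rw [map_smul, smul_eq_mul] at this
      exact eq_inv_of_mul_eq_one_right this
    rw [h3, sub_self] at h2
    exact h2
  have := isOpen_Ioi.is_const_of_deriv_eq_zero isPreconnected_Ioi
    (fun t ht => (hd t ht).differentiableAt.differentiableWithinAt)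
    (fun t ht => (hd t ht).deriv) (mem_Ioi.2 hc0) (mem_Ioi.2 one_pos)
  simp only [one_smul, Real.log_one, sub_zero] at this
  linarith

/-- If `ω` is closed, it has a primitive on a conic neighbourhood of each point: the product of a
ball and of the cone over a ball is convex, and the Poincaré lemma applies to it. -/
theorem exists_primitive (h : IsLocalSpray s V)
    (hc : ∀ z ∈ V, ∀ c : ℝ, 0 < c → (z.1, c • z.2) ∈ V)
    (hcl : ∀ z ∈ V, ∀ ξ ζ, extdL (omegaL s) z ξ ζ = 0) {z : E4} (hz : z ∈ V) :
    ∃ K ⊆ V, IsOpen K ∧ z ∈ K ∧ (∀ w ∈ K, ∀ c : ℝ, 0 < c → (w.1, c • w.2) ∈ K) ∧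
      ∃ f : E4 → ℝ, ∀ w ∈ K, HasFDerivAt f (omegaL s w) w := by
  obtain ⟨r, hr, hrV⟩ := Metric.isOpen_iff.1 h.isOpen z hz
  let C := ConvexCone.hull ℝ (Metric.ball z.2 r)
  have hmem : ∀ y, y ∈ C ↔ ∃ c : ℝ, 0 < c ∧ c • y ∈ Metric.ball z.2 r := by
    intro y
    rw [ConvexCone.mem_hull_of_convex (convex_ball z.2 r)]
    constructor
    · rintro ⟨c, hc0, hy⟩
      exact ⟨c⁻¹, inv_pos.2 hc0, (mem_smul_set_iff_inv_smul_mem₀ hc0.ne' _ _).1 hy⟩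
    · rintro ⟨c, hc0, hy⟩
      exact ⟨c⁻¹, inv_pos.2 hc0, (mem_smul_set_iff_inv_smul_mem₀ (inv_pos.2 hc0).ne' _ _).2
        (by rwa [inv_inv])⟩
  let K : Set E4 := Metric.ball z.1 r ×ˢ (C : Set E2)
  have hKV : K ⊆ V := by
    rintro w ⟨hw1, hw2⟩
    obtain ⟨c, hc0, hcw⟩ := (hmem w.2).1 hw2
    have : ((w.1, c • w.2) : E4) ∈ V := hrV (by
      rw [← ball_prod_same]; exact ⟨hw1, hcw⟩)
    have := hc _ this c⁻¹ (inv_pos.2 hc0)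
    simpa [smul_smul, inv_mul_cancel₀ hc0.ne'] using this
  have hC : IsOpen (C : Set E2) := by
    have : (C : Set E2) = ⋃ c : Ioi (0 : ℝ), (fun y : E2 => (c : ℝ) • y) ⁻¹' Metric.ball z.2 r := by
      ext y
      simp only [mem_iUnion, mem_preimage, Subtype.exists, mem_Ioi, exists_prop]
      exact hmem y
    rw [this]
    exact isOpen_iUnion fun c => Metric.isOpen_ball.preimage (continuous_const_smul _)
  have hK : IsOpen K := Metric.isOpen_ball.prod hC
  have hKc : Convex ℝ K := (convex_ball z.1 r).prod C.convex
  refine ⟨K, hKV, hK, ⟨Metric.mem_ball_self hr, (hmem _).2 ⟨1, one_pos, by simpa using hr⟩⟩,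
    fun w hw c hc0 => ⟨hw.1, C.smul_mem hc0 hw.2⟩, ?_⟩
  refine hKc.exists_forall_hasFDerivAt_of_fderiv_symmetric hK (fun w hw =>
    ((h.smooth_omegaL (hKV hw)).differentiableAt (by simp)).differentiableWithinAt)
    fun w hw ξ ζ => sub_eq_zero.1 (hcl w (hKV hw) ξ ζ)

end IsLocalSpray

/-- The linear map `t ↦ ((t₀, t₁), t₂ (rot y))`, a parametrization of a complement of the line
spanned by `(0, y)`. -/
def slice (y : E2) : EuclideanSpace ℝ (Fin 3) →L[ℝ] E4 :=
  LinearMap.toContinuousLinearMap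
    { toFun := fun t => (!₂[t 0, t 1], t 2 • rot y)
      map_add' := fun a b => by
        refine Prod.ext ?_ (add_smul _ _ _)
        ext i; fin_cases i <;> simp
      map_smul' := fun c a => by
        refine Prod.ext ?_ (mul_smul _ _ _)
        ext i; fin_cases i <;> simp }

/-- The level set through `z` of a primitive `f` of `ω`, as a graph over a slice transverse to the
Liouville field: `f (x, c y) = f (x, y) + log c` gives the rescaling explicitly. -/
theorem IsLocalSpray.exists_integral {s : E4 → E2} {V : Set E4} (h : IsLocalSpray s V)
    (hc : ∀ z ∈ V, ∀ c : ℝ, 0 < c → (z.1, c • z.2) ∈ V)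
    {f : E4 → ℝ} (hf : ∀ z ∈ V, HasFDerivAt f (omegaL s z) z) {z : E4} (hz : z ∈ V) :
    ∃ (W : Set (EuclideanSpace ℝ (Fin 3))) (ψ : EuclideanSpace ℝ (Fin 3) → E4),
      IsOpen W ∧ 0 ∈ W ∧ (∀ t ∈ W, ContDiffAt ℝ ∞ ψ t) ∧ ψ 0 = z ∧
      ∀ t ∈ W, ψ t ∈ V ∧ Function.Injective (fderiv ℝ ψ t) ∧
        ∀ ξ, omegaL s (ψ t) ξ = 0 ↔ ∃ a, fderiv ℝ ψ t a = ξ := by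
  -- `σ` parametrizes the slice, and `ψ` rescales its points to the level of `z`
  let σ : EuclideanSpace ℝ (Fin 3) → E4 := fun t => z + slice z.2 t
  have hσ : ∀ t, HasFDerivAt σ (slice z.2) t := fun t => (slice z.2).hasFDerivAt.const_add z
  have hσs : ContDiff ℝ ∞ σ := contDiff_const.add (slice z.2).contDiff
  let ψ : EuclideanSpace ℝ (Fin 3) → E4 := fun t => ((σ t).1, Real.exp (f z - f (σ t)) • (σ t).2)
  have hσ0 : σ 0 = z := by simp [σ]
  have hψs : ∀ t ∈ σ ⁻¹' V, ContDiffAt ℝ ∞ ψ t := by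
    intro t ht
    have h1 : ContDiffAt ℝ ∞ (fun t => f (σ t)) t :=
      (h.contDiffAt_primitive hf ht).comp t hσs.contDiffAt
    exact hσs.contDiffAt.fst.prodMk (((contDiffAt_const.sub h1).exp).smul hσs.contDiffAt.snd)
  have hψV : ∀ t ∈ σ ⁻¹' V, ψ t ∈ V := fun t ht => hc _ ht _ (Real.exp_pos _)
  refine ⟨σ ⁻¹' V, ψ, h.isOpen.preimage hσs.continuous, by rwa [mem_preimage, hσ0], hψs,
    by simp [ψ, hσ0], fun t ht => ⟨hψV t ht, ?_⟩⟩
  have hψ := ((hψs t ht).differentiableAt (by simp)).hasFDerivAt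
  have hinj : Function.Injective (fderiv ℝ ψ t) := by
    refine (injective_iff_map_eq_zero _).2 fun a ha => ?_
    have h1 := (((h.contDiffAt_primitive hf ht).differentiableAt (by simp)).hasFDerivAt.comp t
      (hσ t))
    have h2 : HasFDerivAt ψ _ t := (hσ t).fst.prodMk (((h1.const_sub (f z)).exp).smul (hσ t).snd)
    rw [h2.fderiv] at ha
    have e1 := congrArg Prod.fst ha
    have e2 := congrArg Prod.snd ha
    simp at e1 e2
    -- pairing with `y` kills `rot y`, so the derivative of the rescaling factor vanishes
    have e0 := congrArg (inner ℝ z.2) e2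
    have ey : (σ t).2 = z.2 + t 2 • rot z.2 := rfl
    have ea : (slice z.2 a).2 = a 2 • rot z.2 := rfl
    have horth : inner ℝ z.2 (rot z.2) = 0 := by
      simp only [inner_eq, rot_apply_zero, rot_apply_one]; ring
    have hrot : rot z.2 ≠ 0 := fun h0 => h.inner_ne_zero hz (by
      have r0 := congrArg (· 0) h0
      have r1 := congrArg (· 1) h0
      simp only [rot_apply_zero, rot_apply_one, PiLp.zero_apply, neg_eq_zero] at r0 r1
      rw [inner_eq, r0, r1]; ring)
    simp only [ey, ea, inner_add_right, inner_neg_right, inner_smul_right, horth, mul_zero,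
      add_zero, zero_add, inner_zero_right, neg_eq_zero] at e0
    have e3 := (mul_eq_zero.1 e0).resolve_right (h.inner_ne_zero hz)
    rw [e3, zero_smul, neg_zero, add_zero, ea] at e2
    have a2 : a 2 = 0 := by
      simpa [hrot, Real.exp_ne_zero] using e2
    ext i
    fin_cases i
    · exact congrArg (· 0) e1
    · exact congrArg (· 1) e1
    · exact a2
  refine ⟨hinj, ?_⟩
  have hle : LinearMap.range (fderiv ℝ ψ t).toLinearMap ≤
      LinearMap.ker (omegaL s (ψ t)).toLinearMap := by
    rintro _ ⟨a, rfl⟩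
    have h1 := (hf _ (hψV t ht)).comp t hψ
    have h2 : (f ∘ ψ) =ᶠ[𝓝 t] fun _ => f z := by
      filter_upwards [(h.isOpen.preimage hσs.continuous).mem_nhds ht] with r hr
      have := h.primitive_smul hc hf hr (Real.exp_pos (f z - f (σ r)))
      rw [Real.log_exp] at this
      change f _ = _
      rw [this]; ring
    exact DFunLike.congr_fun (h1.unique ((hasFDerivAt_const (f z) t).congr_of_eventuallyEq h2)) a
  have hker : Module.finrank ℝ (LinearMap.ker (omegaL s (ψ t)).toLinearMap) = 3 := by
    have h1 := (omegaL s (ψ t)).toLinearMap.finrank_range_add_finrank_ker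
    have h2 : LinearMap.range (omegaL s (ψ t)).toLinearMap = ⊤ := by
      refine LinearMap.range_eq_top.2 fun c => ⟨c • (0, (ψ t).2), ?_⟩
      change omegaL s (ψ t) _ = c
      rw [map_smul, h.omegaL_vert (hψV t ht)]; simp
    rw [h2, finrank_top, finrank_E4, Module.finrank_self] at h1
    omega
  have heq := Submodule.eq_of_le_of_finrank_eq hle (by
    rw [hker, LinearMap.finrank_range_of_inj hinj]; simp)
  intro ξ
  exact (SetLike.ext_iff.1 heq ξ).symm

/-! ### The spray in the charts of the tangent bundle -/

/-- The second component `s` of the spray `(y, s)` in the chart around `p`. -/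
def sprayL (S : VField M) (p : TB M) (z : E4) : E2 := (localVField S p z).2

/-- The part of `A` in the chart around `p`, as a subset of `ℝ² × ℝ²`. -/
def coneL (A : Set (TB M)) (p : TB M) : Set E4 :=
  (extChartAt IT p).target ∩ (extChartAt IT p).symm ⁻¹' A

/-- The horizontal projector in a chart. -/
def horL (s : E4 → E2) (z : E4) : E4 →L[ℝ] E4 :=
  (ContinuousLinearMap.inl ℝ E2 E2).comp (ContinuousLinearMap.fst ℝ E2 E2) +
    (ContinuousLinearMap.inr ℝ E2 E2).comp ((connL s z).comp (ContinuousLinearMap.fst ℝ E2 E2))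

theorem horL_apply (s : E4 → E2) (z ξ : E4) : horL s z ξ = (ξ.1, connL s z ξ.1) := by
  simp [horL]

theorem IsSprayOn.fderiv_horL {s : E4 → E2} {V : Set E4} (h : IsSprayOn s V) {z : E4}
    (hz : z ∈ V) : DifferentiableAt ℝ (horL s) z ∧
      ∀ a ζ, fderiv ℝ (horL s) z a ζ = (0, fderiv ℝ (connL s) z a ζ.1) := by
  have h1 := ((h.smooth_connL hz).differentiableAt (by simp)).hasFDerivAt.clm_comp
    (hasFDerivAt_const (ContinuousLinearMap.fst ℝ E2 E2) z)
  have h2 := (hasFDerivAt_const (ContinuousLinearMap.inr ℝ E2 E2) z).clm_comp h1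
  have h3 : HasFDerivAt (horL s) _ z := h2.const_add
    ((ContinuousLinearMap.inl ℝ E2 E2).comp (ContinuousLinearMap.fst ℝ E2 E2))
  refine ⟨h3.differentiableAt, fun a ζ => ?_⟩
  rw [h3.fderiv]
  simp

theorem mem_coneL {A : Set (TB M)} {p u : TB M} (hu : u ∈ (extChartAt IT p).source) (huA : u ∈ A) :
    extChartAt IT p u ∈ coneL A p :=
  ⟨(extChartAt IT p).map_source hu, by rwa [mem_preimage, (extChartAt IT p).left_inv hu]⟩

theorem exists_of_mem_coneL {A : Set (TB M)} {p : TB M} {z : E4} (hz : z ∈ coneL A p) :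
    ∃ u ∈ (extChartAt IT p).source, u ∈ A ∧ extChartAt IT p u = z :=
  ⟨_, (extChartAt IT p).map_target hz.1, hz.2, (extChartAt IT p).right_inv hz.1⟩

theorem isOpen_coneL {A : Set (TB M)} (hA : IsOpen A) (p : TB M) : IsOpen (coneL A p) :=
  (continuousOn_extChartAt_symm p).isOpen_inter_preimage (isOpen_extChartAt_target p) hA

theorem smul_mem_coneL {A : Set (TB M)} (hA : IsOpenCone A) {p : TB M} {z : E4}
    (hz : z ∈ coneL A p) {c : ℝ} (hc : 0 < c) : (z.1, c • z.2) ∈ coneL A p := by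
  refine ⟨mem_chart_target.2 (mem_chart_target.1 hz.1), ?_⟩
  rw [mem_preimage, chart_symm_smul hz.1]
  exact hA.smul_mem _ hz.2 c hc

theorem snd_ne_zero_of_mem_coneL {A : Set (TB M)} (hA : IsOpenCone A) {p : TB M} {z : E4}
    (hz : z ∈ coneL A p) : z.2 ≠ 0 := by
  intro h0
  have h1 := chart_symm_smul hz.1 0
  have h2 : ((z.1, (0 : ℝ) • z.2) : E4) = z := by rw [zero_smul, ← h0]
  rw [h2] at h1
  have h3 := hA.ne_zero _ hz.2
  rw [h1] at h3
  exact h3 (zero_smul ℝ _)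

theorem eventually_mem_coneL {A : Set (TB M)} (hA : IsOpen A) {p u : TB M}
    (hu : u ∈ (extChartAt IT p).source) (huA : u ∈ A) :
    ∀ᶠ z in 𝓝 (extChartAt IT p u), z ∈ coneL A p :=
  (isOpen_coneL hA p).mem_nhds (mem_coneL hu huA)

/-- Components of a `1`-form in a chart, from its values on tangent vectors. -/
theorem localForm1_eq_of_forall {A : Set (TB M)} {p : TB M} {η : Form1 M} {ηL : E4 → E4 →L[ℝ] ℝ}
    (h : ∀ u ∈ (extChartAt IT p).source, u ∈ A → ∀ ξ, η u ξ = ηL (extChartAt IT p u) (dchart p u ξ))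
    {z : E4} (hz : z ∈ coneL A p) : localForm1 η p z = ηL z := by
  obtain ⟨u, hu, huA, rfl⟩ := exists_of_mem_coneL hz
  refine ContinuousLinearMap.ext fun ξ => ?_
  obtain ⟨ξ, rfl⟩ := (dchart_bijective hu).2 ξ
  rw [localForm1_chart η hu, h u hu huA]

theorem localEndo_eq_of_forall {A : Set (TB M)} {p : TB M} {T : Endo M} {TL : E4 → E4 →L[ℝ] E4}
    (h : ∀ u ∈ (extChartAt IT p).source, u ∈ A →
      ∀ ξ, dchart p u (T u ξ) = TL (extChartAt IT p u) (dchart p u ξ))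
    {z : E4} (hz : z ∈ coneL A p) : localEndo T p z = TL z := by
  obtain ⟨u, hu, huA, rfl⟩ := exists_of_mem_coneL hz
  refine ContinuousLinearMap.ext fun ξ => ?_
  obtain ⟨ξ, rfl⟩ := (dchart_bijective hu).2 ξ
  rw [localEndo_chart T hu, h u hu huA]

namespace IsSpray
variable {S : VField M} {A : Set (TB M)}

theorem localVField_eq (hS : IsSpray S A) {p : TB M} {z : E4} (hz : z ∈ coneL A p) :
    localVField S p z = sprayField (sprayL S p) z := by
  obtain ⟨u, hu, huA, rfl⟩ := exists_of_mem_coneL hz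
  refine Prod.ext ?_ rfl
  have := congrArg (dchart p u) (hS.second_order u huA)
  rw [dchart_J hu, dchart_liouville hu] at this
  rw [localVField_chart S hu]
  exact congrArg Prod.snd this

theorem differentiableAt_localVField (hS : IsSpray S A) (hA : IsOpen A) {p u : TB M}
    (hu : u ∈ (extChartAt IT p).source) (huA : u ∈ A) :
    DifferentiableAt ℝ (localVField S p) (extChartAt IT p u) :=
  (localVField_contDiffAt hA hS.smooth hu huA).differentiableAt (by simp)

theorem localVField_liouville {p : TB M} {z : E4} (hz : z ∈ (extChartAt IT p).target) :
    localVField (liouville M) p z = (0, z.2) := by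
  have hu := (extChartAt IT p).map_target hz
  have := localVField_chart (liouville M) hu
  rwa [dchart_liouville hu, (extChartAt IT p).right_inv hz] at this

theorem eventually_localVField_liouville {p u : TB M} (hu : u ∈ (extChartAt IT p).source) :
    localVField (liouville M) p =ᶠ[𝓝 (extChartAt IT p u)] fun z => (0, z.2) :=
  eventually_of_mem ((isOpen_extChartAt_target p).mem_nhds ((extChartAt IT p).map_source hu))
    fun _ hz => localVField_liouville hz

theorem eventually_localEndo_J {p u : TB M} (hu : u ∈ (extChartAt IT p).source) :
    localEndo (J M) p =ᶠ[𝓝 (extChartAt IT p u)] fun _ =>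
      (ContinuousLinearMap.inr ℝ E2 E2).comp (ContinuousLinearMap.fst ℝ E2 E2) :=
  eventually_of_mem ((isOpen_coneL isOpen_univ p).mem_nhds (mem_coneL hu (mem_univ u)))
    fun _ hz => localEndo_eq_of_forall (TL := fun _ => (ContinuousLinearMap.inr ℝ E2 E2).comp
      (ContinuousLinearMap.fst ℝ E2 E2)) (fun _ hu _ ξ => dchart_J hu ξ) hz

/-- The bracket relation `[𝒞, S] = S` is the Euler relation for the components of `S`. -/
theorem isSprayOn (hS : IsSpray S A) (hA : IsOpenCone A) (p : TB M) :
    IsSprayOn (sprayL S p) (coneL A p) where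
  isOpen := isOpen_coneL hA.isOpen p
  smooth := by
    intro z hz
    obtain ⟨u, hu, huA, rfl⟩ := exists_of_mem_coneL hz
    exact (localVField_contDiffAt hA.isOpen hS.smooth hu huA).snd
  ne_zero := fun z hz => snd_ne_zero_of_mem_coneL hA hz
  euler := by
    intro z hz
    obtain ⟨u, hu, huA, rfl⟩ := exists_of_mem_coneL hz
    have hl : ∀ {q : TB M}, u ∈ (extChartAt IT q).source →
        DifferentiableAt ℝ (localVField (liouville M) q) (extChartAt IT q u) := fun hq =>
      (hasFDerivAt_vert _).differentiableAt.congr_of_eventuallyEq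
        (eventually_localVField_liouville hq)
    have hd : ∀ {q : TB M}, u ∈ (extChartAt IT q).source →
        DifferentiableAt ℝ (localVField S q) (extChartAt IT q u) := fun hq =>
      hS.differentiableAt_localVField hA.isOpen hq huA
    have hself := mem_extChartAt_source (I := IT) u
    have h1 := dchart_mlieBracket hu (hl hself) (hl hu) (hd hself) (hd hu)
    rw [hS.homogeneous u huA, Filter.EventuallyEq.lieBracket_vectorField_eq
      (eventually_localVField_liouville hu) (EventuallyEq.refl _ _), VectorField.lieBracket,
      (hasFDerivAt_vert _).fderiv, ← localVField_chart S hu] at h1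
    have h2 := congrArg Prod.snd h1
    have h3 : HasFDerivAt (sprayL S p) _ _ := (hd hu).hasFDerivAt.snd
    rw [h3.fderiv]
    change sprayL S p _ = _ - sprayL S p _ at h2
    rw [two_smul]
    exact (eq_sub_iff_add_eq.1 h2).symm

/-- In a chart, `Γ (ξ, η) = (ξ, 2 N ξ - η)`. -/
theorem dchart_Gam (hS : IsSpray S A) (hA : IsOpenCone A) {p u : TB M}
    (hu : u ∈ (extChartAt IT p).source) (huA : u ∈ A) (ξ : TT u) :
    dchart p u (Gam S u ξ) = ((dchart p u ξ).1,
      (2 : ℝ) • connL (sprayL S p) (extChartAt IT p u) (dchart p u ξ).1 - (dchart p u ξ).2) := by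
  have hself := mem_extChartAt_source (I := IT) u
  have hJ : ∀ {q : TB M}, u ∈ (extChartAt IT q).source →
      DifferentiableAt ℝ (localEndo (J M) q) (extChartAt IT q u) := fun hq =>
    (differentiableAt_const _).congr_of_eventuallyEq (eventually_localEndo_J hq)
  have h1 := dchart_lieDeriv hu (hS.differentiableAt_localVField hA.isOpen hself huA)
    (hS.differentiableAt_localVField hA.isOpen hu huA) (hJ hself) (hJ hu) ξ
  have hz := mem_coneL hu huA
  have e1 : fderiv ℝ (localVField S p) (extChartAt IT p u) = _ := Filter.EventuallyEq.fderiv_eq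
    ((eventually_mem_coneL hA.isOpen hu huA).mono fun z hz => hS.localVField_eq hz)
  have e2 := (eventually_localEndo_J hu).fderiv_eq (𝕜 := ℝ)
  have h := hS.isSprayOn hA p
  change dchart p u (-(lieDeriv S (J M) u ξ)) = _
  rw [map_neg, h1, lieL, e1, e2, (eventually_localEndo_J hu).self_of_nhds]
  have h0 : fderiv ℝ (sprayL S p) (extChartAt IT p u) ((0 : E2), (0 : E2)) = 0 := map_zero _
  simp only [fderiv_const_apply, zero_apply, zero_sub, add_apply, neg_apply,
    ContinuousLinearMap.comp_apply, ContinuousLinearMap.coe_fst', ContinuousLinearMap.inr_apply,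
    h.fderiv_sprayField hz, h0]
  refine Prod.ext ?_ ?_
  · simp
  · simp
    abel

theorem dchart_hor (hS : IsSpray S A) (hA : IsOpenCone A) {p u : TB M}
    (hu : u ∈ (extChartAt IT p).source) (huA : u ∈ A) (ξ : TT u) :
    dchart p u (hor S u ξ) = horL (sprayL S p) (extChartAt IT p u) (dchart p u ξ) := by
  change dchart p u ((1 / 2 : ℝ) • (ξ + Gam S u ξ)) = _
  rw [map_smul, map_add, hS.dchart_Gam hA hu huA, horL_apply]
  refine Prod.ext ?_ ?_
  · change (1 / 2 : ℝ) • (_ + _) = _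
    module
  · change (1 / 2 : ℝ) • (_ + (_ - _)) = _
    module

theorem dchart_ver (hS : IsSpray S A) (hA : IsOpenCone A) {p u : TB M}
    (hu : u ∈ (extChartAt IT p).source) (huA : u ∈ A) (ξ : TT u) :
    dchart p u (ver S u ξ) = (0, verL (sprayL S p) (extChartAt IT p u) (dchart p u ξ)) := by
  change dchart p u ((1 / 2 : ℝ) • (ξ - Gam S u ξ)) = _
  rw [map_smul, map_sub, hS.dchart_Gam hA hu huA, verL_apply]
  refine Prod.ext ?_ ?_
  · change (1 / 2 : ℝ) • (_ - _) = _
    module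
  · change (1 / 2 : ℝ) • (_ - (_ - _)) = _
    module

theorem dchart_lieDeriv_hor (hS : IsSpray S A) (hA : IsOpenCone A) {p u : TB M}
    (hu : u ∈ (extChartAt IT p).source) (huA : u ∈ A) (ξ : TT u) :
    dchart p u (lieDeriv S (hor S) u ξ) =
      (verL (sprayL S p) (extChartAt IT p u) (dchart p u ξ),
        curvL (sprayL S p) (extChartAt IT p u) (dchart p u ξ).1 +
          connL (sprayL S p) (extChartAt IT p u)
            (verL (sprayL S p) (extChartAt IT p u) (dchart p u ξ))) := by
  have hself := mem_extChartAt_source (I := IT) u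
  have hh : ∀ {q : TB M}, u ∈ (extChartAt IT q).source →
      localEndo (hor S) q =ᶠ[𝓝 (extChartAt IT q u)] horL (sprayL S q) := fun hq =>
    (eventually_mem_coneL hA.isOpen hq huA).mono fun z hz =>
      localEndo_eq_of_forall (fun v hv hvA ξ => hS.dchart_hor hA hv hvA ξ) hz
  have hd : ∀ {q : TB M}, u ∈ (extChartAt IT q).source →
      DifferentiableAt ℝ (horL (sprayL S q)) (extChartAt IT q u) := fun {q} hq =>
    ((hS.isSprayOn hA q).fderiv_horL (mem_coneL hq huA)).1
  have h1 := dchart_lieDeriv hu (hS.differentiableAt_localVField hA.isOpen hself huA)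
    (hS.differentiableAt_localVField hA.isOpen hu huA)
    ((hd hself).congr_of_eventuallyEq (hh hself)) ((hd hu).congr_of_eventuallyEq (hh hu)) ξ
  have hz := mem_coneL hu huA
  have e1 : fderiv ℝ (localVField S p) (extChartAt IT p u) = _ := Filter.EventuallyEq.fderiv_eq
    ((eventually_mem_coneL hA.isOpen hu huA).mono fun z hz => hS.localVField_eq hz)
  have e2 := (hh hu).fderiv_eq (𝕜 := ℝ)
  have h := hS.isSprayOn hA p
  have e3 := (h.fderiv_horL hz).2
  rw [h1, lieL, e1, e2, (hh hu).self_of_nhds, hS.localVField_eq hz]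
  simp only [add_apply, sub_apply, ContinuousLinearMap.comp_apply, e3, h.fderiv_sprayField hz,
    horL_apply, curvL_apply, verL_apply]
  refine Prod.ext ?_ ?_
  · simp only [Prod.fst_add, Prod.fst_sub]
    abel
  · simp only [Prod.snd_add, Prod.snd_sub, map_sub]
    module

/-- In a chart, `Φ (ξ, η) = (0, R ξ)`. -/
theorem dchart_jacobi (hS : IsSpray S A) (hA : IsOpenCone A) {p u : TB M}
    (hu : u ∈ (extChartAt IT p).source) (huA : u ∈ A) (ξ : TT u) :
    dchart p u (jacobi S u ξ) =
      (0, curvL (sprayL S p) (extChartAt IT p u) (dchart p u ξ).1) := by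
  change dchart p u (ver S u (lieDeriv S (hor S) u ξ)) = _
  rw [hS.dchart_ver hA hu huA, hS.dchart_lieDeriv_hor hA hu huA, verL_apply]
  simp

/-- The horizontal component of `𝔽` is the vertical projection; it is all that `i_𝔽 (α/ρ)` sees, as
`α` is semi-basic. -/
theorem dchart_cplx_fst (hS : IsSpray S A) (hA : IsOpenCone A) {p u : TB M}
    (hu : u ∈ (extChartAt IT p).source) (huA : u ∈ A) (ξ : TT u) :
    (dchart p u (cplx S u ξ)).1 = verL (sprayL S p) (extChartAt IT p u) (dchart p u ξ) := by
  change (dchart p u (hor S u (lieDeriv S (hor S) u ξ) - J M u ξ)).1 = _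
  rw [map_sub, hS.dchart_hor hA hu huA, hS.dchart_lieDeriv_hor hA hu huA, dchart_J hu, horL_apply]
  simp

/-- The pair `(ρ, α)` in a chart. It is determined by `Φ = ρ J - α ⊗ 𝒞`, because `y ≠ 0` and the
fibre has dimension `2`: pairing with `rot y` isolates `ρ`. -/
theorem isotropyPair_eq (hS : IsSpray S A) (hA : IsOpenCone A) {p u : TB M}
    (hu : u ∈ (extChartAt IT p).source) (huA : u ∈ A) :
    ricci S u = alphaL (sprayL S p) (extChartAt IT p u) (extChartAt IT p u).2 ∧
      ∀ ξ, alpha S u ξ = alphaL (sprayL S p) (extChartAt IT p u) (dchart p u ξ).1 := by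
  have h := hS.isSprayOn hA p
  have hz := mem_coneL hu huA
  set z := extChartAt IT p u with hzdef
  set s := sprayL S p
  have hex : ∃ q : ℝ × (TT u →L[ℝ] ℝ),
      ∀ ξ : TT u, jacobi S u ξ = q.1 • J M u ξ - q.2 ξ • liouville M u := by
    refine ⟨(alphaL s z z.2, ((alphaL s z).comp (ContinuousLinearMap.fst ℝ E2 E2)).comp
      (dchart p u)), fun ξ => (dchart_bijective hu).1 ?_⟩
    rw [hS.dchart_jacobi hA hu huA, map_sub, map_smul, map_smul, dchart_J hu, dchart_liouville hu,
      h.curvL_eq hz]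
    simp [z, s]
  have hq := Classical.epsilon_spec hex
  change ∀ ξ : TT u, jacobi S u ξ = ricci S u • J M u ξ - alpha S u ξ • liouville M u at hq
  have e : ∀ ξ : TT u, alphaL s z z.2 • (dchart p u ξ).1 - alphaL s z (dchart p u ξ).1 • z.2 =
      ricci S u • (dchart p u ξ).1 - alpha S u ξ • z.2 := by
    intro ξ
    have := congrArg (dchart p u) (hq ξ)
    rw [hS.dchart_jacobi hA hu huA, map_sub, map_smul, map_smul, dchart_J hu, dchart_liouville hu,
      h.curvL_eq hz] at this
    exact congrArg Prod.snd this
  have hρ : ricci S u = alphaL s z z.2 := by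
    -- evaluate `Φ` on a lift of `rot y`, and pair with `rot y`
    obtain ⟨ξ, hξ⟩ := (dchart_bijective hu).2 (rot z.2, 0)
    have e1 := congrArg (fun w => inner ℝ (rot z.2) w) (e ξ)
    have horth : inner ℝ (rot z.2) z.2 = 0 := by
      simp only [inner_eq, rot_apply_zero, rot_apply_one]; ring
    have hrr : inner ℝ (rot z.2) (rot z.2) = inner ℝ z.2 z.2 := by
      simp only [inner_eq, rot_apply_zero, rot_apply_one]; ring
    simp only [hξ, inner_sub_right, inner_smul_right, horth, hrr, mul_zero, sub_zero] at e1
    exact (mul_right_cancel₀ (h.inner_ne_zero hz) e1).symm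
  refine ⟨hρ, fun ξ => ?_⟩
  have e1 := e ξ
  rw [hρ, sub_right_inj] at e1
  exact (smul_left_injective ℝ (h.ne_zero z hz) e1).symm

theorem isLocalSpray (hS : IsSpray S A) (hA : IsOpenCone A) (hnf : NonFlat S A) (p : TB M) :
    IsLocalSpray (sprayL S p) (coneL A p) where
  toIsSprayOn := hS.isSprayOn hA p
  nonflat := by
    intro z hz
    obtain ⟨u, hu, huA, rfl⟩ := exists_of_mem_coneL hz
    rw [← (hS.isotropyPair_eq hA hu huA).1]
    exact (hnf u huA).2

theorem alphaRho_eq (hS : IsSpray S A) (hA : IsOpenCone A) {p u : TB M}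
    (hu : u ∈ (extChartAt IT p).source) (huA : u ∈ A) (ξ : TT u) :
    alphaRho S u ξ = betaH (sprayL S p) (extChartAt IT p u) (dchart p u ξ) := by
  obtain ⟨h1, h2⟩ := hS.isotropyPair_eq hA hu huA
  change (ricci S u)⁻¹ * alpha S u ξ = _
  rw [h1, h2]
  rfl

end IsSpray

/-- The `1`-form `ω = i_𝔽(α/ρ)`: the annihilator of the Berwald distribution, normalized by
`ω(𝒞) = 1`. -/
def berwaldForm (S : VField M) : Form1 M := contract (cplx S) (alphaRho S)

namespace IsSpray
variable {S : VField M} {A : Set (TB M)}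

theorem berwaldForm_eq (hS : IsSpray S A) (hA : IsOpenCone A) {p u : TB M}
    (hu : u ∈ (extChartAt IT p).source) (huA : u ∈ A) (ξ : TT u) :
    berwaldForm S u ξ = omegaL (sprayL S p) (extChartAt IT p u) (dchart p u ξ) := by
  change alphaRho S u (cplx S u ξ) = _
  rw [hS.alphaRho_eq hA hu huA]
  change betaL _ _ (dchart p u (cplx S u ξ)).1 = _
  rw [hS.dchart_cplx_fst hA hu huA]
  rfl

theorem localForm1_berwaldForm (hS : IsSpray S A) (hA : IsOpenCone A) {p : TB M} {z : E4}
    (hz : z ∈ coneL A p) : localForm1 (berwaldForm S) p z = omegaL (sprayL S p) z :=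
  localForm1_eq_of_forall (fun _ hu huA ξ => hS.berwaldForm_eq hA hu huA ξ) hz

theorem localForm1_alphaRho (hS : IsSpray S A) (hA : IsOpenCone A) {p : TB M} {z : E4}
    (hz : z ∈ coneL A p) : localForm1 (alphaRho S) p z = betaH (sprayL S p) z :=
  localForm1_eq_of_forall (fun _ hu huA ξ => hS.alphaRho_eq hA hu huA ξ) hz

theorem berwaldForm_liouville (hS : IsSpray S A) (hA : IsOpenCone A) (hnf : NonFlat S A)
    {u : TB M} (huA : u ∈ A) : berwaldForm S u (liouville M u) = 1 := by
  have hself := mem_extChartAt_source (I := IT) u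
  rw [hS.berwaldForm_eq hA hself huA, dchart_liouville hself]
  exact (hS.isLocalSpray hA hnf u).omegaL_vert (mem_coneL hself huA)

/-- The Berwald distribution is the kernel of `ω`: by non-flatness, the image of `Φ` is the vertical
part of this kernel. -/
theorem mem_berwald_iff (hS : IsSpray S A) (hA : IsOpenCone A) (hnf : NonFlat S A)
    {u : TB M} (huA : u ∈ A) (ξ : TT u) : ξ ∈ berwald S u ↔ berwaldForm S u ξ = 0 := by
  have hu := mem_extChartAt_source (I := IT) u
  have h := hS.isLocalSpray hA hnf u
  have hz := mem_coneL hu huA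
  have h1 : ∀ ζ, berwaldForm S u (hor S u ζ) = 0 := by
    intro ζ
    rw [hS.berwaldForm_eq hA hu huA, hS.dchart_hor hA hu huA, omegaL_apply, horL_apply]
    simp
  have h2 : ∀ ζ, berwaldForm S u (jacobi S u ζ) = 0 := by
    intro ζ
    rw [hS.berwaldForm_eq hA hu huA, hS.dchart_jacobi hA hu huA, omegaL_apply, h.curvL_eq_betaL hz]
    simp only [map_zero, sub_zero, map_smul, map_sub, h.betaL_snd hz, smul_eq_mul, mul_one,
      sub_self, mul_zero]
  constructor
  · intro hξ
    obtain ⟨_, ⟨a, rfl⟩, _, ⟨b, rfl⟩, rfl⟩ := Submodule.mem_sup.1 hξ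
    exact (map_add _ _ _).trans (by rw [add_eq_zero_iff_eq_neg]; exact (h1 a).trans (by
      rw [eq_comm, neg_eq_zero]; exact h2 b))
  · intro hξ
    rw [hS.berwaldForm_eq hA hu huA] at hξ
    set z := extChartAt IT u u with hzdef
    set s := sprayL S u
    obtain ⟨b, hb⟩ := (dchart_bijective hu).2
      ((alphaL s z z.2)⁻¹ • verL s z (dchart u u ξ), (0 : E2))
    have : ξ = hor S u ξ + jacobi S u b := by
      refine (dchart_bijective hu).1 ?_
      rw [map_add, hS.dchart_hor hA hu huA, hS.dchart_jacobi hA hu huA, hb]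
      simp only [map_smul]
      rw [h.curvL_eq_betaL hz]
      change betaL s z (verL s z (dchart u u ξ)) = 0 at hξ
      rw [hξ, zero_smul, sub_zero, smul_smul, inv_mul_cancel₀ (h.nonflat z hz), one_smul,
        horL_apply, verL_apply]
      refine Prod.ext (add_zero _).symm ?_
      exact (add_sub_cancel _ _).symm
    rw [this]
    exact Submodule.add_mem_sup ⟨_, rfl⟩ ⟨_, rfl⟩

end IsSpray

/-! ### Exterior derivatives of semi-basic forms and of primitives -/

theorem extdL_congr {E : Type*} [NormedAddCommGroup E] [NormedSpace ℝ E] {η η' : E → E →L[ℝ] ℝ}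
    {z : E} (h : η =ᶠ[𝓝 z] η') (ξ ζ : E) : extdL η z ξ ζ = extdL η' z ξ ζ := by
  rw [extdL, extdL, h.fderiv_eq]

theorem extdL_eq_zero_of_primitive {E : Type*} [NormedAddCommGroup E] [NormedSpace ℝ E]
    {η : E → E →L[ℝ] ℝ} {f : E → ℝ} {z : E} (hf : ContDiffAt ℝ 2 f z)
    (h : ∀ᶠ w in 𝓝 z, HasFDerivAt f (η w) w) (ξ ζ : E) : extdL η z ξ ζ = 0 := by
  have h1 : η =ᶠ[𝓝 z] fderiv ℝ f := h.mono fun w hw => hw.fderiv.symm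
  rw [extdL_congr h1, extdL, fderiv_fderiv_symm hf, sub_self]

/-- The exterior derivative of a semi-basic form vanishes on pairs of vertical vectors. -/
theorem extdL_vert_eq_zero {η : E4 → E4 →L[ℝ] ℝ} {z : E4} (hη : DifferentiableAt ℝ η z)
    (h : ∀ᶠ w in 𝓝 z, ∀ ζ : E2, η w (0, ζ) = 0) (η₁ η₂ : E2) :
    extdL η z (0, η₁) (0, η₂) = 0 := by
  have key : ∀ a ζ, fderiv ℝ η z a (0, ζ) = 0 := by
    intro a ζ
    have h1 := hη.hasFDerivAt.clm_apply (hasFDerivAt_const ((0, ζ) : E4) z)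
    have := DFunLike.congr_fun (h1.unique ((hasFDerivAt_const (0 : ℝ) z).congr_of_eventuallyEq
      (h.mono fun w hw => hw ζ))) a
    simpa using this
  rw [extdL, key, key, sub_zero]

theorem localForm1_contract_J (η : Form1 M) {p : TB M} {z : E4}
    (hz : z ∈ (extChartAt IT p).target) :
    localForm1 (contract (J M) η) p z = (localForm1 η p z).comp
      ((ContinuousLinearMap.inr ℝ E2 E2).comp (ContinuousLinearMap.fst ℝ E2 E2)) := by
  have hu := (extChartAt IT p).map_target hz
  refine ContinuousLinearMap.ext fun ξ => ?_
  obtain ⟨ξ, rfl⟩ := (dchart_bijective hu).2 ξ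
  have h1 := localForm1_chart (contract (J M) η) hu ξ
  have h2 := localForm1_chart η hu (J M _ ξ)
  rw [(extChartAt IT p).right_inv hz] at h1 h2
  rw [dchart_J hu] at h2
  rw [h1]
  exact h2.symm

theorem localForm1_self (η : Form1 M) (u : TB M) (ξ : TT u) :
    η u ξ = localForm1 η u (extChartAt IT u u) ξ := by
  rw [← localForm1_chart η (mem_extChartAt_source (I := IT) u), dchart_self_apply]

/-- The rank criterion for a `2`-form on `TM` with components `b` in the chart around `u`. -/
theorem rankAt_eq_four_iff (B : Form2 M) (u : TB M) (b : E4 → E4 → ℝ)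
    (hb : ∀ ξ ζ : TT u, B u ξ ζ = b ξ ζ) (halt : ∀ ξ ζ, b ξ ζ = - b ζ ξ)
    (h0 : ∀ η ζ : E2, b (0, η) (0, ζ) = 0) :
    B.rankAt u = 4 ↔ ∀ η : E2, (∀ ζ : E2, b (0, η) (ζ, 0) = 0) → η = 0 := by
  refine (finrank_range_eq_four_iff (B u) (fun ξ ζ => ?_) (fun η ζ => ?_)).trans ?_
  · exact (hb ξ ζ).trans ((halt ξ ζ).trans (congrArg Neg.neg (hb ζ ξ).symm))
  · exact (hb _ _).trans (h0 η ζ)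
  · exact forall_congr' fun η => imp_congr_left (forall_congr' fun ζ =>
      Eq.congr_left (hb ((0, η) : E4) ((ζ, 0) : E4)))

namespace IsSpray
variable {S : VField M} {A : Set (TB M)}

theorem mono (hS : IsSpray S A) {A' : Set (TB M)} (h : A' ⊆ A) : IsSpray S A' :=
  ⟨ContMDiffOn.mono hS.smooth h, fun u hu => hS.second_order u (h hu),
    fun u hu => hS.homogeneous u (h hu)⟩

theorem eventuallyEq_berwaldForm (hS : IsSpray S A) (hA : IsOpenCone A) {p u : TB M}
    (hu : u ∈ (extChartAt IT p).source) (huA : u ∈ A) :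
    localForm1 (berwaldForm S) p =ᶠ[𝓝 (extChartAt IT p u)] omegaL (sprayL S p) :=
  (eventually_mem_coneL hA.isOpen hu huA).mono fun _ hz => hS.localForm1_berwaldForm hA hz

theorem contDiffAt_berwaldForm (hS : IsSpray S A) (hA : IsOpenCone A) (hnf : NonFlat S A)
    {p u : TB M} (hu : u ∈ (extChartAt IT p).source) (huA : u ∈ A) :
    ContDiffAt ℝ ∞ (localForm1 (berwaldForm S) p) (extChartAt IT p u) :=
  ((hS.isLocalSpray hA hnf p).smooth_omegaL (mem_coneL hu huA)).congr_of_eventuallyEq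
    (hS.eventuallyEq_berwaldForm hA hu huA)

theorem smoothOn_berwaldForm (hS : IsSpray S A) (hA : IsOpenCone A) (hnf : NonFlat S A) :
    (berwaldForm S).SmoothOn A := fun u huA =>
  ((form1_contMDiffAt_iff (berwaldForm S) u).2
    (hS.contDiffAt_berwaldForm hA hnf (mem_extChartAt_source u) huA)).contMDiffWithinAt

theorem extd_berwaldForm (hS : IsSpray S A) (hA : IsOpenCone A) (hnf : NonFlat S A)
    {p u : TB M} (hu : u ∈ (extChartAt IT p).source) (huA : u ∈ A) (ξ ζ : TT u) :
    extd (berwaldForm S) u ξ ζ = extdL (omegaL (sprayL S p)) (extChartAt IT p u)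
      (dchart p u ξ) (dchart p u ζ) := by
  rw [extd_eq hu
    ((hS.contDiffAt_berwaldForm hA hnf (mem_extChartAt_source u) huA).differentiableAt (by simp))
    ((hS.contDiffAt_berwaldForm hA hnf hu huA).differentiableAt (by simp)),
    extdL_congr (hS.eventuallyEq_berwaldForm hA hu huA)]

theorem extd_berwaldForm_eq_zero_iff (hS : IsSpray S A) (hA : IsOpenCone A) (hnf : NonFlat S A)
    {p u : TB M} (hu : u ∈ (extChartAt IT p).source) (huA : u ∈ A) :
    extd (berwaldForm S) u = 0 ↔
      ∀ ξ ζ, extdL (omegaL (sprayL S p)) (extChartAt IT p u) ξ ζ = 0 := by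
  constructor
  · intro h ξ ζ
    obtain ⟨ξ, rfl⟩ := (dchart_bijective hu).2 ξ
    obtain ⟨ζ, rfl⟩ := (dchart_bijective hu).2 ζ
    rw [← hS.extd_berwaldForm hA hnf hu huA, h]
    rfl
  · intro h
    refine LinearMap.ext fun ξ => LinearMap.ext fun ζ => ?_
    rw [hS.extd_berwaldForm hA hnf hu huA, h]
    rfl

theorem annihilates_berwaldForm (hS : IsSpray S A) (hA : IsOpenCone A) (hnf : NonFlat S A) :
    Annihilates S (berwaldForm S) A :=
  fun _ huA ξ hξ => (hS.mem_berwald_iff hA hnf huA ξ).1 hξ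

/-- The annihilator of the Berwald distribution is spanned by `ω`. -/
theorem eq_mul_berwaldForm (hS : IsSpray S A) (hA : IsOpenCone A) (hnf : NonFlat S A)
    {θ : Form1 M} (hθ : Annihilates S θ A) {u : TB M} (huA : u ∈ A) (ξ : TT u) :
    θ u ξ = θ u (liouville M u) * berwaldForm S u ξ := by
  have h1 := hθ u huA (ξ - berwaldForm S u ξ • liouville M u) (by
    rw [hS.mem_berwald_iff hA hnf huA, map_sub, map_smul, hS.berwaldForm_liouville hA hnf huA]
    simp)
  rw [map_sub, map_smul, smul_eq_mul, sub_eq_zero] at h1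
  rw [h1, mul_comm]

/-! ### The ranks of the two-forms -/

/-- On vertical and horizontal vectors, `Ω` is `∂β/∂y + 2 β ⊗ β`. -/
theorem omega_rankAt_iff (hS : IsSpray S A) (hA : IsOpenCone A) (hnf : NonFlat S A) {u : TB M}
    (huA : u ∈ A) (hcl : extd (berwaldForm S) u = 0) :
    (Omega S).rankAt u = 4 ↔ IsTransversal (sprayL S u) (extChartAt IT u u) := by
  have hu := mem_extChartAt_source (I := IT) u
  have h := hS.isLocalSpray hA hnf u
  have hz := mem_coneL hu huA
  refine (rankAt_eq_four_iff (Omega S) u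
    (fun ξ ζ => extdL (betaH (sprayL S u)) (extChartAt IT u u) ξ ζ +
      2 * (omegaL (sprayL S u) (extChartAt IT u u) ξ * betaH (sprayL S u) (extChartAt IT u u) ζ -
        omegaL (sprayL S u) (extChartAt IT u u) ζ * betaH (sprayL S u) (extChartAt IT u u) ξ))
    (fun ξ ζ => ?_) (fun ξ ζ => ?_) (fun η ζ => ?_)).trans ?_
  · change extd (alphaRho S) u ξ ζ + 2 * (berwaldForm S u ξ * alphaRho S u ζ -
      berwaldForm S u ζ * alphaRho S u ξ) = _
    have e : localForm1 (alphaRho S) u =ᶠ[𝓝 (extChartAt IT u u)] betaH (sprayL S u) :=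
      (eventually_mem_coneL hA.isOpen hu huA).mono fun z hz => hS.localForm1_alphaRho hA hz
    rw [(extd_self (alphaRho S) u ξ ζ).trans (extdL_congr e ξ ζ),
      hS.berwaldForm_eq hA hu huA, hS.berwaldForm_eq hA hu huA,
      hS.alphaRho_eq hA hu huA, hS.alphaRho_eq hA hu huA, dchart_self_apply, dchart_self_apply]
  · rw [extdL, extdL]; ring
  · rw [extdL, h.fderiv_betaH hz, h.fderiv_betaH hz]; simp [betaH]
  · rw [← h.isTransversal_iff hz (h.fderiv_betaL_symm hz
      ((hS.extd_berwaldForm_eq_zero_iff hA hnf hu huA).1 hcl)) (k := 2) (by norm_num)]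
    refine forall_congr' fun η => imp_congr_left (forall_congr' fun ζ => ?_)
    rw [extdL, h.fderiv_betaH hz, h.fderiv_betaH hz]
    simp [omegaL_apply, betaH]

/-- In a chart, a form that annihilates the Berwald distribution is `φ ω` with the smooth factor
`φ = θ(𝒞)`, and then `i_J θ = φ β`. -/
theorem exists_local_multiple (hS : IsSpray S A) (hA : IsOpenCone A) (hnf : NonFlat S A)
    {θ : Form1 M} (hsm : θ.SmoothOn A) (hθ : Annihilates S θ A) {u : TB M} (huA : u ∈ A) :
    DifferentiableAt ℝ (fun z : E4 => localForm1 θ u z (0, z.2)) (extChartAt IT u u) ∧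
    (∀ᶠ z in 𝓝 (extChartAt IT u u),
      localForm1 θ u z = localForm1 θ u z (0, z.2) • omegaL (sprayL S u) z) ∧
    ∀ᶠ z in 𝓝 (extChartAt IT u u), localForm1 (contract (J M) θ) u z =
      localForm1 θ u z (0, z.2) • betaH (sprayL S u) z := by
  have hu := mem_extChartAt_source (I := IT) u
  have h1 := (form1_contMDiffAt_iff θ u).1 ((hsm u huA).contMDiffAt (hA.isOpen.mem_nhds huA))
  have h2 : ∀ᶠ z in 𝓝 (extChartAt IT u u),
      localForm1 θ u z = localForm1 θ u z (0, z.2) • omegaL (sprayL S u) z := by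
    filter_upwards [eventually_mem_coneL hA.isOpen hu huA] with z hz
    obtain ⟨v, hv, hvA, rfl⟩ := exists_of_mem_coneL hz
    refine ContinuousLinearMap.ext fun ξ => ?_
    obtain ⟨ξ, rfl⟩ := (dchart_bijective hv).2 ξ
    rw [← dchart_liouville hv, localForm1_chart θ hv, smul_apply, localForm1_chart θ hv,
      ← hS.berwaldForm_eq hA hv hvA]
    exact hS.eq_mul_berwaldForm hA hnf hθ hvA ξ
  refine ⟨(h1.differentiableAt (by simp)).clm_apply (hasFDerivAt_vert _).differentiableAt, h2, ?_⟩
  filter_upwards [h2, eventually_mem_coneL hA.isOpen hu huA] with z hz hzA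
  rw [localForm1_contract_J θ hzA.1]
  refine ContinuousLinearMap.ext fun ξ => ?_
  change localForm1 θ u z (0, ξ.1) = _
  rw [DFunLike.congr_fun hz (0, ξ.1)]
  simp [omegaL_apply, betaH]

/-- If `θ` is closed, then `d_J θ = -d i_J θ`. -/
theorem rankForm_rankAt_iff (hS : IsSpray S A) (hA : IsOpenCone A) (hnf : NonFlat S A)
    {θ : Form1 M} (hcl : IsClosedForm θ A) (hθ : Annihilates S θ A) {u : TB M} (huA : u ∈ A) :
    (rankForm θ).rankAt u = 4 ↔ ∀ η : E2, (∀ ζ : E2,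
      -extdL (localForm1 (contract (J M) θ) u) (extChartAt IT u u) (0, η) (ζ, 0) +
        2 * (localForm1 θ u (extChartAt IT u u) (0, η) *
            localForm1 (contract (J M) θ) u (extChartAt IT u u) (ζ, 0) -
          localForm1 θ u (extChartAt IT u u) (ζ, 0) *
            localForm1 (contract (J M) θ) u (extChartAt IT u u) (0, η)) = 0) → η = 0 := by
  have hu := mem_extChartAt_source (I := IT) u
  have h := hS.isLocalSpray hA hnf u
  have hz := mem_coneL hu huA
  obtain ⟨h1, h2, h3⟩ := hS.exists_local_multiple hA hnf hcl.1 hθ huA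
  have hv : ∀ᶠ w in 𝓝 (extChartAt IT u u), ∀ ζ : E2,
      localForm1 (contract (J M) θ) u w (0, ζ) = 0 := h3.mono fun w hw ζ => by
    rw [hw]; simp [betaH]
  have hd : DifferentiableAt ℝ (localForm1 (contract (J M) θ) u) (extChartAt IT u u) :=
    (h1.smul ((h.smooth_betaH hz).differentiableAt (by simp))).congr_of_eventuallyEq h3
  refine rankAt_eq_four_iff (rankForm θ) u
    (fun ξ ζ => -extdL (localForm1 (contract (J M) θ) u) (extChartAt IT u u) ξ ζ +
        2 * (localForm1 θ u (extChartAt IT u u) ξ *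
            localForm1 (contract (J M) θ) u (extChartAt IT u u) ζ -
          localForm1 θ u (extChartAt IT u u) ζ *
            localForm1 (contract (J M) θ) u (extChartAt IT u u) ξ))
    (fun ξ ζ => ?_) (fun ξ ζ => ?_) (fun η ζ => ?_)
  · change (extd θ u (J M u ξ) ζ + extd θ u ξ (J M u ζ)) - extd (contract (J M) θ) u ξ ζ +
      2 * (θ u ξ * contract (J M) θ u ζ - θ u ζ * contract (J M) θ u ξ) = _
    rw [hcl.2 u huA, extd_self, localForm1_self, localForm1_self, localForm1_self,
      localForm1_self]
    change (0 : ℝ) + 0 - _ + _ = _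
    ring
  · rw [extdL, extdL]; ring
  · rw [extdL_vert_eq_zero hd hv, hv.self_of_nhds, hv.self_of_nhds]; simp

theorem closed_and_transversal_of_rankForm (hS : IsSpray S A) (hA : IsOpenCone A)
    (hnf : NonFlat S A) {θ : Form1 M} (hcl : IsClosedForm θ A) (hθ : Annihilates S θ A)
    {u : TB M} (huA : u ∈ A) (hr : (rankForm θ).rankAt u = 4) :
    extd (berwaldForm S) u = 0 ∧ IsTransversal (sprayL S u) (extChartAt IT u u) := by
  have hu := mem_extChartAt_source (I := IT) u
  obtain ⟨h1, h2, h3⟩ := hS.exists_local_multiple hA hnf hcl.1 hθ huA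
  rw [hS.extd_berwaldForm_eq_zero_iff hA hnf hu huA]
  refine (hS.isLocalSpray hA hnf u).closed_and_transversal (mem_coneL hu huA) h1 h2 h3
    (fun ξ ζ => ?_) ((hS.rankForm_rankAt_iff hA hnf hcl hθ huA).1 hr)
  exact (extd_self θ u ξ ζ).symm.trans
    (DFunLike.congr_fun (DFunLike.congr_fun (hcl.2 u huA) ξ) ζ)

/-- On vertical and horizontal vectors, `d_J ω + 2 ω ∧ i_J ω` is `-∂β/∂y + 2 β ⊗ β`. -/
theorem rankForm_berwaldForm (hS : IsSpray S A) (hA : IsOpenCone A) (hnf : NonFlat S A)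
    (hcl : ∀ u ∈ A, extd (berwaldForm S) u = 0) {u : TB M} (huA : u ∈ A)
    (ht : IsTransversal (sprayL S u) (extChartAt IT u u)) :
    (rankForm (berwaldForm S)).rankAt u = 4 := by
  have hu := mem_extChartAt_source (I := IT) u
  have hz := mem_coneL hu huA
  have h := hS.isLocalSpray hA hnf u
  rw [hS.rankForm_rankAt_iff hA hnf ⟨hS.smoothOn_berwaldForm hA hnf, hcl⟩
    (hS.annihilates_berwaldForm hA hnf) huA]
  rw [← h.isTransversal_iff hz (h.fderiv_betaL_symm hz
      ((hS.extd_berwaldForm_eq_zero_iff hA hnf hu huA).1 (hcl u huA))) (k := -2)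
      (by norm_num)] at ht
  intro η hη
  refine ht η fun ζ => ?_
  have e := h.rankForm_multiple hz (φ := fun _ => 1) (θ := localForm1 (berwaldForm S) u)
    (θJ := localForm1 (contract (J M) (berwaldForm S)) u) (differentiableAt_const 1)
    (by rw [one_smul]; exact hS.localForm1_berwaldForm hA hz)
    ((eventually_mem_coneL hA.isOpen hu huA).mono fun w hw => by
      rw [localForm1_contract_J _ hw.1, hS.localForm1_berwaldForm hA hw, one_smul]
      refine ContinuousLinearMap.ext fun ξ => ?_
      simp [omegaL_apply, betaH]) η ζ
  rw [hη] at e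
  rw [fderiv_const_apply] at e
  simp only [zero_apply] at e
  linarith

end IsSpray

/-! ### Integral manifolds of the Berwald distribution -/

namespace IsSpray
variable {S : VField M} {A : Set (TB M)}

theorem extdL_omegaL_eq_zero (hS : IsSpray S A) (hA : IsOpenCone A) (hnf : NonFlat S A)
    (hcl : ∀ u ∈ A, extd (berwaldForm S) u = 0) (p : TB M) :
    ∀ z ∈ coneL A p, ∀ ξ ζ, extdL (omegaL (sprayL S p)) z ξ ζ = 0 := by
  intro z hz
  obtain ⟨u, hu, huA, rfl⟩ := exists_of_mem_coneL hz
  exact (hS.extd_berwaldForm_eq_zero_iff hA hnf hu huA).1 (hcl u huA)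

/-- An integral manifold of the Berwald distribution through `u` forces `dω = 0` at `u`. -/
theorem extd_berwaldForm_of_isIntegrable (hS : IsSpray S A) (hA : IsOpenCone A)
    (hnf : NonFlat S A) (hint : IsIntegrable 3 (berwald S) A) {u : TB M} (huA : u ∈ A) :
    extd (berwaldForm S) u = 0 := by
  obtain ⟨W, ψ, hW, h0, hψ, h0u, hr⟩ := hint u huA
  have hu := mem_extChartAt_source (I := IT) u
  have h := hS.isLocalSpray hA hnf u
  have hsm : ∀ r ∈ W, ContMDiffAt (𝓡 3) IT ∞ ψ r := fun r hrW =>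
    (hψ r hrW).contMDiffAt (hW.mem_nhds hrW)
  have hchart : ∀ {v : TB M}, v ∈ (extChartAt IT u).source →
      ContMDiffAt IT 𝓘(ℝ, E4) ∞ (extChartAt IT u) v := fun hv =>
    contMDiffAt_extChartAt' (by rwa [← extChartAt_source IT])
  let g : EuclideanSpace ℝ (Fin 3) → E4 := extChartAt IT u ∘ ψ
  have hg0 : g 0 = extChartAt IT u u := by simp only [g, Function.comp_apply, h0u]
  have hg : ContDiffAt ℝ ∞ g 0 :=
    (ContMDiffAt.comp (I' := IT) (0 : EuclideanSpace ℝ (Fin 3)) (hchart (by rw [h0u]; exact hu))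
      (hsm 0 h0)).contDiffAt
  have hdg : ∀ r ∈ W, ψ r ∈ (extChartAt IT u).source → ∀ a,
      fderiv ℝ g r a = dchart u (ψ r) (mfderiv (𝓡 3) IT ψ r a) := by
    intro r hrW hrs a
    have := mfderiv_comp (I := 𝓡 3) (I' := IT) (I'' := 𝓘(ℝ, E4)) r
      (mdifferentiableAt_chart hrs) ((hsm r hrW).mdifferentiableAt (by simp))
    rw [mfderiv_eq_fderiv] at this
    exact DFunLike.congr_fun this a
  have hmem : ∀ r ∈ W, ∀ ξ, berwaldForm S (ψ r) ξ = 0 ↔ ∃ a, mfderiv (𝓡 3) IT ψ r a = ξ := by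
    intro r hrW ξ
    obtain ⟨h1, -, h2⟩ := hr r hrW
    rw [← hS.mem_berwald_iff hA hnf h1, ← h2]
    exact LinearMap.mem_range
  have h0s : ψ 0 ∈ (extChartAt IT u).source := by rw [h0u]; exact hu
  have h0A := (hr 0 h0).1
  rw [hS.extd_berwaldForm_eq_zero_iff hA hnf hu huA, ← hg0]
  refine h.closed_of_integral (mem_coneL h0s h0A) (hg.of_le (WithTop.coe_le_coe.2 le_top)) ?_ ?_
  · filter_upwards [hW.mem_nhds h0, (hsm 0 h0).continuousAt.preimage_mem_nhds
      ((isOpen_extChartAt_source (I := IT) u).mem_nhds h0s)] with r hrW hrs a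
    rw [hdg r hrW hrs]
    exact (hS.berwaldForm_eq hA hrs (hr r hrW).1 _).symm.trans ((hmem r hrW _).2 ⟨a, rfl⟩)
  · intro ξ hξ
    obtain ⟨ξ, rfl⟩ := (dchart_bijective h0s).2 ξ
    have hξ' : berwaldForm S (ψ 0) ξ = 0 := by
      rw [hS.berwaldForm_eq hA h0s h0A]; exact hξ
    obtain ⟨a, rfl⟩ := (hmem 0 h0 ξ).1 hξ'
    exact ⟨a, hdg 0 h0 h0s a⟩

theorem isIntegrable_berwald (hS : IsSpray S A) (hA : IsOpenCone A) (hnf : NonFlat S A)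
    (hcl : ∀ u ∈ A, extd (berwaldForm S) u = 0) : IsIntegrable 3 (berwald S) A := by
  intro u huA
  have hu := mem_extChartAt_source (I := IT) u
  have h := hS.isLocalSpray hA hnf u
  obtain ⟨K, hKA, hK, huK, hKc, f, hf⟩ := h.exists_primitive
    (fun z hz c hc => smul_mem_coneL hA hz hc) (hS.extdL_omegaL_eq_zero hA hnf hcl u)
    (mem_coneL hu huA)
  obtain ⟨W, ψ, hW, h0, hψ, hψ0, hr⟩ := (h.mono hK hKA).exists_integral hKc hf huK
  have hsymm : ∀ {z : E4}, z ∈ (extChartAt IT u).target →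
      ContMDiffAt 𝓘(ℝ, E4) IT ∞ (extChartAt IT u).symm z := fun hz =>
    (contMDiffOn_extChartAt_symm u).contMDiffAt ((isOpen_extChartAt_target u).mem_nhds hz)
  have hd : ∀ t ∈ W, mfderiv (𝓡 3) IT ((extChartAt IT u).symm ∘ ψ) t =
      (dchartInv u (ψ t)).comp (fderiv ℝ ψ t) := by
    intro t ht
    have := mfderiv_comp (I := 𝓡 3) (I' := 𝓘(ℝ, E4)) (I'' := IT) t
      ((hsymm (hKA (hr t ht).1).1).mdifferentiableAt (by simp))
      ((hψ t ht).contMDiffAt.mdifferentiableAt (by simp))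
    rwa [mfderiv_eq_fderiv] at this
  refine ⟨W, (extChartAt IT u).symm ∘ ψ, hW, h0, fun t ht => ?_, ?_, fun t ht => ?_⟩
  · exact (ContMDiffAt.comp (I' := 𝓘(ℝ, E4)) t (hsymm (hKA (hr t ht).1).1)
      (hψ t ht).contMDiffAt).contMDiffWithinAt
  · rw [Function.comp_apply, hψ0, extChartAt_to_inv]
  · obtain ⟨htK, hinj, hran⟩ := hr t ht
    have htA := hKA htK
    have htA' : (extChartAt IT u).symm (ψ t) ∈ A := htA.2
    have hts := (extChartAt IT u).map_target htA.1
    have hmem : ∀ ξ : TT ((extChartAt IT u).symm (ψ t)),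
        ξ ∈ berwald S ((extChartAt IT u).symm (ψ t)) ↔
          ∃ a, fderiv ℝ ψ t a = dchart u ((extChartAt IT u).symm (ψ t)) ξ := fun ξ => by
      rw [hS.mem_berwald_iff hA hnf htA', hS.berwaldForm_eq hA hts htA',
        (extChartAt IT u).right_inv htA.1, hran]
    have hrange : LinearMap.range ((dchartInv u (ψ t)).comp (fderiv ℝ ψ t)).toLinearMap =
        berwald S ((extChartAt IT u).symm (ψ t)) := by
      refine Submodule.ext fun ξ => ?_
      rw [hmem ξ]
      constructor
      · rintro ⟨a, rfl⟩
        exact ⟨a, (dchart_dchartInv u htA.1 _).symm⟩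
      · rintro ⟨a, ha⟩
        refine ⟨a, ?_⟩
        change dchartInv u (ψ t) (fderiv ℝ ψ t a) = ξ
        rw [ha]
        exact dchartInv_dchart u htA.1 ξ
    have hinj' : Function.Injective ((dchartInv u (ψ t)).comp (fderiv ℝ ψ t)) := by
      intro a b hab
      have := congrArg (dchart u ((extChartAt IT u).symm (ψ t))) hab
      rw [ContinuousLinearMap.comp_apply, ContinuousLinearMap.comp_apply,
        dchart_dchartInv u htA.1, dchart_dchartInv u htA.1] at this
      exact hinj this
    refine ⟨htA', ?_, ?_⟩
    · rw [hd t ht]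
      exact hinj'
    · rw [hd t ht]
      exact hrange

/-! ### Primitives of the form `ω` -/

theorem hasFDerivAt_of_isPrimitive (hS : IsSpray S A) (hA : IsOpenCone A) {f : TB M → ℝ}
    (hf : IsPrimitive f (berwaldForm S) A) (p : TB M) :
    ∀ z ∈ coneL A p, HasFDerivAt (localFun f p) (omegaL (sprayL S p) z) z := by
  intro z hz
  obtain ⟨u, hu, huA, rfl⟩ := exists_of_mem_coneL hz
  have hs := (hf.1 u huA).contMDiffAt (hA.isOpen.mem_nhds huA)
  have h1 := ((localFun_contDiffAt hu hs).differentiableAt (by simp)).hasFDerivAt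
  suffices h2 : omegaL (sprayL S p) (extChartAt IT p u) =
      fderiv ℝ (localFun f p) (extChartAt IT p u) by rw [h2]; exact h1
  refine ContinuousLinearMap.ext fun ξ => ?_
  obtain ⟨ξ, rfl⟩ := (dchart_bijective hu).2 ξ
  rw [fderiv_localFun hu (hs.mdifferentiableAt (by simp)), hf.2 u huA, hS.berwaldForm_eq hA hu huA]

theorem isPrimitive_of_hasFDerivAt (hS : IsSpray S A) (hA : IsOpenCone A) (hnf : NonFlat S A)
    {f : TB M → ℝ} (hf : ∀ u ∈ A, ∃ p, u ∈ (extChartAt IT p).source ∧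
      ∀ z ∈ coneL A p, HasFDerivAt (localFun f p) (omegaL (sprayL S p) z) z) :
    IsPrimitive f (berwaldForm S) A := by
  have hs : ∀ u ∈ A, ContMDiffAt IT 𝓘(ℝ, ℝ) ∞ f u := by
    intro u huA
    obtain ⟨p, hu, hfp⟩ := hf u huA
    exact contMDiffAt_of_localFun hu
      ((hS.isLocalSpray hA hnf p).contDiffAt_primitive hfp (mem_coneL hu huA))
  refine ⟨fun u huA => (hs u huA).contMDiffWithinAt, fun u huA => ?_⟩
  obtain ⟨p, hu, hfp⟩ := hf u huA
  refine ContinuousLinearMap.ext fun ξ => ?_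
  rw [← fderiv_localFun hu ((hs u huA).mdifferentiableAt (by simp)),
    (hfp _ (mem_coneL hu huA)).fderiv, hS.berwaldForm_eq hA hu huA]

theorem exists_isPrimitive (hS : IsSpray S A) (hA : IsOpenCone A) (hnf : NonFlat S A)
    (hcl : ∀ u ∈ A, extd (berwaldForm S) u = 0) {u : TB M} (huA : u ∈ A) :
    ∃ A' ⊆ A, IsOpenCone A' ∧ u ∈ A' ∧ ∃ f : TB M → ℝ, IsPrimitive f (berwaldForm S) A' := by
  have hu := mem_extChartAt_source (I := IT) u
  obtain ⟨K, hKA, hK, huK, hKc, f, hf⟩ := (hS.isLocalSpray hA hnf u).exists_primitive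
    (fun z hz c hc => smul_mem_coneL hA hz hc) (hS.extdL_omegaL_eq_zero hA hnf hcl u)
    (mem_coneL hu huA)
  let A' : Set (TB M) := (extChartAt IT u).source ∩ extChartAt IT u ⁻¹' K
  have hsub : A' ⊆ A := by
    rintro v ⟨hv, hvK⟩
    have := (hKA hvK).2
    rwa [mem_preimage, (extChartAt IT u).left_inv hv] at this
  have hA' : IsOpenCone A' := by
    refine ⟨(continuousOn_extChartAt u).isOpen_inter_preimage (isOpen_extChartAt_source u) hK,
      fun v hv => hA.ne_zero v (hsub hv), fun v hv c hc => ?_⟩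
    refine ⟨mem_chart_source.2 (mem_chart_source.1 hv.1), ?_⟩
    rw [mem_preimage, chart_smul hv.1]
    exact hKc _ hv.2 c hc
  refine ⟨A', hsub, hA', ⟨hu, huK⟩, f ∘ extChartAt IT u,
    (hS.mono hsub).isPrimitive_of_hasFDerivAt hA' (fun v hv => hnf v (hsub hv))
      fun v hv => ⟨u, hv.1, fun z hz => ?_⟩⟩
  have hzK : z ∈ K := by
    have := hz.2.2
    rwa [mem_preimage, (extChartAt IT u).right_inv hz.1] at this
  refine (hf z hzK).congr_of_eventuallyEq ?_
  filter_upwards [(isOpen_extChartAt_target (I := IT) u).mem_nhds hz.1] with w hw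
  simp only [localFun, Function.comp_apply, (extChartAt IT u).right_inv hw]

theorem isPrimitive_smul (hS : IsSpray S A) (hA : IsOpenCone A) (hnf : NonFlat S A)
    {f : TB M → ℝ} (hf : IsPrimitive f (berwaldForm S) A) {u : TB M} (huA : u ∈ A) {c : ℝ}
    (hc : 0 < c) : f ⟨u.proj, c • u.snd⟩ = f u + Real.log c := by
  have hu := mem_extChartAt_source (I := IT) u
  have := (hS.isLocalSpray hA hnf u).primitive_smul (fun z hz c hc => smul_mem_coneL hA hz hc)
    (hS.hasFDerivAt_of_isPrimitive hA hf u) (mem_coneL hu huA) hc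
  rw [← chart_smul hu] at this
  simp only [localFun, Function.comp_apply] at this
  have hc' : (⟨u.proj, c • u.snd⟩ : TB M) ∈ (extChartAt IT u).source :=
    mem_chart_source.2 (mem_chart_source.1 hu)
  rwa [(extChartAt IT u).left_inv hu, (extChartAt IT u).left_inv hc'] at this

theorem extd_berwaldForm_of_isPrimitive (hS : IsSpray S A) (hA : IsOpenCone A) (hnf : NonFlat S A)
    {f : TB M → ℝ} (hf : IsPrimitive f (berwaldForm S) A) {u : TB M} (huA : u ∈ A) :
    extd (berwaldForm S) u = 0 := by
  have hu := mem_extChartAt_source (I := IT) u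
  have h := hS.isLocalSpray hA hnf u
  have hp := hS.hasFDerivAt_of_isPrimitive hA hf u
  exact (hS.extd_berwaldForm_eq_zero_iff hA hnf hu huA).2 (extdL_eq_zero_of_primitive
    ((h.contDiffAt_primitive hp (mem_coneL hu huA)).of_le (WithTop.coe_le_coe.2 le_top))
    ((h.mem_nhds (mem_coneL hu huA)).mono hp))

end IsSpray

/-! ### Finsler functions and primitives -/

theorem localFun_chart (f : TB M → ℝ) {p u : TB M} (hu : u ∈ (extChartAt IT p).source) :
    localFun f p (extChartAt IT p u) = f u := by
  rw [localFun, Function.comp_apply, (extChartAt IT p).left_inv hu]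

/-- The homotheties of the fibres in a chart. -/
theorem localFun_smul (f : TB M → ℝ) {p : TB M} {z : E4} (hz : z ∈ (extChartAt IT p).target)
    (c : ℝ) : localFun f p (z.1, c • z.2) =
      f ⟨((extChartAt IT p).symm z).proj, c • ((extChartAt IT p).symm z).snd⟩ := by
  rw [localFun, Function.comp_apply, chart_symm_smul hz]

/-- The form `d_J f` in a chart. -/
theorem localForm1_dAlong0_J {f : TB M → ℝ} {p u : TB M} (hu : u ∈ (extChartAt IT p).source)
    (hf : MDifferentiableAt IT 𝓘(ℝ, ℝ) f u) :
    localForm1 (dAlong0 (J M) f) p (extChartAt IT p u) =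
      dJL (localFun f p) (extChartAt IT p u) := by
  rw [dAlong0, localForm1_contract_J _ ((extChartAt IT p).map_source hu)]
  refine ContinuousLinearMap.ext fun ξ => ?_
  obtain ⟨ξ', h⟩ := (dchart_bijective hu).2 (0, ξ.1)
  change localForm1 (diff f) p (extChartAt IT p u) (0, ξ.1) =
    fderiv ℝ (localFun f p) (extChartAt IT p u) (0, ξ.1)
  rw [← h, localForm1_chart _ hu, fderiv_localFun hu hf]

theorem smooth_dJL {E : E4 → ℝ} {z : E4} (hE : ContDiffAt ℝ ∞ E z) : ContDiffAt ℝ ∞ (dJL E) z :=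
  (hE.fderiv_right (m := ∞) (by simp)).clm_comp contDiffAt_const

theorem extd_dAlong0_J {f : TB M → ℝ} {A : Set (TB M)} (hA : IsOpen A)
    (hf : ContMDiffOn IT 𝓘(ℝ, ℝ) ∞ f A) {p u : TB M} (hu : u ∈ (extChartAt IT p).source)
    (huA : u ∈ A) (ξ ζ : TT u) :
    extd (dAlong0 (J M) f) u ξ ζ = extdL (dJL (localFun f p)) (extChartAt IT p u)
      (dchart p u ξ) (dchart p u ζ) := by
  have hs : ∀ v ∈ A, ContMDiffAt IT 𝓘(ℝ, ℝ) ∞ f v := fun v hv =>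
    (hf v hv).contMDiffAt (hA.mem_nhds hv)
  have e : ∀ {q : TB M}, u ∈ (extChartAt IT q).source →
      localForm1 (dAlong0 (J M) f) q =ᶠ[𝓝 (extChartAt IT q u)] dJL (localFun f q) := by
    intro q hq
    filter_upwards [eventually_mem_coneL hA hq huA] with z hz
    obtain ⟨v, hv, hvA, rfl⟩ := exists_of_mem_coneL hz
    exact localForm1_dAlong0_J hv ((hs v hvA).mdifferentiableAt (by simp))
  have hd : ∀ {q : TB M}, u ∈ (extChartAt IT q).source →
      DifferentiableAt ℝ (localForm1 (dAlong0 (J M) f) q) (extChartAt IT q u) := fun hq =>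
    ((smooth_dJL (localFun_contDiffAt hq (hs u huA))).differentiableAt
      (by simp)).congr_of_eventuallyEq (e hq)
  rw [extd_eq hu (hd (mem_extChartAt_source u)) (hd hu), extdL_congr (e hu)]

/-- The Hessian of the restriction to a fibre. -/
theorem fderiv_fderiv_vert {E : E4 → ℝ} {z : E4} (hE : ContDiffAt ℝ 2 E z) (η ζ : E2) :
    fderiv ℝ (fun y : E2 => fderiv ℝ (fun w : E2 => E (z.1, w)) y) z.2 η ζ =
      fderiv ℝ (fderiv ℝ E) z (0, η) (0, ζ) := by
  have hι : ∀ y : E2, HasFDerivAt (fun w : E2 => (z.1, w)) (ContinuousLinearMap.inr ℝ E2 E2) y :=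
    fun y => hasFDerivAt_prodMk_right z.1 y
  have hev : ∀ᶠ y : E2 in 𝓝 z.2, ContDiffAt ℝ 2 E (z.1, y) :=
    (hι z.2).continuousAt.eventually (p := fun w => ContDiffAt ℝ 2 E w) (hE.eventually (by simp))
  have h1 : (fun y => fderiv ℝ (fun w : E2 => E (z.1, w)) y) =ᶠ[𝓝 z.2]
      fun y => (fderiv ℝ E (z.1, y)).comp (ContinuousLinearMap.inr ℝ E2 E2) :=
    hev.mono fun y hy => ((hy.differentiableAt two_ne_zero).hasFDerivAt.comp y (hι y)).fderiv
  have h2 : HasFDerivAt (fun w : E2 => fderiv ℝ E (z.1, w)) _ z.2 :=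
    (differentiableAt_fderiv hE).hasFDerivAt.comp z.2 (hι z.2)
  rw [((h2.clm_comp (hasFDerivAt_const (ContinuousLinearMap.inr ℝ E2 E2)
    z.2)).congr_of_eventuallyEq h1).fderiv]
  simp

/-- The metric tensor is half the vertical Hessian of `F²` in the chart around the base point. -/
theorem metricTensor_apply {F : TB M → ℝ} {u : TB M}
    (hF : ContDiffAt ℝ 2 (localFun (fun w => F w ^ 2) u) (extChartAt IT u u)) (η ζ : E2) :
    metricTensor F u η ζ = 1 / 2 * fderiv ℝ (fderiv ℝ (localFun (fun w => F w ^ 2) u))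
      (extChartAt IT u u) (0, η) (0, ζ) := by
  have h0 : (fun w : E2 => F ⟨u.proj, w⟩ ^ 2) =
      fun w => localFun (fun w => F w ^ 2) u ((extChartAt IT u u).1, w) := by
    funext w
    rw [localFun, Function.comp_apply, chart_self_symm_mk]
  rw [← fderiv_fderiv_vert hF, chart_self_snd, ← h0]
  rfl

theorem finrank_range_eq_two_iff (B : E2 →ₗ[ℝ] E2 →L[ℝ] ℝ) :
    Module.finrank ℝ (LinearMap.range B) = 2 ↔ ∀ η, (∀ ζ, B η ζ = 0) → η = 0 := by
  have h1 := B.finrank_range_add_finrank_ker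
  rw [finrank_euclideanSpace_fin] at h1
  have h2 : Module.finrank ℝ (LinearMap.range B) = 2 ↔ LinearMap.ker B = ⊥ := by
    rw [← Submodule.finrank_eq_zero (R := ℝ)]
    omega
  rw [h2, LinearMap.ker_eq_bot']
  exact forall_congr' fun η => imp_congr_left
    ⟨fun h ζ => by rw [h]; rfl, fun h => ContinuousLinearMap.ext h⟩

namespace IsSpray
variable {S : VField M} {A : Set (TB M)} {F : TB M → ℝ}

/-- Where `d F² = 2 F² ω`, the metric tensor is non-degenerate exactly if the spray is
transversal. -/
theorem metricTensor_rank_iff (hS : IsSpray S A) (hA : IsOpenCone A) (hnf : NonFlat S A)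
    {u : TB M} (huA : u ∈ A) (hpos : F u ≠ 0)
    (hE : ∀ z ∈ coneL A u, ContDiffAt ℝ ∞ (localFun (fun w => F w ^ 2) u) z)
    (hω : ∀ z ∈ coneL A u, fderiv ℝ (localFun (fun w => F w ^ 2) u) z =
      (2 * localFun (fun w => F w ^ 2) u z) • omegaL (sprayL S u) z)
    (hcl : extd (berwaldForm S) u = 0) :
    Module.finrank ℝ (LinearMap.range (metricTensor F u)) = 2 ↔
      IsTransversal (sprayL S u) (extChartAt IT u u) := by
  have hu := mem_extChartAt_source (I := IT) u
  have h := hS.isLocalSpray hA hnf u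
  have hz := mem_coneL hu huA
  rw [finrank_range_eq_two_iff, ← h.isTransversal_iff hz (h.fderiv_betaL_symm hz
      ((hS.extd_berwaldForm_eq_zero_iff hA hnf hu huA).1 hcl)) (k := 2) (by norm_num)]
  refine forall_congr' fun η => imp_congr_left (forall_congr' fun ζ => ?_)
  rw [metricTensor_apply ((hE _ hz).of_le (WithTop.coe_le_coe.2 le_top)),
    h.fderiv_fderiv_energy hE hω hz, localFun_chart _ hu]
  have : F u ^ 2 ≠ 0 := pow_ne_zero 2 hpos
  simp [this]

/-- The energy `F²` of a Finsler function that metrizes `S` satisfies `d F² = 2 F² ω`. -/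
theorem fderiv_energy (hS : IsSpray S A) (hA : IsOpenCone A) (hnf : NonFlat S A)
    (hF : Metrizes S F A) (p : TB M) : ∀ z ∈ coneL A p,
      ContDiffAt ℝ ∞ (localFun (fun w => F w ^ 2) p) z ∧
      fderiv ℝ (localFun (fun w => F w ^ 2) p) z =
        (2 * localFun (fun w => F w ^ 2) p z) • omegaL (sprayL S p) z := by
  obtain ⟨hFin, hEL⟩ := hF
  have hsm : ContMDiffOn IT 𝓘(ℝ, ℝ) ∞ (fun w => F w ^ 2) A := hFin.smooth.pow 2
  have h := hS.isLocalSpray hA hnf p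
  have hE : ∀ z ∈ coneL A p, ContDiffAt ℝ ∞ (localFun (fun w => F w ^ 2) p) z := by
    intro z hz
    obtain ⟨u, hu, huA, rfl⟩ := exists_of_mem_coneL hz
    exact localFun_contDiffAt hu ((hsm u huA).contMDiffAt (hA.isOpen.mem_nhds huA))
  have heul : ∀ z ∈ coneL A p, fderiv ℝ (localFun (fun w => F w ^ 2) p) z (0, z.2) =
      2 * localFun (fun w => F w ^ 2) p z := by
    intro z hz
    have h1 : HasDerivAt (fun t : ℝ => ((z.1, t • z.2) : E4)) (0, z.2) 1 := by
      have := (hasDerivAt_const (1 : ℝ) z.1).prodMk ((hasDerivAt_id (1 : ℝ)).smul_const z.2)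
      simpa using this
    have h2 : HasFDerivAt (localFun (fun w => F w ^ 2) p)
        (fderiv ℝ (localFun (fun w => F w ^ 2) p) z) (z.1, (1 : ℝ) • z.2) := by
      rw [one_smul]
      exact ((hE z hz).differentiableAt (by simp)).hasFDerivAt
    have h3 := HasFDerivAt.comp_hasDerivAt (1 : ℝ) h2 h1
    have h4 : HasDerivAt (fun t : ℝ => t ^ 2 * localFun (fun w => F w ^ 2) p z)
        (2 * localFun (fun w => F w ^ 2) p z) 1 := by
      have := (hasDerivAt_pow 2 (1 : ℝ)).mul_const (localFun (fun w => F w ^ 2) p z)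
      simpa using this
    refine h3.unique (h4.congr_of_eventuallyEq ?_)
    filter_upwards [lt_mem_nhds (zero_lt_one' ℝ)] with t ht
    rw [Function.comp_apply, localFun_smul _ hz.1, hFin.homogeneous _ hz.2 t ht, mul_pow]
    rfl
  refine fun z hz => ⟨hE z hz, h.fderiv_energy hE heul (fun z hz ξ => ?_) hz⟩
  obtain ⟨u, hu, huA, rfl⟩ := exists_of_mem_coneL hz
  obtain ⟨ξ, rfl⟩ := (dchart_bijective hu).2 ξ
  have h1 := hEL u huA ξ
  rw [extd_dAlong0_J hA.isOpen hsm hu huA, ← localVField_chart S hu, hS.localVField_eq hz,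
    ← fderiv_localFun hu (((hsm u huA).contMDiffAt (hA.isOpen.mem_nhds huA)).mdifferentiableAt
      (by simp))] at h1
  exact h1

theorem isPrimitive_of_metrizes (hS : IsSpray S A) (hA : IsOpenCone A) (hnf : NonFlat S A)
    (hF : Metrizes S F A) :
    IsPrimitive (fun u => Real.log (F u ^ 2) / 2) (berwaldForm S) A := by
  refine hS.isPrimitive_of_hasFDerivAt hA hnf fun u huA =>
    ⟨u, mem_extChartAt_source u, fun z hz => ?_⟩
  obtain ⟨h1, h2⟩ := hS.fderiv_energy hA hnf hF u z hz
  have hpos : localFun (fun w => F w ^ 2) u z ≠ 0 := pow_ne_zero 2 (hF.1.pos _ hz.2).ne'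
  have h3 := ((h1.differentiableAt (by simp)).hasFDerivAt.log hpos).mul_const (1 / 2 : ℝ)
  have e : omegaL (sprayL S u) z = (1 / 2 : ℝ) • (localFun (fun w => F w ^ 2) u z)⁻¹ •
      fderiv ℝ (localFun (fun w => F w ^ 2) u) z := by
    rw [h2, smul_smul, smul_smul]
    have : (1 / 2 : ℝ) * ((localFun (fun w => F w ^ 2) u z)⁻¹ *
        (2 * localFun (fun w => F w ^ 2) u z)) = 1 := by field_simp
    rw [mul_assoc, this, one_smul]
  rw [e]
  refine h3.congr_of_eventuallyEq (Eventually.of_forall fun w => ?_)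
  simp only [localFun, Function.comp_apply]
  ring

/-- If `F = exp f` with `df = ω`, then `d F² = 2 F² ω`. -/
theorem energy_of_isPrimitive (hS : IsSpray S A) (hA : IsOpenCone A) (hnf : NonFlat S A)
    {f : TB M → ℝ} (hf : IsPrimitive f (berwaldForm S) A) (hF : ∀ u ∈ A, F u = Real.exp (f u))
    (p : TB M) : ∀ z ∈ coneL A p,
      ContDiffAt ℝ ∞ (localFun (fun w => F w ^ 2) p) z ∧
      fderiv ℝ (localFun (fun w => F w ^ 2) p) z =
        (2 * localFun (fun w => F w ^ 2) p z) • omegaL (sprayL S p) z := by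
  intro z hz
  have h := hS.isLocalSpray hA hnf p
  have hp := hS.hasFDerivAt_of_isPrimitive hA hf p
  have e : localFun (fun w => F w ^ 2) p =ᶠ[𝓝 z] fun w => Real.exp (2 * localFun f p w) := by
    filter_upwards [h.mem_nhds hz] with w hw
    change F _ ^ 2 = _
    rw [hF _ hw.2, ← Real.exp_nat_mul]
    rfl
  have h1 := ((hp z hz).const_mul 2).exp.congr_of_eventuallyEq e
  refine ⟨((contDiffAt_const.mul (h.contDiffAt_primitive hp hz)).exp).congr_of_eventuallyEq e, ?_⟩
  rw [h1.fderiv, e.self_of_nhds, smul_smul, mul_comm]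

theorem metrizes_of_isPrimitive (hS : IsSpray S A) (hA : IsOpenCone A) (hnf : NonFlat S A)
    (ht : ∀ u ∈ A, IsTransversal (sprayL S u) (extChartAt IT u u))
    {f : TB M → ℝ} (hf : IsPrimitive f (berwaldForm S) A) (hF : ∀ u ∈ A, F u = Real.exp (f u)) :
    Metrizes S F A := by
  have hpos : ∀ u ∈ A, 0 < F u := fun u hu => by rw [hF u hu]; exact Real.exp_pos _
  have hsm : ContMDiffOn IT 𝓘(ℝ, ℝ) ∞ F A := by
    have : ContMDiffOn IT 𝓘(ℝ, ℝ) ∞ (fun u => Real.exp (f u)) A :=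
      Real.contDiff_exp.contMDiff.comp_contMDiffOn hf.1
    exact this.congr hF
  have hsm2 : ContMDiffOn IT 𝓘(ℝ, ℝ) ∞ (fun w => F w ^ 2) A := hsm.pow 2
  have key := hS.energy_of_isPrimitive hA hnf hf hF
  refine ⟨⟨hsm, hpos, fun u huA c hc => ?_, fun u huA => ?_⟩, fun u huA ξ => ?_⟩
  · rw [hF _ (hA.smul_mem u huA c hc), hS.isPrimitive_smul hA hnf hf huA hc, Real.exp_add,
      Real.exp_log hc, hF u huA, mul_comm]
  · exact (hS.metricTensor_rank_iff hA hnf huA (hpos u huA).ne' (fun z hz => (key u z hz).1)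
      (fun z hz => (key u z hz).2) (hS.extd_berwaldForm_of_isPrimitive hA hnf hf huA)).2 (ht u huA)
  · have hu := mem_extChartAt_source (I := IT) u
    have hz := mem_coneL hu huA
    rw [extd_dAlong0_J hA.isOpen hsm2 hu huA, ← localVField_chart S hu, hS.localVField_eq hz,
      (hS.isLocalSpray hA hnf u).eulerLagrange_of_fderiv (fun z hz => (key u z hz).1)
        (fun z hz => (key u z hz).2) hz, fderiv_localFun hu
        (((hsm2 u huA).contMDiffAt (hA.isOpen.mem_nhds huA)).mdifferentiableAt (by simp))]

theorem isTransversal_of_metrizes (hS : IsSpray S A) (hA : IsOpenCone A) (hnf : NonFlat S A)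
    (hF : Metrizes S F A) {u : TB M} (huA : u ∈ A) :
    IsTransversal (sprayL S u) (extChartAt IT u u) :=
  (hS.metricTensor_rank_iff hA hnf huA (hF.1.pos u huA).ne'
    (fun z hz => (hS.fderiv_energy hA hnf hF u z hz).1)
    (fun z hz => (hS.fderiv_energy hA hnf hF u z hz).2)
    (hS.extd_berwaldForm_of_isPrimitive hA hnf (hS.isPrimitive_of_metrizes hA hnf hF) huA)).1
    (hF.1.regular u huA)

end IsSpray

/-! ### The equivalences -/

/-- The form `ω` is closed, and `∂β/∂y` has no kernel inside `ker β`. Both conditions are read in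
the chart around the base point. -/
def IsClosedTransversal (S : VField M) (A : Set (TB M)) : Prop :=
  ∀ u ∈ A, extd (berwaldForm S) u = 0 ∧ IsTransversal (sprayL S u) (extChartAt IT u u)

namespace IsSpray
variable {S : VField M} {A : Set (TB M)} {F : TB M → ℝ}

theorem metrizes_iff (hS : IsSpray S A) (hA : IsOpenCone A) (hnf : NonFlat S A)
    (h : IsClosedTransversal S A) : Metrizes S F A ↔
      ∃ f : TB M → ℝ, IsPrimitive f (berwaldForm S) A ∧ ∀ u ∈ A, F u = Real.exp (f u) := by
  refine ⟨fun hF => ⟨_, hS.isPrimitive_of_metrizes hA hnf hF, fun u huA => ?_⟩,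
    fun ⟨f, hf, hF⟩ => hS.metrizes_of_isPrimitive hA hnf (fun u hu => (h u hu).2) hf hF⟩
  -- the primitive is `log (F²) / 2 = log F`
  rw [Real.log_pow, Nat.cast_two, mul_div_cancel_left₀ _ two_ne_zero,
    Real.exp_log (hF.1.pos u huA)]

theorem metrizable_iff (hS : IsSpray S A) (hA : IsOpenCone A) (hnf : NonFlat S A) :
    Metrizable S A ↔ IsClosedTransversal S A := by
  constructor
  · intro h u huA
    obtain ⟨A', hAA, hA', hu, F, hF⟩ := h u huA
    have hS' := hS.mono hAA
    have hnf' : NonFlat S A' := fun v hv => hnf v (hAA hv)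
    exact ⟨hS'.extd_berwaldForm_of_isPrimitive hA' hnf' (hS'.isPrimitive_of_metrizes hA' hnf' hF)
      hu, hS'.isTransversal_of_metrizes hA' hnf' hF hu⟩
  · intro h u huA
    obtain ⟨A', hAA, hA', hu, f, hf⟩ := hS.exists_isPrimitive hA hnf (fun v hv => (h v hv).1) huA
    exact ⟨A', hAA, hA', hu, fun v => Real.exp (f v),
      ((hS.mono hAA).metrizes_iff hA' (fun v hv => hnf v (hAA hv)) fun v hv => h v (hAA hv)).2
        ⟨f, hf, fun _ _ => rfl⟩⟩

theorem regular_and_isIntegrable_iff (hS : IsSpray S A) (hA : IsOpenCone A) (hnf : NonFlat S A) :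
    Regular S A ∧ IsIntegrable 3 (berwald S) A ↔ IsClosedTransversal S A := by
  constructor
  · rintro ⟨hr, hi⟩ u huA
    have hcl := hS.extd_berwaldForm_of_isIntegrable hA hnf hi huA
    exact ⟨hcl, (hS.omega_rankAt_iff hA hnf huA hcl).1 (hr u huA)⟩
  · intro h
    exact ⟨fun u huA => (hS.omega_rankAt_iff hA hnf huA (h u huA).1).2 (h u huA).2,
      hS.isIntegrable_berwald hA hnf fun u huA => (h u huA).1⟩

theorem exists_closed_form_iff (hS : IsSpray S A) (hA : IsOpenCone A) (hnf : NonFlat S A) :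
    (∃ θ : Form1 M, IsClosedForm θ A ∧ Annihilates S θ A ∧ ∀ u ∈ A, (rankForm θ).rankAt u = 4) ↔
      IsClosedTransversal S A := by
  constructor
  · rintro ⟨θ, hcl, hθ, hr⟩ u huA
    exact hS.closed_and_transversal_of_rankForm hA hnf hcl hθ huA (hr u huA)
  · intro h
    exact ⟨berwaldForm S, ⟨hS.smoothOn_berwaldForm hA hnf, fun u huA => (h u huA).1⟩,
      hS.annihilates_berwaldForm hA hnf, fun u huA =>
        hS.rankForm_berwaldForm hA hnf (fun v hv => (h v hv).1) huA (h u huA).2⟩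

end IsSpray

end Spray

end

theorem theorem1 {M : Type*} [TopologicalSpace M] [ChartedSpace Spray.E2 M]
    [IsManifold (𝓡 2) ∞ M]
    (A : Set (Spray.TB M)) (hA : Spray.IsOpenCone A)
    (S : Spray.VField M) (hS : Spray.IsSpray S A) (hnf : Spray.NonFlat S A) :
    List.TFAE [
      Spray.Metrizable S A,
      Spray.Regular S A ∧ Spray.IsIntegrable 3 (Spray.berwald S) A,
      ∃ θ : Spray.Form1 M, Spray.IsClosedForm θ A ∧ Spray.Annihilates S θ A ∧
        ∀ u ∈ A, (Spray.rankForm θ).rankAt u = 4] ∧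
    (Spray.Metrizable S A →
      ∃ θ : Spray.Form1 M,
        (Spray.IsClosedForm θ A ∧ Spray.Annihilates S θ A ∧
          (∀ u ∈ A, (Spray.rankForm θ).rankAt u = 4) ∧
          (∀ u ∈ A, θ u (Spray.liouville M u) = 1)) ∧
        (∀ θ' : Spray.Form1 M, Spray.IsClosedForm θ' A → Spray.Annihilates S θ' A →
          (∀ u ∈ A, θ' u (Spray.liouville M u) = 1) → ∀ u ∈ A, θ' u = θ u) ∧
        (∀ u ∈ A, ∃ A' ⊆ A, Spray.IsOpenCone A' ∧ u ∈ A' ∧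
          ∃ f : Spray.TB M → ℝ, Spray.IsPrimitive f θ A') ∧
        (∀ A' ⊆ A, Spray.IsOpenCone A' → ∀ F : Spray.TB M → ℝ,
          Spray.Metrizes S F A' ↔
            ∃ f : Spray.TB M → ℝ, Spray.IsPrimitive f θ A' ∧
              ∀ u ∈ A', F u = Real.exp (f u))) := by
  have h1 := hS.metrizable_iff hA hnf
  have h2 := hS.regular_and_isIntegrable_iff hA hnf
  have h3 := hS.exists_closed_form_iff hA hnf
  refine ⟨?_, fun hm => ?_⟩
  · tfae_have 1 ↔ 2 := h1.trans h2.symm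
    tfae_have 1 ↔ 3 := h1.trans h3.symm
    tfae_finish
  · have h := h1.1 hm
    refine ⟨Spray.berwaldForm S, ⟨⟨hS.smoothOn_berwaldForm hA hnf, fun u hu => (h u hu).1⟩,
      hS.annihilates_berwaldForm hA hnf, fun u hu =>
        hS.rankForm_berwaldForm hA hnf (fun v hv => (h v hv).1) hu (h u hu).2,
      fun u hu => hS.berwaldForm_liouville hA hnf hu⟩, fun θ' _ hθ hC u hu => ?_,
      fun u hu => hS.exists_isPrimitive hA hnf (fun v hv => (h v hv).1) hu,
      fun A' hAA hA' F => (hS.mono hAA).metrizes_iff hA' (fun v hv => hnf v (hAA hv))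
        fun v hv => h v (hAA hv)⟩
    refine ContinuousLinearMap.ext fun ξ => ?_
    rw [hS.eq_mul_berwaldForm hA hnf hθ hu, hC u hu, one_mul]
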